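/- For a finite graph $G=(V,E)$ let the edge expansion be $h(G)=\min\{|\partial S|/|S| : S\subseteq V,\ 1\le |S|\le |V|/2\}$, where $\partial S$ is the set of edges with exactly one endpoint in $S$ (and $h(G)=\infty$ if $|V|\le 1$). Under geodesic routing every unordered pair of distinct vertices exchanges one unit of traffic, which is divided equally among all shortest paths between the two vertices. Let $\mathcal L_G(v)$ be the total traffic passing through $v$ (traffic that starts or ends at $v$ included), and let $M(G)=\max_v \mathcal L_G(v)$ be the maximum vertex congestion. (i) There are constants $\beta,\kappa_1,\kappa_2>0$ and a family $\{G_n\}_{n\ge 1}$ of connected simple graphs, $G_n$ having exactly $n$ vertices, such that for every $n\ge1$ the graph $G_n$ has maximum degree at most $4$, $h(G_n)\ge\beta$ and $M(G_n)\le\kappa_2 n^2$, and for every $n\ge 2$ also $M(G_n)\ge\kappa_1n^2$. Thus $\{G_n\}$ is a constant-degree expander family with congestion $\Theta(n^2)$. (ii) Moreover, the following construction gives such graphs. For $k\ge 0$ let $T$ be the rooted tree of depth $2k$ in which each node at depth less than $k$ has $3$ children and each node at depth $k,\dots,2k-1$ has $2$ children; it has $N=6^k$ leaves. Let $A$ be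 a graph of maximum degree at most $3$ on $2N$ vertices, and match the $2N$ leaves of two copies $T_L,T_R$ of $T$ bijectively with the vertices of $A$. Form a graph from $T_L$, $T_R$, $A$, a new vertex $v^*$ joined to both roots, and a matching edge between each leaf and the vertex of $A$ matched with it; then replace every edge of $A$ and every matching edge by a path of length $c$. Call the result $G$. There are an even integer $c>0$ and constants $K,\kappa_1,\kappa_2>0$ such that for every $\alpha>0$ there is $\beta>0$ with the following property: for every $k\ge0$, every such $A$ with $h(A)\ge\alpha$ and every matching, the graph $G$ is connected, has maximum degree at most $4$, satisfies $h(G)\ge\beta$ and $N\le|V(G)|\le K N$, for at least $N^2/2$ of the pairs (leaf of $T_L$, leaf of $T_R$) all shortest paths in $G$ between the two leaves pass through $v^*$, and $\kappa_1|V(G)|^2\le M(G)\le\kappa_2|V(G)|^2$. -/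

import Mathlib

open scoped NNReal ENNReal

/-! ### Edge expansion -/

/-- The edge boundary of `S`: the edges with exactly one endpoint in `S`. -/
def edgeBoundary {V : Type*} (G : SimpleGraph V) (S : Finset V) : Set (Sym2 V) :=
  {e | e ∈ G.edgeSet ∧ ∃ u ∈ S, ∃ v ∉ S, e = s(u, v)}

/-- The edge expansion (isoperimetric number, Cheeger constant): the minimum of `|∂S| / |S|` over
the vertex sets `S` with `1 ≤ |S| ≤ |V| / 2`. It is `∞` if there is no such set, that is, if
`|V| ≤ 1`. -/
noncomputable def edgeExpansion {V : Type*} [Fintype V] (G : SimpleGraph V) : ℝ≥0∞ :=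
  ⨅ (S : Finset V) (_ : 1 ≤ S.card ∧ 2 * S.card ≤ Fintype.card V),
    ((edgeBoundary G S).ncard : ℝ≥0∞) / (S.card : ℝ≥0∞)

/-! ### Traffic under geodesic routing -/

/-- The geodesics (shortest paths) from `x` to `y`. -/
def geodesics {V : Type*} (G : SimpleGraph V) (x y : V) : Set (G.Walk x y) :=
  {w | w.length = G.dist x y}

/-- The part of a unit flow from `x` to `y`, divided equally among the geodesics from `x` to `y`,
that passes through `v` (endpoints included). -/
noncomputable def pairFlow {V : Type*} (G : SimpleGraph V) (x y v : V) : ℝ :=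
  ({w | w ∈ geodesics G x y ∧ v ∈ w.support}.ncard : ℝ) / ((geodesics G x y).ncard : ℝ)

open Classical in
/-- The total traffic through `v`, with a unit flow for every unordered pair of distinct vertices
(hence the factor `1 / 2` in front of the sum over ordered pairs). -/
noncomputable def traffic {V : Type*} [Fintype V] (G : SimpleGraph V) (v : V) : ℝ :=
  (1 / 2 : ℝ) * ∑ p ∈ (Finset.univ : Finset V).offDiag, pairFlow G p.1 p.2 v

/-- The maximum vertex congestion. -/
noncomputable def maxCongestion {V : Type*} [Fintype V] (G : SimpleGraph V) : ℝ :=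
  ⨆ v : V, traffic G v

/-! ### The tree of depth `2 * k` with branching `3` in its upper and `2` in its lower half -/

/-- The number of children of a node at depth `d < 2 * k`. -/
def branching (k d : ℕ) : ℕ := if d < k then 3 else 2

/-- The number of nodes at depth `d`. -/
def levelSize (k : ℕ) : ℕ → ℕ
  | 0 => 1
  | d + 1 => levelSize k d * branching k d

/-- A node is a pair of its depth `d ≤ 2 * k` and its number within its level. -/
abbrev TreeNode (k : ℕ) : Type := Σ d : Fin (2 * k + 1), Fin (levelSize k d)

/-- Node `i` at depth `d` has as children the nodes `b * i, …, b * i + (b - 1)` at depth `d + 1`,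
where `b = branching k d`. -/
def IsParent {k : ℕ} (x y : TreeNode k) : Prop :=
  (y.1 : ℕ) = x.1 + 1 ∧ (y.2 : ℕ) / branching k x.1 = x.2

/-- The root. -/
def treeRoot (k : ℕ) : TreeNode k := ⟨⟨0, Nat.succ_pos _⟩, ⟨0, Nat.one_pos⟩⟩

/-- The leaves are the nodes at depth `2 * k`. -/
abbrev TreeLeaf (k : ℕ) : Type := Fin (levelSize k (2 * k))

/-- A leaf as a node. -/
def TreeLeaf.node {k : ℕ} (l : TreeLeaf k) : TreeNode k := ⟨Fin.last (2 * k), l⟩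

theorem levelSize_of_le {k d : ℕ} (h : d ≤ k) : levelSize k d = 3 ^ d := by
  induction d with
  | zero => rfl
  | succ d ih =>
    have hd : d < k := h
    simp [levelSize, branching, hd, ih hd.le, pow_succ]

theorem levelSize_add (k d : ℕ) : levelSize k (k + d) = 3 ^ k * 2 ^ d := by
  induction d with
  | zero => simp [levelSize_of_le le_rfl]
  | succ d ih =>
    have : levelSize k (k + (d + 1)) = levelSize k (k + d) * branching k (k + d) := rfl
    rw [this, ih]
    simp [branching, pow_succ, mul_assoc]

/-- There are `6 ^ k` leaves. -/
theorem levelSize_leaves (k : ℕ) : levelSize k (2 * k) = 6 ^ k := by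
  rw [two_mul, levelSize_add, ← mul_pow]; norm_num

/-! ### Replacing edges by paths -/

/-- The vertices of the graph that arises from `H` when the edges in `F` are replaced by paths of
length `c`: those of `H` and `c - 1` new ones for each edge in `F`. -/
abbrev SubdivVertex {V : Type*} (H : SimpleGraph V) (F : Set (Sym2 V)) (c : ℕ) : Type _ :=
  V ⊕ ({e : Sym2 V // e ∈ H.edgeSet ∧ e ∈ F} × Fin (c - 1))

noncomputable instance {V : Type*} [Fintype V] (H : SimpleGraph V) (F : Set (Sym2 V)) :
    Fintype {e : Sym2 V // e ∈ H.edgeSet ∧ e ∈ F} :=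
  Fintype.ofFinite _

/-- The `j`-th vertex, `0 ≤ j ≤ c`, of the path of length `c` that replaces the edge `e`; the path
joins the two endpoints of `e`. -/
noncomputable def pathPoint {V : Type*} (H : SimpleGraph V) (F : Set (Sym2 V)) (c : ℕ)
    (e : {e : Sym2 V // e ∈ H.edgeSet ∧ e ∈ F}) (j : ℕ) : SubdivVertex H F c :=
  if h₀ : j = 0 then Sum.inl (Quot.out e.1).1
  else if h : j < c then Sum.inr (e, ⟨j - 1, by omega⟩)
  else Sum.inl (Quot.out e.1).2

/-- The edges of the new graph: the edges of `H` outside `F`, and the edges of the new paths. -/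
inductive SubdivRel {V : Type*} (H : SimpleGraph V) (F : Set (Sym2 V)) (c : ℕ) :
    SubdivVertex H F c → SubdivVertex H F c → Prop
  | keep (u v : V) (huv : H.Adj u v) (hF : s(u, v) ∉ F) :
      SubdivRel H F c (Sum.inl u) (Sum.inl v)
  | path (e : {e : Sym2 V // e ∈ H.edgeSet ∧ e ∈ F}) (j : ℕ) (hj : j < c) :
      SubdivRel H F c (pathPoint H F c e j) (pathPoint H F c e (j + 1))

/-- The graph `H` with every edge in `F` replaced by a path of length `c`. -/
def subdivide {V : Type*} (H : SimpleGraph V) (F : Set (Sym2 V)) (c : ℕ) :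
    SimpleGraph (SubdivVertex H F c) :=
  SimpleGraph.fromRel (SubdivRel H F c)

/-! ### Two trees joined through an expander and an apex -/

/-- The vertices before edges are replaced by paths: the apex, two copies of the tree, and the
`2 * 6 ^ k` vertices of the expander. -/
abbrev BaseVertex (k : ℕ) : Type := Unit ⊕ ((Bool × TreeNode k) ⊕ Fin (2 * 6 ^ k))

/-- The apex. -/
def baseApex (k : ℕ) : BaseVertex k := Sum.inl ()

/-- The node `x` of copy `s` of the tree. -/
def baseTree {k : ℕ} (s : Bool) (x : TreeNode k) : BaseVertex k := Sum.inr (Sum.inl (s, x))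

/-- A vertex of the expander. -/
def baseExp {k : ℕ} (a : Fin (2 * 6 ^ k)) : BaseVertex k := Sum.inr (Sum.inr a)

/-- The edges: the apex is joined to both roots, the trees and `A` keep their edges, and every leaf
is joined to the vertex of `A` that it is matched with. -/
inductive BaseRel {k : ℕ} (A : SimpleGraph (Fin (2 * 6 ^ k)))
    (m : Bool × TreeLeaf k ≃ Fin (2 * 6 ^ k)) : BaseVertex k → BaseVertex k → Prop
  | apex (s : Bool) : BaseRel A m (baseApex k) (baseTree s (treeRoot k))
  | tree (s : Bool) (x y : TreeNode k) (h : IsParent x y) :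
      BaseRel A m (baseTree s x) (baseTree s y)
  | matching (s : Bool) (l : TreeLeaf k) : BaseRel A m (baseTree s l.node) (baseExp (m (s, l)))
  | expander (a b : Fin (2 * 6 ^ k)) (h : A.Adj a b) : BaseRel A m (baseExp a) (baseExp b)

/-- The graph before edges are replaced by paths. -/
def baseGraph {k : ℕ} (A : SimpleGraph (Fin (2 * 6 ^ k)))
    (m : Bool × TreeLeaf k ≃ Fin (2 * 6 ^ k)) : SimpleGraph (BaseVertex k) :=
  SimpleGraph.fromRel (BaseRel A m)

/-- The pairs with an endpoint in the expander; the edges among them are the expander edges and the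
matching edges. -/
def longEdges (k : ℕ) : Set (Sym2 (BaseVertex k)) := {e | ∃ a, baseExp a ∈ e}

/-- The vertices of the final graph. -/
abbrev JoinVertex {k : ℕ} (A : SimpleGraph (Fin (2 * 6 ^ k)))
    (m : Bool × TreeLeaf k ≃ Fin (2 * 6 ^ k)) (c : ℕ) : Type :=
  SubdivVertex (baseGraph A m) (longEdges k) c

/-- The final graph: expander edges and matching edges are replaced by paths of length `c`. -/
def joinGraph {k : ℕ} (A : SimpleGraph (Fin (2 * 6 ^ k)))
    (m : Bool × TreeLeaf k ≃ Fin (2 * 6 ^ k)) (c : ℕ) : SimpleGraph (JoinVertex A m c) :=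
  subdivide (baseGraph A m) (longEdges k) c

/-- The apex of the final graph. -/
def joinApex {k : ℕ} (A : SimpleGraph (Fin (2 * 6 ^ k)))
    (m : Bool × TreeLeaf k ≃ Fin (2 * 6 ^ k)) (c : ℕ) : JoinVertex A m c :=
  Sum.inl (baseApex k)

/-- The leaf `l` of copy `s` of the tree, as a vertex of the final graph. -/
def joinLeaf {k : ℕ} (A : SimpleGraph (Fin (2 * 6 ^ k)))
    (m : Bool × TreeLeaf k ≃ Fin (2 * 6 ^ k)) (c : ℕ) (s : Bool) (l : TreeLeaf k) :
    JoinVertex A m c :=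
  Sum.inl (baseTree s l.node)

/-- The pairs of a leaf in the first tree and a leaf in the second tree all of whose geodesics pass
through the apex. -/
def apexPairs {k : ℕ} (A : SimpleGraph (Fin (2 * 6 ^ k)))
    (m : Bool × TreeLeaf k ≃ Fin (2 * 6 ^ k)) (c : ℕ) : Set (TreeLeaf k × TreeLeaf k) :=
  {p | ∀ w ∈ geodesics (joinGraph A m c) (joinLeaf A m c false p.1) (joinLeaf A m c true p.2),
    joinApex A m c ∈ w.support}

/-! ### Edge boundaries and expansion -/

section Expansion

open Finset
open scoped Classical

variable {V : Type*} {G : SimpleGraph V}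

/-! The upper bound on the congestion is trivial: a pair of vertices contributes at most 1 at any
vertex. The lower bound comes from the apex. The route through it joins two leaves of different
trees with length `4 * k + 2`, and from each leaf at least half of the leaves of the other tree turn
out to have no route of at most that length avoiding the apex (`card_reached_le`).

To see this, measure walks in half-lengths. Climbing to height `h` and coming down again costs `h`
and gives a choice of `leavesBelow k h` leaves, which is `2 ^ h` for `h ≤ k` and `2 ^ k * 3 ^ (h -
k)` above. Every edge of the expander and every matching edge costs `c / 2 = 6`. The budget is `2 *
k + 1`, and there are `6 ^ k` leaves, so a growth rate below `√6` per unit is harmless. The slower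
branching near the leaves provides the slack: short climbs grow at rate 2, so walks composed of many
of them stay below rate `12 / 5 < √6`, and a climb above height `k` is governed by the term `(2 / 3)
^ k * 3 ^ t`, which is `6 ^ k` only at the very end of the budget. The function `growth` is stable,
up to the factor 11, under convolution with `leavesBelow` (`sum_leavesBelow_mul_growth_le`), while a
long edge gains a factor 100 (`growth_le`). A crossing to the other tree needs long edges, so few
leaves are reached. Only the degree bound on `A` enters this count, not its expansion.

Expansion is always carried from one graph to the next by `le_edgeExpansion_of_transfer`: a vertex
set is controlled by its trace on a core, up to multiples of its boundary. The cores are the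
expander inside the base graph, the old vertices inside a subdivision or a graph with pendant paths,
and the grid inside the cubic graph.

For the family with all sizes, explicit cubic expanders are needed. They come from translations and
shears of `(ℤ/m)²`, whose spectral gap `sum_norm_sq_le_dirichlet` is proved by Fourier transform and
a ping-pong argument for the shears on the frequencies. The sizes in between are filled by pendant
paths at the leaves. Retracting these paths turns geodesics into geodesics, so the congestion at the
apex survives (`geodesics_through_of_retract`). Finitely many small sizes are covered by paths. -/

theorem card_crossing_le {ι : Type*} [Finite V] [Fintype ι] (S : Finset V) (x y : ι → V)
    (hadj : ∀ i, G.Adj (x i) (y i)) (hinj : Function.Injective fun i => (x i, y i)) :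
    #{i | x i ∈ S ∧ y i ∉ S} ≤ (edgeBoundary G S).ncard := by
  rw [← Set.ncard_coe_finset]
  refine Set.ncard_le_ncard_of_injOn (fun i => s(x i, y i)) ?_ ?_ (Set.toFinite _)
  · intro i hi
    simp only [coe_filter, mem_univ, true_and, Set.mem_ofPred_eq] at hi
    exact ⟨hadj i, x i, hi.1, y i, hi.2, rfl⟩
  · intro i hi j hj hij
    simp only [coe_filter, mem_univ, true_and, Set.mem_ofPred_eq] at hi hj
    rcases Sym2.eq_iff.1 hij with h | h
    · exact hinj (Prod.ext h.1 h.2)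
    · exact absurd (h.1 ▸ hi.1) hj.2

theorem edgeBoundary_compl [Fintype V] (S : Finset V) : edgeBoundary G Sᶜ = edgeBoundary G S := by
  ext e
  constructor
  · rintro ⟨he, u, hu, v, hv, rfl⟩
    exact ⟨he, v, by simpa using hv, u, by simpa using hu, Sym2.eq_swap⟩
  · rintro ⟨he, u, hu, v, hv, rfl⟩
    exact ⟨he, v, by simpa using hv, u, by simpa using hu, Sym2.eq_swap⟩

theorem edgeBoundary_univ [Fintype V] : edgeBoundary G univ = ∅ := by
  ext e
  simp [edgeBoundary]

/-- `1` if `S` separates `x` and `y`, otherwise `0`. -/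
noncomputable def sep (S : Finset V) (x y : V) : ℕ := if x ∈ S ↔ y ∈ S then 0 else 1

/-- Injectivity is required of the ordered pairs only, so an edge may occur once in each direction;
hence the factor 2. -/
theorem sum_sep_le {ι : Type*} [Fintype V] [Fintype ι] (S : Finset V) (x y : ι → V)
    (hadj : ∀ i, G.Adj (x i) (y i)) (hinj : Function.Injective fun i => (x i, y i)) :
    ∑ i, sep S (x i) (y i) ≤ 2 * (edgeBoundary G S).ncard := by
  have h1 := card_crossing_le S x y hadj hinj
  have h2 := card_crossing_le Sᶜ x y hadj hinj
  rw [edgeBoundary_compl] at h2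
  have h3 : ({i | ¬(x i ∈ S ↔ y i ∈ S)} : Finset ι) ⊆
      ({i | x i ∈ S ∧ y i ∉ S} : Finset ι) ∪ ({i | x i ∈ Sᶜ ∧ y i ∉ Sᶜ} : Finset ι) := by
    intro i
    simp only [mem_filter, mem_univ, true_and, mem_union, mem_compl, not_not]
    tauto
  have h4 := (card_le_card h3).trans (card_union_le _ _)
  have h5 : ∑ i, sep S (x i) (y i) = #({i | ¬(x i ∈ S ↔ y i ∈ S)} : Finset ι) := by
    rw [card_filter]
    exact sum_congr rfl fun i _ => by unfold sep; split_ifs <;> simp_all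
  omega

theorem sep_triangle (S : Finset V) (x y z : V) : sep S x z ≤ sep S x y + sep S y z := by
  unfold sep
  by_cases hx : x ∈ S <;> by_cases hy : y ∈ S <;> by_cases hz : z ∈ S <;> simp [hx, hy, hz]

theorem sep_comm (S : Finset V) (x y : V) : sep S x y = sep S y x := by
  unfold sep
  simp only [iff_comm]

theorem sep_self (S : Finset V) (x : V) : sep S x x = 0 := by
  simp [sep]

/-- The preimage of a finite set of vertices. -/
noncomputable def preim {X : Type*} [Fintype X] (p : X → V) (S : Finset V) : Finset X :=
  {a | p a ∈ S}

theorem mem_preim {X : Type*} [Fintype X] {p : X → V} {S : Finset V} {a : X} :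
    a ∈ preim p S ↔ p a ∈ S := by
  simp [preim]

theorem sep_preim {X : Type*} [Fintype X] (p : X → V) (S : Finset V) (a b : X) :
    sep (preim p S) a b = sep S (p a) (p b) := by
  simp [sep, mem_preim]

/-- The indicator function of `S`. -/
noncomputable def ind (S : Finset V) (v : V) : ℕ := if v ∈ S then 1 else 0

theorem sum_ind [Fintype V] (S : Finset V) : ∑ v, ind S v = #S := by
  simp [ind]

theorem sum_ind_comp {ι : Type*} [Fintype ι] (S : Finset V) (x : ι → V) :
    ∑ i, ind S (x i) = #(preim x S) := by
  simp [ind, preim]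

/-- If `x i` lies in `S` and `y i` does not, the `i`-th edge is cut. Membership in `S` can therefore
be moved along a whole family of edges at the price of one boundary. -/
theorem sum_ind_le {ι : Type*} [Finite V] [Fintype ι] (S : Finset V) (x y : ι → V)
    (hadj : ∀ i, G.Adj (x i) (y i)) (hinj : Function.Injective fun i => (x i, y i)) :
    ∑ i, ind S (x i) ≤ ∑ i, ind S (y i) + (edgeBoundary G S).ncard := by
  rw [sum_ind_comp, sum_ind_comp]
  unfold preim
  have h : ({i | x i ∈ S} : Finset ι) ⊆
      ({i | y i ∈ S} : Finset ι) ∪ ({i | x i ∈ S ∧ y i ∉ S} : Finset ι) := by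
    intro i
    simp only [mem_filter, mem_univ, true_and, mem_union]
    tauto
  exact (card_le_card h).trans ((card_union_le _ _).trans
    (Nat.add_le_add_left (card_crossing_le S x y hadj hinj) _))

theorem sum_comp_le_of_injective {ι κ : Type*} [Fintype ι] [Fintype κ] (f : κ → ℕ) (x : ι → κ)
    (hx : Function.Injective x) : ∑ i, f (x i) ≤ ∑ v, f v := by
  rw [← sum_image (f := f) (fun i _ j _ h => hx h)]
  exact sum_le_sum_of_subset (subset_univ _)

theorem sum_comp_le_mul_of_card_fiber_le {ι κ : Type*} [Fintype ι] [Fintype κ] (f : κ → ℕ)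
    (x : ι → κ) (D : ℕ) (hx : ∀ v, #{i | x i = v} ≤ D) : ∑ i, f (x i) ≤ D * ∑ v, f v := by
  rw [← sum_fiberwise_of_maps_to (g := x) (t := univ) (fun i _ => mem_univ _), mul_sum]
  refine sum_le_sum fun v _ => ?_
  rw [sum_congr rfl (g := fun _ => f v) (fun i hi => by rw [(mem_filter.1 hi).2]), sum_const,
    smul_eq_mul]
  exact Nat.mul_le_mul_right _ (hx v)

theorem le_edgeExpansion_iff [Fintype V] (β : ℝ≥0) :
    (β : ℝ≥0∞) ≤ edgeExpansion G ↔ ∀ S : Finset V, 2 * #S ≤ Fintype.card V →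
      (β : ℝ) * #S ≤ (edgeBoundary G S).ncard := by
  unfold edgeExpansion
  simp only [le_iInf_iff]
  refine forall_congr' fun S => ?_
  rcases S.eq_empty_or_nonempty with rfl | hS
  · simp
  · have h1 : 1 ≤ #S := hS.card_pos
    have hne : ((#S : ℕ) : ℝ≥0∞) ≠ 0 := by simp; exact hS.ne_empty
    simp only [h1, true_and]
    refine imp_congr_right fun _ => ?_
    rw [ENNReal.le_div_iff_mul_le (Or.inl hne) (Or.inl (ENNReal.natCast_ne_top _))]
    have h : ((β * (#S : ℝ≥0) : ℝ≥0) : ℝ≥0∞) ≤ (((edgeBoundary G S).ncard : ℝ≥0) : ℝ≥0∞) ↔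
        ((β * (#S : ℝ≥0) : ℝ≥0) : ℝ) ≤ (((edgeBoundary G S).ncard : ℝ≥0) : ℝ) := by
      rw [ENNReal.coe_le_coe, NNReal.coe_le_coe]
    push_cast at h
    exact h

theorem edgeBoundary_ncard_compl [Fintype V] (S : Finset V) :
    (edgeBoundary G Sᶜ).ncard = (edgeBoundary G S).ncard := by
  rw [edgeBoundary_compl]

/-- Transfer of expansion along a map `p : X → V`, when the sets in `V` are controlled by their
preimages in `X`, up to multiples of their edge boundary. -/
theorem le_edgeExpansion_of_transfer {X : Type*} [Fintype V] [Fintype X] (p : X → V)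
    (b : Finset X → ℝ) (α : ℝ≥0) (hα : 0 < α) (B C : ℕ) (hC : 0 < C)
    (hX : ∀ Y : Finset X, α * #Y ≤ b Y ∨ α * #Yᶜ ≤ b Y)
    (hS : ∀ S : Finset V, #S ≤ B * #(preim p S) + C * (edgeBoundary G S).ncard)
    (hb : ∀ S : Finset V, b (preim p S) ≤ C * (edgeBoundary G S).ncard) :
    ((α / (C * (B + α)) : ℝ≥0) : ℝ≥0∞) ≤ edgeExpansion G := by
  rw [le_edgeExpansion_iff]
  intro S hS2
  have hα' : (0 : ℝ) < α := hα
  have hC' : (0 : ℝ) < C := by exact_mod_cast hC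
  -- Multiplying `hS` by `α` and inserting the bound for the preimage gives the claim for any set,
  -- in particular for `S` and for its complement, which has the same boundary.
  have key : ∀ T : Finset V, (α : ℝ) * #(preim p T) ≤ C * (edgeBoundary G T).ncard →
      (α : ℝ) * #T ≤ C * (B + α) * (edgeBoundary G T).ncard := by
    intro T hT
    have h1 : (#T : ℝ) ≤ B * #(preim p T) + C * (edgeBoundary G T).ncard := by
      exact_mod_cast hS T
    have hB : (0 : ℝ) ≤ (B : ℝ) := Nat.cast_nonneg _
    have h2 := mul_le_mul_of_nonneg_left h1 hα'.le
    have h3 := mul_le_mul_of_nonneg_left hT hB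
    linarith
  have main : (α : ℝ) * #S ≤ C * (B + α) * (edgeBoundary G S).ncard := by
    have hcomp : (preim p S)ᶜ = preim p Sᶜ := by
      ext a; simp [mem_preim]
    rcases hX (preim p S) with h | h
    · exact key S (h.trans (hb S))
    · rw [hcomp] at h
      have h2 := key Sᶜ (by rw [edgeBoundary_ncard_compl]; exact h.trans (hb S))
      rw [edgeBoundary_ncard_compl] at h2
      refine le_trans ?_ h2
      have h3 : #S ≤ #Sᶜ := by rw [card_compl]; omega
      have h4 : (#S : ℝ) ≤ #Sᶜ := by exact_mod_cast h3
      gcongr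
  push_cast
  rw [div_mul_eq_mul_div, div_le_iff₀ (by positivity)]
  linarith

theorem isoperimetry_of_le_edgeExpansion [Fintype V] (α : ℝ≥0)
    (h : (α : ℝ≥0∞) ≤ edgeExpansion G) (Y : Finset V) :
    (α : ℝ) * #Y ≤ (edgeBoundary G Y).ncard ∨ (α : ℝ) * #Yᶜ ≤ (edgeBoundary G Y).ncard := by
  rw [le_edgeExpansion_iff] at h
  by_cases hY : 2 * #Y ≤ Fintype.card V
  · exact Or.inl (h Y hY)
  · right
    rw [← edgeBoundary_ncard_compl]
    apply h
    rw [card_compl]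
    omega

theorem connected_of_le_edgeExpansion [Fintype V] [Nonempty V] (β : ℝ≥0) (hβ : 0 < β)
    (h : (β : ℝ≥0∞) ≤ edgeExpansion G) : G.Connected := by
  refine ⟨fun u v => ?_⟩
  by_contra huv
  let S : Finset V := {w | G.Reachable u w}
  have hS : edgeBoundary G S = ∅ := by
    ext e
    simp only [edgeBoundary, Set.mem_ofPred_eq, Set.mem_empty_iff_false, iff_false]
    rintro ⟨he, x, hx, y, hy, rfl⟩
    simp only [S, mem_filter, mem_univ, true_and] at hx hy
    exact hy (hx.trans (SimpleGraph.Adj.reachable he))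
  have hβ' : (0 : ℝ) < β := hβ
  have hu : 0 < #S := card_pos.2 ⟨u, by simp [S]⟩
  have hv : 0 < #Sᶜ := card_pos.2 ⟨v, by simpa [S] using huv⟩
  have hu' : (0 : ℝ) < #S := by exact_mod_cast hu
  have hv' : (0 : ℝ) < #Sᶜ := by exact_mod_cast hv
  rcases isoperimetry_of_le_edgeExpansion β h S with h | h <;> rw [hS] at h <;>
    simp only [Set.ncard_empty, Nat.cast_zero] at h
  · exact absurd h (not_le.2 (mul_pos hβ' hu'))
  · exact absurd h (not_le.2 (mul_pos hβ' hv'))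

/-- The full vertex set has empty boundary, so the hypothesis used for expansion also counts
vertices. -/
theorem card_le_of_transfer {X : Type*} [Fintype V] [Fintype X] (p : X → V) (B C : ℕ)
    (hS : ∀ S : Finset V, #S ≤ B * #(preim p S) + C * (edgeBoundary G S).ncard) :
    Fintype.card V ≤ B * Fintype.card X := by
  have := hS univ
  simpa [edgeBoundary_univ, preim] using this

end Expansion

/-! ### Traffic -/

section Traffic

open Finset

variable {V : Type*} {G : SimpleGraph V}

theorem geodesics_finite [Finite V] (x y : V) : (geodesics G x y).Finite := by
  classical
  have := Fintype.ofFinite V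
  have h := G.coe_finsetWalkLength_eq (G.dist x y) x y
  unfold geodesics
  rw [← h]
  exact Finset.finite_toSet _

theorem pairFlow_nonneg (x y v : V) : 0 ≤ pairFlow G x y v := by
  unfold pairFlow; positivity

theorem pairFlow_le_one [Finite V] (x y v : V) : pairFlow G x y v ≤ 1 := by
  unfold pairFlow
  refine div_le_one_of_le₀ ?_ (Nat.cast_nonneg _)
  exact_mod_cast Set.ncard_le_ncard (Set.sep_subset (geodesics G x y) _) (geodesics_finite x y)

/-- Connectedness makes the set of geodesics nonempty; otherwise the quotient would be `0 / 0 = 0`.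
-/
theorem pairFlow_eq_one [Finite V] (hG : G.Connected) (x y v : V)
    (h : ∀ w ∈ geodesics G x y, v ∈ w.support) : pairFlow G x y v = 1 := by
  have h1 : {w | w ∈ geodesics G x y ∧ v ∈ w.support} = geodesics G x y := by
    ext w
    exact ⟨fun hw => hw.1, fun hw => ⟨hw, h w hw⟩⟩
  unfold pairFlow
  rw [h1]
  apply div_self
  have : (geodesics G x y).ncard ≠ 0 := by
    obtain ⟨w, hw⟩ := hG.exists_walk_length_eq_dist x y
    exact (Set.ncard_pos (geodesics_finite x y)).2 ⟨w, hw⟩ |>.ne'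
  exact_mod_cast this

theorem traffic_le [Fintype V] (v : V) : traffic G v ≤ 1 / 2 * (Fintype.card V : ℝ) ^ 2 := by
  classical
  unfold traffic
  gcongr
  refine (sum_le_sum fun p _ => pairFlow_le_one p.1 p.2 v).trans ?_
  rw [sum_const, nsmul_eq_mul, mul_one, sq]
  norm_cast
  rw [offDiag_card, card_univ]
  omega

theorem maxCongestion_le [Fintype V] [Nonempty V] :
    maxCongestion G ≤ 1 / 2 * (Fintype.card V : ℝ) ^ 2 :=
  ciSup_le traffic_le

theorem traffic_le_maxCongestion [Fintype V] (v : V) : traffic G v ≤ maxCongestion G :=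
  le_ciSup (Set.finite_range (traffic G)).bddAbove v

/-- A lower bound for the congestion from pairs of vertices all of whose geodesics pass through a
common vertex. -/
theorem card_pairs_le_maxCongestion [Fintype V] (hG : G.Connected) (v : V) (P : Finset (V × V))
    (hP : ∀ p ∈ P, p.1 ≠ p.2 ∧ ∀ w ∈ geodesics G p.1 p.2, v ∈ w.support) :
    (1 / 2 : ℝ) * #P ≤ maxCongestion G := by
  classical
  refine le_trans ?_ (traffic_le_maxCongestion v)
  unfold traffic
  gcongr
  have h1 : ∑ p ∈ P, pairFlow G p.1 p.2 v = #P := by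
    rw [sum_congr rfl fun p hp => pairFlow_eq_one hG p.1 p.2 v (hP p hp).2]
    simp
  rw [← h1]
  refine sum_le_sum_of_subset_of_nonneg ?_ fun _ _ _ => pairFlow_nonneg _ _ _
  intro p hp
  simpa using (hP p hp).1

end Traffic

theorem ncard_le_of_subset_range {V : Type*} {n : ℕ} {s : Set V} (f : Fin n → V)
    (h : s ⊆ Set.range f) : s.ncard ≤ n := by
  refine (Set.ncard_le_ncard h (Set.finite_range f)).trans ?_
  rw [← Set.image_univ]
  refine (Set.ncard_image_le (Set.toFinite _)).trans ?_
  rw [Set.ncard_univ, Nat.card_fin]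

/-! ### Subdivision -/

section Subdivision

open Finset
open scoped Classical

variable {V : Type*} {H : SimpleGraph V} {F : Set (Sym2 V)} {c : ℕ}

theorem pathPoint_zero (e : {e : Sym2 V // e ∈ H.edgeSet ∧ e ∈ F}) :
    pathPoint H F c e 0 = Sum.inl (Quot.out e.1).1 := by
  simp [pathPoint]

theorem pathPoint_end (hc : 0 < c) (e : {e : Sym2 V // e ∈ H.edgeSet ∧ e ∈ F}) :
    pathPoint H F c e c = Sum.inl (Quot.out e.1).2 := by
  simp [pathPoint, hc.ne']

theorem pathPoint_succ (e : {e : Sym2 V // e ∈ H.edgeSet ∧ e ∈ F}) (i : Fin (c - 1)) :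
    pathPoint H F c e (i + 1) = Sum.inr (e, i) := by
  have : (i : ℕ) + 1 < c := by omega
  simp [pathPoint, this]

theorem pathPoint_inner (e : {e : Sym2 V // e ∈ H.edgeSet ∧ e ∈ F}) {j : ℕ} (h0 : j ≠ 0)
    (hj : j < c) : pathPoint H F c e j = Sum.inr (e, ⟨j - 1, by omega⟩) := by
  simp [pathPoint, h0, hj]

theorem mk_out (e : Sym2 V) : s((Quot.out e).1, (Quot.out e).2) = e :=
  Quot.out_eq e

theorem adj_out (e : {e : Sym2 V // e ∈ H.edgeSet ∧ e ∈ F}) :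
    H.Adj (Quot.out e.1).1 (Quot.out e.1).2 := by
  rw [← SimpleGraph.mem_edgeSet, mk_out]
  exact e.2.1

theorem out_mem (e : {e : Sym2 V // e ∈ H.edgeSet ∧ e ∈ F}) :
    s((Quot.out e.1).1, (Quot.out e.1).2) ∈ F := by
  rw [mk_out]
  exact e.2.2

/-- As `2 ≤ c`, at least one of two consecutive path points is interior, and an interior point
determines its edge. -/
theorem pathPoint_injective (hc : 2 ≤ c) {j : ℕ} (hj : j < c) :
    Function.Injective fun e : {e : Sym2 V // e ∈ H.edgeSet ∧ e ∈ F} =>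
      (pathPoint H F c e (j + 1), pathPoint H F c e j) := by
  intro e e' h
  simp only [Prod.mk.injEq] at h
  by_cases h0 : j = 0
  · have h1 := h.1
    rw [pathPoint_inner e (by omega) (by omega), pathPoint_inner e' (by omega) (by omega)] at h1
    simpa using h1
  · have h1 := h.2
    rw [pathPoint_inner e h0 hj, pathPoint_inner e' h0 hj] at h1
    simpa using h1

theorem pathPoint_adj (hc : 2 ≤ c) {j : ℕ} (hj : j < c)
    (e : {e : Sym2 V // e ∈ H.edgeSet ∧ e ∈ F}) :
    (subdivide H F c).Adj (pathPoint H F c e (j + 1)) (pathPoint H F c e j) := by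
  refine (SimpleGraph.fromRel_adj _ _ _).2 ⟨?_, Or.inr (SubdivRel.path e j hj)⟩
  by_cases h0 : j = 0
  · subst h0
    rw [pathPoint_inner e (by omega) (by omega), pathPoint_zero]
    simp
  · rw [pathPoint_inner e h0 hj]
    by_cases h1 : j + 1 < c
    · rw [pathPoint_inner e (by omega) h1]
      simp
      omega
    · have : j + 1 = c := by omega
      rw [this, pathPoint_end (by omega)]
      simp

theorem subdivide_adj_inl {u v : V} (h : H.Adj u v) (hF : s(u, v) ∉ F) :
    (subdivide H F c).Adj (Sum.inl u) (Sum.inl v) :=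
  (SimpleGraph.fromRel_adj _ _ _).2 ⟨by simpa using h.ne, Or.inl (SubdivRel.keep u v h hF)⟩

/-! ### Expansion of a subdivision -/

section Boundary

variable [Fintype V] (S : Finset (SubdivVertex H F c))

theorem sum_ind_pathPoint_le (hc : 2 ≤ c) (j : ℕ) (hj : j ≤ c) :
    ∑ e, ind S (pathPoint H F c e j) ≤
      ∑ e, ind S (pathPoint H F c e 0) + j * (edgeBoundary (subdivide H F c) S).ncard := by
  induction j with
  | zero => simp
  | succ j ih =>
    have h := sum_ind_le S (fun e => pathPoint H F c e (j + 1)) (fun e => pathPoint H F c e j)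
      (fun e => pathPoint_adj hc (by omega) e) (pathPoint_injective hc (by omega))
    have := ih (by omega)
    rw [add_mul]
    omega

/-- An edge with a prescribed first endpoint is determined by its second one, so at most `Δ` paths
start at a given vertex. -/
theorem sum_ind_out_le (Δ : ℕ) (hΔ : ∀ v, (H.neighborSet v).ncard ≤ Δ) :
    ∑ e, ind S (pathPoint H F c e 0) ≤ Δ * #(preim Sum.inl S) := by
  have h := sum_comp_le_mul_of_card_fiber_le (fun v => ind S (Sum.inl v))
    (fun e : {e : Sym2 V // e ∈ H.edgeSet ∧ e ∈ F} => (Quot.out e.1).1) Δ ?_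
  · rw [sum_ind_comp S Sum.inl] at h
    simpa only [pathPoint_zero] using h
  · intro v
    rw [← Set.ncard_coe_finset]
    refine le_trans (Set.ncard_le_ncard_of_injOn (fun e => (Quot.out e.1).2) ?_ ?_
      (Set.toFinite _)) (hΔ v)
    · intro e he
      simp only [coe_filter, mem_univ, true_and, Set.mem_ofPred_eq] at he
      rw [SimpleGraph.mem_neighborSet, ← he]
      exact adj_out e
    · intro e he e' he' h
      simp only [coe_filter, mem_univ, true_and, Set.mem_ofPred_eq] at he he'
      apply Subtype.ext
      rw [← mk_out e.1, ← mk_out e'.1, he, he', show (Quot.out e.1).2 = (Quot.out e'.1).2 from h]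

theorem subdivide_card_le (hc : 2 ≤ c) (Δ : ℕ) (hΔ : ∀ v, (H.neighborSet v).ncard ≤ Δ) :
    #S ≤ (1 + (c - 1) * Δ) * #(preim Sum.inl S) +
      ((c - 1) * c) * (edgeBoundary (subdivide H F c) S).ncard := by
  set bd := (edgeBoundary (subdivide H F c) S).ncard with hbd
  have h1 : ∑ p : {e : Sym2 V // e ∈ H.edgeSet ∧ e ∈ F} × Fin (c - 1), ind S (Sum.inr p) ≤
      ∑ i : Fin (c - 1), (Δ * #(preim Sum.inl S) + c * bd) := by
    rw [Fintype.sum_prod_type_right]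
    refine sum_le_sum fun i _ => ?_
    have h2 := sum_ind_pathPoint_le S hc (i + 1) (by omega)
    rw [← hbd] at h2
    simp only [pathPoint_succ] at h2
    have h3 := sum_ind_out_le S Δ hΔ
    have h4 : ((i : ℕ) + 1) * bd ≤ c * bd := Nat.mul_le_mul_right _ (by omega)
    omega
  rw [← sum_ind S, Fintype.sum_sum_type, sum_ind_comp S Sum.inl]
  rw [sum_const, card_univ, Fintype.card_fin, smul_eq_mul] at h1
  refine (Nat.add_le_add_left h1 _).trans (le_of_eq ?_)
  ring

/-- A cut edge outside `F` is still a cut edge. A cut edge in `F` becomes a path with separated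
ends, so some edge of the path is cut; summing `sep` over the `c` steps of all paths gives the term
`2 * c`. -/
theorem edgeBoundary_comap_inl_le (hc : 2 ≤ c) :
    (edgeBoundary H (preim Sum.inl S)).ncard ≤
      (1 + 2 * c) * (edgeBoundary (subdivide H F c) S).ncard := by
  set bd := (edgeBoundary (subdivide H F c) S).ncard
  set Y : Finset V := preim Sum.inl S
  have hY : ∀ v, v ∈ Y ↔ (Sum.inl v : SubdivVertex H F c) ∈ S := fun v => mem_preim
  have h1 : (edgeBoundary H Y \ F).ncard ≤ bd := by
    refine Set.ncard_le_ncard_of_injOn (Sym2.map Sum.inl) ?_ ?_ (Set.toFinite _)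
    · rintro _ ⟨⟨he, u, hu, v, hv, rfl⟩, hF⟩
      exact ⟨subdivide_adj_inl he hF, _, (hY u).1 hu, _, fun h => hv ((hY v).2 h), rfl⟩
    · exact (Sym2.map.injective Sum.inl_injective).injOn
  have h2 : (edgeBoundary H Y ∩ F).ncard ≤
      ∑ e, sep S (pathPoint H F c e 0) (pathPoint H F c e c) := by
    let cr : Finset {e : Sym2 V // e ∈ H.edgeSet ∧ e ∈ F} :=
      {e | sep S (pathPoint H F c e 0) (pathPoint H F c e c) = 1}
    have h3 : #cr ≤ ∑ e, sep S (pathPoint H F c e 0) (pathPoint H F c e c) := by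
      rw [card_filter]
      exact sum_le_sum fun e _ => by split_ifs <;> omega
    refine le_trans ?_ h3
    rw [← Set.ncard_coe_finset]
    rw [← Set.ncard_image_of_injective _ Subtype.val_injective]
    refine Set.ncard_le_ncard ?_ (Set.toFinite _)
    rintro e ⟨⟨he, u, hu, v, hv, huv⟩, hF⟩
    refine ⟨⟨e, he, hF⟩, ?_, rfl⟩
    simp only [cr, coe_filter, mem_univ, true_and, Set.mem_ofPred_eq]
    rw [pathPoint_zero, pathPoint_end (by omega)]
    rw [← mk_out e, Sym2.eq_iff] at huv
    rw [← sep_preim, sep, if_neg]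
    rcases huv with ⟨h, h'⟩ | ⟨h, h'⟩ <;> simp only [h, h'] <;> tauto
  have h3 : ∀ j ≤ c, ∑ e, sep S (pathPoint H F c e 0) (pathPoint H F c e j) ≤ j * (2 * bd) := by
    intro j
    induction j with
    | zero => simp [sep_self]
    | succ j ih =>
      intro hj
      have h4 := sum_sep_le S (fun e => pathPoint H F c e (j + 1)) (fun e => pathPoint H F c e j)
        (fun e => pathPoint_adj hc hj e) (pathPoint_injective hc hj)
      have h5 : ∑ e, sep S (pathPoint H F c e 0) (pathPoint H F c e (j + 1)) ≤
          ∑ e, (sep S (pathPoint H F c e 0) (pathPoint H F c e j) +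
            sep S (pathPoint H F c e (j + 1)) (pathPoint H F c e j)) :=
        sum_le_sum fun e _ => by rw [sep_comm S (pathPoint H F c e (j + 1))]; exact sep_triangle ..
      rw [sum_add_distrib] at h5
      rw [add_mul, one_mul]
      exact h5.trans (Nat.add_le_add (ih (by omega)) h4)
  have h5 : (edgeBoundary H Y).ncard ≤ _ :=
    (congrArg Set.ncard (Set.inter_union_sdiff (edgeBoundary H Y) F)).symm.le.trans
      (Set.ncard_union_le _ _)
  have h4 := h3 c le_rfl
  linarith

theorem le_edgeExpansion_subdivide (hc : 2 ≤ c) (Δ : ℕ)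
    (hΔ : ∀ v, (H.neighborSet v).ncard ≤ Δ) (α : ℝ≥0) (hα : 0 < α)
    (h : (α : ℝ≥0∞) ≤ edgeExpansion H) :
    ((α / ((((c - 1) * c + (1 + 2 * c) : ℕ) : ℝ≥0) * (((1 + (c - 1) * Δ : ℕ) : ℝ≥0) + α)) : ℝ≥0) :
      ℝ≥0∞) ≤ edgeExpansion (subdivide H F c) := by
  refine le_edgeExpansion_of_transfer (fun v => Sum.inl v)
    (fun Y => ((edgeBoundary H Y).ncard : ℝ)) α hα _ _ (by omega)
    (isoperimetry_of_le_edgeExpansion α h) (fun S => ?_) (fun S => ?_)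
  · refine (subdivide_card_le S hc Δ hΔ).trans ?_
    gcongr
    omega
  · have := edgeBoundary_comap_inl_le S hc
    have h2 : (edgeBoundary H (preim Sum.inl S)).ncard ≤
        ((c - 1) * c + (1 + 2 * c)) * (edgeBoundary (subdivide H F c) S).ncard :=
      this.trans (Nat.mul_le_mul_right _ (by omega))
    exact_mod_cast h2

end Boundary

/-- Each neighbour in `H` is either kept or replaced by the adjacent point of the path. The
orientation chosen by `Quot.out` decides whether this is point `1` or point `c - 1`. -/
theorem subdivide_degree_inl [Finite V] (hc : 2 ≤ c) (v : V) :
    ((subdivide H F c).neighborSet (Sum.inl v)).ncard ≤ (H.neighborSet v).ncard := by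
  let ψ : V → SubdivVertex H F c := fun u =>
    if h : s(v, u) ∈ H.edgeSet ∧ s(v, u) ∈ F then
      if (Quot.out s(v, u)).1 = v then pathPoint H F c ⟨s(v, u), h⟩ 1
      else pathPoint H F c ⟨s(v, u), h⟩ (c - 1)
    else Sum.inl u
  refine le_trans (Set.ncard_le_ncard (t := ψ '' H.neighborSet v) ?_ (Set.toFinite _))
    (Set.ncard_image_le (Set.toFinite _))
  have hkeep : ∀ u, H.Adj v u → s(v, u) ∉ F → ψ u = Sum.inl u := by
    intro u h hF
    simp [ψ, hF]
  have hfirst : ∀ e : {e : Sym2 V // e ∈ H.edgeSet ∧ e ∈ F}, (Quot.out e.1).1 = v →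
      pathPoint H F c e 1 ∈ ψ '' H.neighborSet v := by
    intro e he
    have hve : s(v, (Quot.out e.1).2) = e.1 := by rw [← he, mk_out]
    refine ⟨(Quot.out e.1).2, by rw [SimpleGraph.mem_neighborSet, ← he]; exact adj_out e, ?_⟩
    simp only [ψ, hve]
    rw [dif_pos e.2, if_pos he]
  have hlast : ∀ e : {e : Sym2 V // e ∈ H.edgeSet ∧ e ∈ F}, (Quot.out e.1).2 = v →
      pathPoint H F c e (c - 1) ∈ ψ '' H.neighborSet v := by
    intro e he
    have hve : s(v, (Quot.out e.1).1) = e.1 := by rw [← he, Sym2.eq_swap, mk_out]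
    refine ⟨(Quot.out e.1).1, by rw [SimpleGraph.mem_neighborSet, ← he]; exact (adj_out e).symm, ?_⟩
    simp only [ψ, hve]
    rw [dif_pos e.2, if_neg (by rw [← he]; exact (adj_out e).ne)]
  intro x hx
  rw [SimpleGraph.mem_neighborSet, subdivide, SimpleGraph.fromRel_adj] at hx
  obtain ⟨-, hx | hx⟩ := hx
  · generalize hy : (Sum.inl v : SubdivVertex H F c) = y at hx
    cases hx with
    | keep u w huw hF =>
      obtain rfl := Sum.inl_injective hy
      exact ⟨w, huw, hkeep w huw hF⟩
    | path e j hj =>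
      by_cases h0 : j = 0
      · subst h0
        rw [pathPoint_zero] at hy
        exact hfirst e (Sum.inl_injective hy).symm
      · rw [pathPoint_inner e h0 hj] at hy
        simp at hy
  · generalize hy : (Sum.inl v : SubdivVertex H F c) = y at hx
    cases hx with
    | keep u w huw hF =>
      obtain rfl := Sum.inl_injective hy
      exact ⟨u, huw.symm, hkeep u huw.symm (by rwa [Sym2.eq_swap])⟩
    | path e j hj =>
      by_cases h1 : j + 1 < c
      · rw [pathPoint_inner e (by omega) h1] at hy
        simp at hy
      · obtain rfl : j = c - 1 := by omega
        rw [Nat.sub_add_cancel (by omega), pathPoint_end (by omega)] at hy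
        exact hlast e (Sum.inl_injective hy).symm

theorem subdivide_degree_inr (p : {e : Sym2 V // e ∈ H.edgeSet ∧ e ∈ F} × Fin (c - 1)) :
    ((subdivide H F c).neighborSet (Sum.inr p)).ncard ≤ 2 := by
  obtain ⟨e, i⟩ := p
  refine ncard_le_of_subset_range ![pathPoint H F c e i, pathPoint H F c e (i + 2)] ?_
  -- The interior vertex with index `i` is path point `i + 1`, hence the neighbours `i` and `i + 2`.
  have key : ∀ (e' : {e : Sym2 V // e ∈ H.edgeSet ∧ e ∈ F}) (j : ℕ),
      (Sum.inr (e, i) : SubdivVertex H F c) = pathPoint H F c e' j →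
      e' = e ∧ j = i + 1 := by
    intro e' j h
    have hi := i.2
    unfold pathPoint at h
    split_ifs at h with h0 h1
    simp only [Sum.inr.injEq, Prod.mk.injEq] at h
    refine ⟨h.1.symm, ?_⟩
    have := congrArg Fin.val h.2
    simp only at this
    omega
  intro x hx
  rw [SimpleGraph.mem_neighborSet, subdivide, SimpleGraph.fromRel_adj] at hx
  obtain ⟨-, hx | hx⟩ := hx
  · generalize hy : (Sum.inr (e, i) : SubdivVertex H F c) = y at hx
    cases hx with
    | keep => simp at hy
    | path e' j hj =>
      obtain ⟨rfl, rfl⟩ := key e' j hy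
      exact ⟨1, rfl⟩
  · generalize hy : (Sum.inr (e, i) : SubdivVertex H F c) = y at hx
    cases hx with
    | keep => simp at hy
    | path e' j hj =>
      obtain ⟨rfl, h⟩ := key e' (j + 1) hy
      exact ⟨0, by rw [Nat.succ_injective h]; rfl⟩

/-! ### Lower bounds for the lengths of walks in a subdivision -/

section Reach

/-- The time at which a vertex of the subdivision is reached, in terms of the times at which the
original vertices are reached. -/
def subdivReach (P : V → ℕ → Prop) : SubdivVertex H F c → ℕ → Prop
  | Sum.inl v, t => P v t
  | Sum.inr (e, i), t => (∃ t', P (Quot.out e.1).1 t' ∧ t' + (i + 1) ≤ t) ∨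
      (∃ t', P (Quot.out e.1).2 t' ∧ t' + (c - (i + 1)) ≤ t)

variable {P : V → ℕ → Prop} {o : V}

/-- A walk may turn round inside a path, so an interior vertex admits a bound from either end.
Traversing a whole path takes `c` steps, which is exactly what `hlong` allows. Thus any predicate
closed under the moves in `H`, with these costs, controls all walks in the subdivision that avoid
`o`. -/
theorem subdivReach_step (hc : 2 ≤ c) (hmono : ∀ v t t', P v t → t ≤ t' → P v t')
    (hkeep : ∀ u v t, H.Adj u v → s(u, v) ∉ F → v ≠ o → P u t → P v (t + 1))
    (hlong : ∀ u v t, H.Adj u v → s(u, v) ∈ F → v ≠ o → P u t → P v (t + c))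
    {x y : SubdivVertex H F c} (hxy : (subdivide H F c).Adj x y) (hy : y ≠ Sum.inl o) {t : ℕ}
    (hx : subdivReach P x t) : subdivReach P y (t + 1) := by
  -- `h1` and `h2` treat the ends of a path like its interior points, so that a step is always a
  -- change of `j` by one.
  have h1 : ∀ (e : {e : Sym2 V // e ∈ H.edgeSet ∧ e ∈ F}) (j t : ℕ), j ≤ c →
      subdivReach P (pathPoint H F c e j) t → (∃ t', P (Quot.out e.1).1 t' ∧ t' + j ≤ t) ∨
      (∃ t', P (Quot.out e.1).2 t' ∧ t' + (c - j) ≤ t) := by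
    intro e j t hj h
    by_cases h0 : j = 0
    · subst h0
      rw [pathPoint_zero] at h
      exact Or.inl ⟨t, h, le_rfl⟩
    by_cases hjc : j = c
    · subst hjc
      rw [pathPoint_end (by omega)] at h
      exact Or.inr ⟨t, h, by omega⟩
    · rw [pathPoint_inner e h0 (by omega)] at h
      simpa only [subdivReach, Nat.sub_add_cancel (Nat.one_le_iff_ne_zero.2 h0)] using h
  have h2 : ∀ (e : {e : Sym2 V // e ∈ H.edgeSet ∧ e ∈ F}) (j t : ℕ), j ≤ c →
      pathPoint H F c e j ≠ Sum.inl o →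
      ((∃ t', P (Quot.out e.1).1 t' ∧ t' + j ≤ t) ∨
      (∃ t', P (Quot.out e.1).2 t' ∧ t' + (c - j) ≤ t)) →
      subdivReach P (pathPoint H F c e j) t := by
    intro e j t hj hne h
    by_cases h0 : j = 0
    · subst h0
      rw [pathPoint_zero] at hne ⊢
      have hne' : (Quot.out e.1).1 ≠ o := fun h => hne (congrArg _ h)
      rcases h with ⟨t', h, ht⟩ | ⟨t', h, ht⟩
      · exact hmono _ _ _ h ht
      · exact hmono _ _ _ (hlong _ _ _ (adj_out e).symm
          (by rw [Sym2.eq_swap]; exact out_mem e) hne' h) ht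
    by_cases hjc : j = c
    · subst hjc
      rw [pathPoint_end (by omega)] at hne ⊢
      have hne' : (Quot.out e.1).2 ≠ o := fun h => hne (congrArg _ h)
      rcases h with ⟨t', h, ht⟩ | ⟨t', h, ht⟩
      · exact hmono _ _ _ (hlong _ _ _ (adj_out e) (out_mem e) hne' h) ht
      · exact hmono _ _ _ h (by omega)
    · rw [pathPoint_inner e h0 (by omega)]
      simpa only [subdivReach, Nat.sub_add_cancel (Nat.one_le_iff_ne_zero.2 h0)] using h
  rw [subdivide, SimpleGraph.fromRel_adj] at hxy
  obtain ⟨-, h | h⟩ := hxy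
  · cases h with
    | keep u v huv hF => exact hkeep u v t huv hF (fun h => hy (congrArg _ h)) hx
    | path e j hj =>
      refine h2 e (j + 1) _ hj hy ?_
      rcases h1 e j t hj.le hx with ⟨t', h, ht⟩ | ⟨t', h, ht⟩
      · exact Or.inl ⟨t', h, by omega⟩
      · exact Or.inr ⟨t', h, by omega⟩
  · cases h with
    | keep u v huv hF =>
      exact hkeep v u t huv.symm (by rwa [Sym2.eq_swap]) (fun h => hy (congrArg _ h)) hx
    | path e j hj =>
      refine h2 e j _ hj.le hy ?_
      rcases h1 e (j + 1) t hj hx with ⟨t', h, ht⟩ | ⟨t', h, ht⟩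
      · exact Or.inl ⟨t', h, by omega⟩
      · exact Or.inr ⟨t', h, by omega⟩

theorem subdivReach_walk (hc : 2 ≤ c) (hmono : ∀ v t t', P v t → t ≤ t' → P v t')
    (hkeep : ∀ u v t, H.Adj u v → s(u, v) ∉ F → v ≠ o → P u t → P v (t + 1))
    (hlong : ∀ u v t, H.Adj u v → s(u, v) ∈ F → v ≠ o → P u t → P v (t + c))
    {x y : SubdivVertex H F c} (w : (subdivide H F c).Walk x y) (hw : Sum.inl o ∉ w.support)
    {t : ℕ} (hx : subdivReach P x t) : subdivReach P y (t + w.length) := by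
  induction w generalizing t with
  | nil => exact hx
  | @cons u v z h q ih =>
    rw [SimpleGraph.Walk.support_cons, List.mem_cons, not_or] at hw
    have hv : v ≠ Sum.inl o := fun h => hw.2 (h ▸ q.start_mem_support)
    have := ih hw.2 (subdivReach_step hc hmono hkeep hlong h hv hx)
    rw [SimpleGraph.Walk.length_cons]
    rwa [add_assoc, add_comm 1] at this

end Reach

end Subdivision

/-! ### The two trees and the expander -/

section Base

open Finset
open scoped Classical

theorem two_le_branching (k d : ℕ) : 2 ≤ branching k d := by
  unfold branching; split_ifs <;> omega

theorem branching_le_three (k d : ℕ) : branching k d ≤ 3 := by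
  unfold branching; split_ifs <;> omega

theorem treeNode_ext {k : ℕ} {x y : TreeNode k} (h1 : (x.1 : ℕ) = y.1) (h2 : (x.2 : ℕ) = y.2) :
    x = y := by
  obtain ⟨d, j⟩ := x
  obtain ⟨d', j'⟩ := y
  obtain rfl : d = d' := Fin.ext h1
  obtain rfl : j = j' := Fin.ext h2
  rfl

/-- The nodes that are not leaves. -/
abbrev InnerNode (k : ℕ) : Type := Σ d : Fin (2 * k), Fin (levelSize k d)

/-- An inner node as a node. -/
def InnerNode.node {k : ℕ} (x : InnerNode k) : TreeNode k := ⟨x.1.castSucc, x.2⟩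

theorem child_lt {n b j i : ℕ} (hj : j < n) (hi : i < b) : b * j + i < n * b :=
  calc b * j + i < b * j + b := by omega
    _ = (j + 1) * b := by ring
    _ ≤ n * b := Nat.mul_le_mul_right _ hj

/-- The first or the second child of an inner node. -/
def InnerNode.child {k : ℕ} (x : InnerNode k) (i : Bool) : TreeNode k :=
  ⟨x.1.succ, ⟨branching k x.1 * x.2 + i.toNat,
    child_lt x.2.2 (lt_of_lt_of_le (Bool.toNat_lt i) (two_le_branching k x.1))⟩⟩

theorem isParent_child {k : ℕ} (x : InnerNode k) (i : Bool) : IsParent x.node (x.child i) := by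
  refine ⟨rfl, ?_⟩
  have hb := two_le_branching k x.1
  have hi := lt_of_lt_of_le (Bool.toNat_lt i) hb
  change (branching k x.1 * x.2 + i.toNat) / branching k x.1 = x.2
  rw [Nat.mul_add_div (by omega), Nat.div_eq_of_lt hi, add_zero]

theorem isParent_unique {k : ℕ} {x y z : TreeNode k} (hx : IsParent x z) (hy : IsParent y z) :
    x = y := by
  have h1 : (x.1 : ℕ) = y.1 := by have := hx.1; have := hy.1; omega
  refine treeNode_ext h1 ?_
  rw [← hx.2, ← hy.2, h1]

theorem innerNode_node_injective {k : ℕ} : Function.Injective (InnerNode.node (k := k)) := by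
  rintro ⟨d, j⟩ ⟨d', j'⟩ h
  have h1 : (d : ℕ) = d' := congrArg (fun x : TreeNode k => (x.1 : ℕ)) h
  have h2 : (j : ℕ) = j' := congrArg (fun x : TreeNode k => (x.2 : ℕ)) h
  obtain rfl : d = d' := Fin.ext h1
  obtain rfl : j = j' := Fin.ext h2
  rfl

theorem child_injective {k : ℕ} :
    Function.Injective fun p : InnerNode k × Bool => p.1.child p.2 := by
  rintro ⟨x, i⟩ ⟨y, j⟩ h
  have hxy : x = y := by
    apply innerNode_node_injective
    refine isParent_unique (isParent_child x i) ?_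
    rw [show x.child i = y.child j from h]
    exact isParent_child y j
  subst hxy
  have h2 := congrArg (fun x : TreeNode k => (x.2 : ℕ)) h
  change branching k x.1 * x.2 + i.toNat = branching k x.1 * x.2 + j.toNat at h2
  have h3 := Nat.add_left_cancel h2
  cases i <;> cases j <;> simp_all

theorem sum_treeNode {k : ℕ} (f : TreeNode k → ℕ) :
    ∑ x, f x = ∑ x : InnerNode k, f x.node + ∑ l : TreeLeaf k, f (TreeLeaf.node l) := by
  rw [Fintype.sum_sigma, Fin.sum_univ_castSucc, Fintype.sum_sigma]
  rfl

variable {k : ℕ} {A : SimpleGraph (Fin (2 * 6 ^ k))} {m : Bool × TreeLeaf k ≃ Fin (2 * 6 ^ k)}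

theorem baseTree_inj {s s' : Bool} {x x' : TreeNode k} :
    (baseTree s x : BaseVertex k) = baseTree s' x' ↔ s = s' ∧ x = x' := by
  simp [baseTree]

theorem baseExp_injective : Function.Injective (baseExp : Fin (2 * 6 ^ k) → BaseVertex k) :=
  fun _ _ h => Sum.inr_injective (Sum.inr_injective h)

theorem baseApex_ne_baseTree (s : Bool) (x : TreeNode k) : baseApex k ≠ baseTree s x := by
  simp [baseApex, baseTree]

theorem baseApex_ne_baseExp (a : Fin (2 * 6 ^ k)) : baseApex k ≠ baseExp a := by
  simp [baseApex, baseExp]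

theorem baseTree_ne_baseExp (s : Bool) (x : TreeNode k) (a : Fin (2 * 6 ^ k)) :
    baseTree s x ≠ baseExp a := by
  simp [baseTree, baseExp]

theorem baseGraph_adj_of_rel {u v : BaseVertex k} (h : BaseRel A m u v) :
    (baseGraph A m).Adj u v := by
  refine (SimpleGraph.fromRel_adj _ _ _).2 ⟨?_, Or.inl h⟩
  cases h with
  | apex s => exact baseApex_ne_baseTree _ _
  | tree s x y h =>
    intro h'
    obtain rfl := (baseTree_inj.1 h').2
    have := h.1
    omega
  | matching s l => exact baseTree_ne_baseExp _ _ _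
  | expander a b h => exact fun h' => h.ne (baseExp_injective h')

theorem baseGraph_adj_apex {v : BaseVertex k} (h : (baseGraph A m).Adj (baseApex k) v) :
    ∃ s, v = baseTree s (treeRoot k) := by
  rw [baseGraph, SimpleGraph.fromRel_adj] at h
  obtain ⟨-, h | h⟩ := h
  · generalize hu : baseApex k = u at h
    cases h with
    | apex s => exact ⟨s, rfl⟩
    | tree s x y h => exact absurd hu (baseApex_ne_baseTree _ _)
    | matching s l => exact absurd hu (baseApex_ne_baseTree _ _)
    | expander a b h => exact absurd hu (baseApex_ne_baseExp _)
  · generalize hu : baseApex k = u at h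
    cases h with
    | apex s => exact absurd hu (baseApex_ne_baseTree _ _)
    | tree s x y h => exact absurd hu (baseApex_ne_baseTree _ _)
    | matching s l => exact absurd hu (baseApex_ne_baseExp _)
    | expander a b h => exact absurd hu (baseApex_ne_baseExp _)

theorem baseGraph_adj_tree {s : Bool} {x : TreeNode k} {v : BaseVertex k}
    (h : (baseGraph A m).Adj (baseTree s x) v) :
    (v = baseApex k ∧ x = treeRoot k) ∨ (∃ y, IsParent y x ∧ v = baseTree s y) ∨
      (∃ y, IsParent x y ∧ v = baseTree s y) ∨
      ∃ l : TreeLeaf k, x = l.node ∧ v = baseExp (m (s, l)) := by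
  rw [baseGraph, SimpleGraph.fromRel_adj] at h
  obtain ⟨-, h | h⟩ := h
  · generalize hu : baseTree s x = u at h
    cases h with
    | apex s => exact absurd hu.symm (baseApex_ne_baseTree _ _)
    | tree s x y h =>
      obtain ⟨rfl, rfl⟩ := baseTree_inj.1 hu
      exact Or.inr (Or.inr (Or.inl ⟨y, h, rfl⟩))
    | matching s l =>
      obtain ⟨rfl, rfl⟩ := baseTree_inj.1 hu
      exact Or.inr (Or.inr (Or.inr ⟨l, rfl, rfl⟩))
    | expander a b h => exact absurd hu (baseTree_ne_baseExp _ _ _)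
  · generalize hu : baseTree s x = u at h
    cases h with
    | apex s =>
      obtain ⟨rfl, rfl⟩ := baseTree_inj.1 hu
      exact Or.inl ⟨rfl, rfl⟩
    | tree s x y h =>
      obtain ⟨rfl, rfl⟩ := baseTree_inj.1 hu
      exact Or.inr (Or.inl ⟨x, h, rfl⟩)
    | matching s l => exact absurd hu (baseTree_ne_baseExp _ _ _)
    | expander a b h => exact absurd hu (baseTree_ne_baseExp _ _ _)

theorem baseGraph_adj_exp {a : Fin (2 * 6 ^ k)} {v : BaseVertex k}
    (h : (baseGraph A m).Adj (baseExp a) v) :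
    (∃ s, ∃ l : TreeLeaf k, a = m (s, l) ∧ v = baseTree s l.node) ∨
      ∃ b, A.Adj a b ∧ v = baseExp b := by
  rw [baseGraph, SimpleGraph.fromRel_adj] at h
  obtain ⟨-, h | h⟩ := h
  · generalize hu : baseExp a = u at h
    cases h with
    | apex s => exact absurd hu.symm (baseApex_ne_baseExp _)
    | tree s x y h => exact absurd hu.symm (baseTree_ne_baseExp _ _ _)
    | matching s l => exact absurd hu.symm (baseTree_ne_baseExp _ _ _)
    | expander a b h =>
      obtain rfl := baseExp_injective hu
      exact Or.inr ⟨b, h, rfl⟩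
  · generalize hu : baseExp a = u at h
    cases h with
    | apex s => exact absurd hu.symm (baseTree_ne_baseExp _ _ _)
    | tree s x y h => exact absurd hu.symm (baseTree_ne_baseExp _ _ _)
    | matching s l =>
      obtain rfl := baseExp_injective hu
      exact Or.inl ⟨s, l, rfl, rfl⟩
    | expander a b h =>
      obtain rfl := baseExp_injective hu
      exact Or.inr ⟨a, h.symm, rfl⟩

/-! #### Degrees -/

theorem ncard_upper_le (s : Bool) (x : TreeNode k) :
    {v : BaseVertex k | (v = baseApex k ∧ x = treeRoot k) ∨
      ∃ y, IsParent y x ∧ v = baseTree s y}.ncard ≤ 1 := by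
  rw [Set.ncard_le_one_iff_subsingleton]
  have hroot : ∀ y, ¬ IsParent y (treeRoot k) := fun y h => by
    have : (0 : ℕ) = y.1 + 1 := h.1
    omega
  rintro u (⟨rfl, rfl⟩ | ⟨y, hy, rfl⟩) v (⟨rfl, hx⟩ | ⟨z, hz, rfl⟩)
  · rfl
  · exact absurd hz (hroot _)
  · subst hx; exact absurd hy (hroot _)
  · rw [isParent_unique hy hz]

theorem not_isParent_leaf (l : TreeLeaf k) (y : TreeNode k) : ¬ IsParent l.node y := by
  intro h
  have h1 : (y.1 : ℕ) = 2 * k + 1 := h.1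
  have := y.1.2
  omega

theorem leaf_node_injective : Function.Injective (TreeLeaf.node (k := k)) := by
  intro l l' h
  exact Fin.ext (congrArg (fun x : TreeNode k => (x.2 : ℕ)) h)

theorem baseGraph_degree_leaf (s : Bool) (l : TreeLeaf k) :
    ((baseGraph A m).neighborSet (baseTree s l.node)).ncard ≤ 2 := by
  refine (Set.ncard_le_ncard (t := {v : BaseVertex k | (v = baseApex k ∧ l.node = treeRoot k) ∨
      ∃ y, IsParent y l.node ∧ v = baseTree s y} ∪ {baseExp (m (s, l))}) ?_ (Set.toFinite _)).trans
    ((Set.ncard_union_le _ _).trans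
      (Nat.add_le_add (ncard_upper_le s _) (Set.ncard_singleton _).le))
  intro v hv
  rcases baseGraph_adj_tree hv with h | h | ⟨y, h, -⟩ | ⟨l', h, rfl⟩
  · exact Or.inl (Or.inl h)
  · exact Or.inl (Or.inr h)
  · exact absurd h (not_isParent_leaf l y)
  · rw [leaf_node_injective h]
    exact Or.inr rfl

theorem baseGraph_degree_tree (s : Bool) (x : TreeNode k) :
    ((baseGraph A m).neighborSet (baseTree s x)).ncard ≤ 4 := by
  by_cases hx : ∃ l : TreeLeaf k, x = l.node
  · obtain ⟨l, rfl⟩ := hx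
    exact (baseGraph_degree_leaf s l).trans (by norm_num)
  have hD : {v : BaseVertex k | ∃ y, IsParent x y ∧ v = baseTree s y}.ncard ≤ 3 := by
    refine ncard_le_of_subset_range (fun i : Fin 3 =>
      if h : ∃ y : TreeNode k, IsParent x y ∧ (y.2 : ℕ) % branching k x.1 = i then
        baseTree s h.choose else baseApex k) ?_
    rintro v ⟨y, hy, rfl⟩
    have hb := two_le_branching k x.1
    have hb3 := branching_le_three k x.1
    have hlt : (y.2 : ℕ) % branching k x.1 < 3 := (Nat.mod_lt _ (by omega)).trans_le hb3
    have h : ∃ z : TreeNode k, IsParent x z ∧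
        (z.2 : ℕ) % branching k x.1 = (⟨_, hlt⟩ : Fin 3) := ⟨y, hy, rfl⟩
    refine ⟨⟨_, hlt⟩, ?_⟩
    simp only
    rw [dif_pos h]
    congr 1
    obtain ⟨h1, h2⟩ := h.choose_spec
    refine treeNode_ext (by rw [h1.1, hy.1]) ?_
    have h3 := Nat.div_add_mod (h.choose.2 : ℕ) (branching k x.1)
    have h4 := Nat.div_add_mod (y.2 : ℕ) (branching k x.1)
    rw [h1.2, show (h.choose.2 : ℕ) % branching k x.1 = (y.2 : ℕ) % branching k x.1 from h2] at h3
    rw [hy.2] at h4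
    exact h3.symm.trans h4
  refine (Set.ncard_le_ncard (t := {v : BaseVertex k | (v = baseApex k ∧ x = treeRoot k) ∨
      ∃ y, IsParent y x ∧ v = baseTree s y} ∪
      {v : BaseVertex k | ∃ y, IsParent x y ∧ v = baseTree s y}) ?_ (Set.toFinite _)).trans
    ((Set.ncard_union_le _ _).trans (Nat.add_le_add (ncard_upper_le s _) hD))
  intro v hv
  rcases baseGraph_adj_tree hv with h | h | h | ⟨l', h, rfl⟩
  · exact Or.inl (Or.inl h)
  · exact Or.inl (Or.inr h)
  · exact Or.inr h
  · exact absurd ⟨l', h⟩ hx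

theorem baseGraph_degree_le (hA : ∀ a, (A.neighborSet a).ncard ≤ 3) (v : BaseVertex k) :
    ((baseGraph A m).neighborSet v).ncard ≤ 4 := by
  rcases v with u | ⟨s, x⟩ | a
  · refine le_trans (ncard_le_of_subset_range
      (fun i : Fin 2 => baseTree (i = 0) (treeRoot k)) ?_) (by norm_num : 2 ≤ 4)
    intro v hv
    obtain ⟨s, rfl⟩ := baseGraph_adj_apex hv
    cases s
    · exact ⟨1, by simp⟩
    · exact ⟨0, by simp⟩
  · exact baseGraph_degree_tree s x
  · refine (Set.ncard_le_ncard (t := {baseTree (m.symm a).1 (m.symm a).2.node} ∪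
      baseExp '' A.neighborSet a) ?_ (Set.toFinite _)).trans ((Set.ncard_union_le _ _).trans
      (Nat.add_le_add (Set.ncard_singleton _).le
        ((Set.ncard_image_le (Set.toFinite _)).trans (hA a))))
    intro v hv
    rcases baseGraph_adj_exp (show (baseGraph A m).Adj (baseExp a) v from hv) with
      ⟨s, l, h, rfl⟩ | ⟨b, h, rfl⟩
    · left
      rw [h]
      simp
    · exact Or.inr ⟨b, h, rfl⟩

/-! #### Expansion -/

/-- The matching compares the leaves in `S` with the expander, the branching compares inner nodes
with leaves, and the apex is compared with a root. No edge of `A` is used. -/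
theorem baseGraph_card_le (S : Finset (BaseVertex k)) :
    #S ≤ 5 * #(preim baseExp S) + 7 * (edgeBoundary (baseGraph A m) S).ncard := by
  set bd := (edgeBoundary (baseGraph A m) S).ncard with hbd
  set L := ∑ p : Bool × TreeLeaf k, ind S (baseTree p.1 p.2.node) with hL
  set I := ∑ p : Bool × InnerNode k, ind S (baseTree p.1 p.2.node) with hI
  have htree : ∑ p : Bool × TreeNode k, ind S (baseTree p.1 p.2) = I + L := by
    rw [hI, hL, Fintype.sum_prod_type, Fintype.sum_prod_type, Fintype.sum_prod_type,
      ← sum_add_distrib]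
    exact sum_congr rfl fun s _ => sum_treeNode fun x => ind S (baseTree s x)
  have h1 : L ≤ #(preim baseExp S) + bd := by
    have h := sum_ind_le S (fun p : Bool × TreeLeaf k => baseTree p.1 p.2.node)
      (fun p => baseExp (m p)) (fun p => baseGraph_adj_of_rel (BaseRel.matching (A := A) p.1 p.2))
      (fun p q h => m.injective (baseExp_injective (Prod.ext_iff.1 h).2))
    rw [← hL, m.sum_comp (fun a => ind S (baseExp a)), sum_ind_comp] at h
    exact h
  -- Each inner node sends edges to two of its children and no node is the child of two nodes. This
  -- yields `I ≤ L + bd`.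
  have h2 : 2 * I ≤ I + L + bd := by
    have h := sum_ind_le S (fun p : Bool × (InnerNode k × Bool) => baseTree p.1 p.2.1.node)
      (fun p => baseTree p.1 (p.2.1.child p.2.2))
      (fun p => baseGraph_adj_of_rel
        (BaseRel.tree (A := A) (m := m) p.1 _ _ (isParent_child p.2.1 p.2.2)))
      (fun p q h => by
        obtain ⟨h3, h4⟩ := baseTree_inj.1 (Prod.ext_iff.1 h).2
        exact Prod.ext h3 (child_injective h4))
    have h5 := sum_comp_le_of_injective (fun p : Bool × TreeNode k => ind S (baseTree p.1 p.2))
      (fun p : Bool × (InnerNode k × Bool) => (p.1, p.2.1.child p.2.2))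
      (fun p q h => Prod.ext (Prod.ext_iff.1 h).1 (child_injective (Prod.ext_iff.1 h).2))
    rw [htree] at h5
    have h6 : ∑ p : Bool × (InnerNode k × Bool), ind S (baseTree p.1 p.2.1.node) = 2 * I := by
      rw [Fintype.sum_prod_type, hI, Fintype.sum_prod_type, mul_sum]
      refine sum_congr rfl fun s _ => ?_
      rw [Fintype.sum_prod_type, mul_sum]
      exact sum_congr rfl fun x _ => by simp
    rw [h6] at h
    exact h.trans (Nat.add_le_add_right h5 _)
  have h3 : ind S (baseApex k) ≤ I + L + bd := by
    have h := sum_ind_le S (fun _ : Unit => baseApex k) (fun _ => baseTree false (treeRoot k))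
      (fun _ => baseGraph_adj_of_rel (BaseRel.apex (A := A) (m := m) false)) (fun _ _ _ => rfl)
    simp only [univ_unique, sum_singleton] at h
    refine h.trans (Nat.add_le_add_right ?_ _)
    rw [← htree]
    exact single_le_sum (f := fun p : Bool × TreeNode k => ind S (baseTree p.1 p.2))
      (fun _ _ => Nat.zero_le _) (mem_univ (false, treeRoot k))
  have h4 : #S = ind S (baseApex k) + (I + L + #(preim baseExp S)) := by
    rw [← sum_ind S, Fintype.sum_sum_type, Fintype.sum_sum_type, ← htree, ← sum_ind_comp]
    simp only [univ_unique, sum_singleton]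
    rfl
  omega

theorem edgeBoundary_preim_baseExp_le (S : Finset (BaseVertex k)) :
    (edgeBoundary A (preim baseExp S)).ncard ≤ (edgeBoundary (baseGraph A m) S).ncard := by
  refine Set.ncard_le_ncard_of_injOn (Sym2.map baseExp) ?_
    (Sym2.map.injective baseExp_injective).injOn (Set.toFinite _)
  rintro _ ⟨he, u, hu, v, hv, rfl⟩
  exact ⟨baseGraph_adj_of_rel (BaseRel.expander u v he), _, mem_preim.1 hu, _,
    fun h => hv (mem_preim.2 h), rfl⟩

theorem le_edgeExpansion_baseGraph (α : ℝ≥0) (hα : 0 < α) (h : (α : ℝ≥0∞) ≤ edgeExpansion A) :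
    ((α / (((7 : ℕ) : ℝ≥0) * (((5 : ℕ) : ℝ≥0) + α)) : ℝ≥0) : ℝ≥0∞) ≤
      edgeExpansion (baseGraph A m) := by
  refine le_edgeExpansion_of_transfer baseExp (fun Y => ((edgeBoundary A Y).ncard : ℝ)) α hα _ _
    (by omega) (isoperimetry_of_le_edgeExpansion α h) baseGraph_card_le (fun S => ?_)
  have h1 := edgeBoundary_preim_baseExp_le (A := A) (m := m) S
  have h2 : (edgeBoundary A (preim baseExp S)).ncard ≤
    7 * (edgeBoundary (baseGraph A m) S).ncard := by omega
  exact_mod_cast h2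

theorem card_baseVertex_le (k : ℕ) : Fintype.card (BaseVertex k) ≤ 5 * (2 * 6 ^ k) := by
  -- Any matching and any `A`, even the empty graph, serve for counting vertices.
  let m : Bool × TreeLeaf k ≃ Fin (2 * 6 ^ k) :=
    Fintype.equivOfCardEq (by simp [levelSize_leaves])
  have := card_le_of_transfer baseExp 5 7 (baseGraph_card_le (A := ⊥) (m := m))
  simpa using this

end Base

/-! ### Walks that avoid the apex -/

section Reach

open Finset
open scoped Classical

/-- The number of leaves below a node at height `h ≤ 2 * k`. -/
def leavesBelow (k : ℕ) : ℕ → ℕ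
  | 0 => 1
  | h + 1 => leavesBelow k h * branching k (2 * k - h - 1)

theorem leavesBelow_of_le {k h : ℕ} (hk : h ≤ k) : leavesBelow k h = 2 ^ h := by
  induction h with
  | zero => rfl
  | succ h ih =>
    have : ¬ 2 * k - h - 1 < k := by omega
    simp [leavesBelow, ih (by omega), branching, this, pow_succ]

theorem leavesBelow_add {k h : ℕ} (hk : h ≤ k) : leavesBelow k (k + h) = 2 ^ k * 3 ^ h := by
  induction h with
  | zero => simpa using leavesBelow_of_le le_rfl
  | succ h ih =>
    have : 2 * k - (k + h) - 1 < k := by omega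
    rw [← add_assoc, leavesBelow, ih (by omega), branching, if_pos this, pow_succ, mul_assoc]

theorem leavesBelow_pos (k h : ℕ) : 0 < leavesBelow k h := by
  induction h with
  | zero => exact Nat.one_pos
  | succ h ih => exact Nat.mul_pos ih (by have := two_le_branching k (2 * k - h - 1); omega)

theorem levelSize_mul_leavesBelow {k h : ℕ} (hk : h ≤ 2 * k) :
    levelSize k (2 * k - h) * leavesBelow k h = levelSize k (2 * k) := by
  induction h with
  | zero => simp [leavesBelow]
  | succ h ih =>
    rw [← ih (by omega), show 2 * k - h = (2 * k - (h + 1)) + 1 by omega, levelSize, leavesBelow,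
      show 2 * k - h - 1 = 2 * k - (h + 1) by omega]
    ring

/-- The ancestor of leaf `i` at height `h` has number `i / leavesBelow k h` in its level; one step
up divides by the branching number. -/
theorem div_leavesBelow_succ (k h i : ℕ) :
    i / leavesBelow k (h + 1) = i / leavesBelow k h / branching k (2 * k - h - 1) := by
  rw [leavesBelow, Nat.div_div_eq_div_mul]

theorem div_leavesBelow_mono {k g h i j : ℕ} (hgh : g ≤ h)
    (hij : i / leavesBelow k g = j / leavesBelow k g) :
    i / leavesBelow k h = j / leavesBelow k h := by
  induction h, hgh using Nat.le_induction with
  | base => exact hij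
  | succ h _ ih => rw [div_leavesBelow_succ, div_leavesBelow_succ, ih]

/-- Two leaves of the same tree with a common ancestor at height `h`. -/
def SameBlock {k : ℕ} (h : ℕ) (z z' : Bool × TreeLeaf k) : Prop :=
  z.1 = z'.1 ∧ (z.2 : ℕ) / leavesBelow k h = (z'.2 : ℕ) / leavesBelow k h

/-- Walks in the tree part and in the expander part of the graph, starting at the leaf `z₀`:
the flags tell whether an edge of the expander has been used, and whether the current position is
the expander vertex matched with the leaf `z` (or the leaf itself); `t` is half the length. -/
inductive BlockReach {k : ℕ} (A : SimpleGraph (Fin (2 * 6 ^ k)))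
    (m : Bool × TreeLeaf k ≃ Fin (2 * 6 ^ k)) (z₀ : Bool × TreeLeaf k) :
    Bool → Bool → Bool × TreeLeaf k → ℕ → Prop
  | start : BlockReach A m z₀ false false z₀ 0
  | up (b : Bool) (z z' : Bool × TreeLeaf k) (t h : ℕ) (hz : BlockReach A m z₀ b false z t)
      (hh : h ≤ 2 * k) (hzz : SameBlock h z z') : BlockReach A m z₀ b true z' (t + h + 6)
  | down (b : Bool) (z : Bool × TreeLeaf k) (t : ℕ) (hz : BlockReach A m z₀ b true z t) :
      BlockReach A m z₀ b false z (t + 6)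
  | edge (b : Bool) (z z' : Bool × TreeLeaf k) (t : ℕ) (hz : BlockReach A m z₀ b true z t)
      (hzz : A.Adj (m z) (m z')) : BlockReach A m z₀ true true z' (t + 6)

variable {k : ℕ} {A : SimpleGraph (Fin (2 * 6 ^ k))} {m : Bool × TreeLeaf k ≃ Fin (2 * 6 ^ k)}
  {z₀ : Bool × TreeLeaf k}

/-- The condition that a walk of length `t` that avoids the apex and ends at the given vertex
imposes on this vertex. -/
def BaseReach (A : SimpleGraph (Fin (2 * 6 ^ k))) (m : Bool × TreeLeaf k ≃ Fin (2 * 6 ^ k))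
    (z₀ : Bool × TreeLeaf k) : BaseVertex k → ℕ → Prop
  | Sum.inl _, _ => False
  | Sum.inr (Sum.inl (s, x)), t => ∃ b z q h, ∃ i : TreeLeaf k,
      BlockReach A m z₀ b false z q ∧ z.1 = s ∧ h ≤ 2 * k ∧ 2 * k ≤ x.1 + h ∧
      (i : ℕ) / leavesBelow k (2 * k - x.1) = x.2 ∧
      (i : ℕ) / leavesBelow k h = (z.2 : ℕ) / leavesBelow k h ∧ 2 * q + 2 * h + x.1 ≤ t + 2 * k
  | Sum.inr (Sum.inr a), t => ∃ b z q, BlockReach A m z₀ b true z q ∧ a = m z ∧ 2 * q ≤ t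

theorem baseReach_mono (v : BaseVertex k) (t t' : ℕ) (h : BaseReach A m z₀ v t) (ht : t ≤ t') :
    BaseReach A m z₀ v t' := by
  rcases v with u | ⟨s, x⟩ | a
  · exact h
  · obtain ⟨b, z, q, h, i, h1, h2, h3, h4, h5, h6, h7⟩ := h
    exact ⟨b, z, q, h, i, h1, h2, h3, h4, h5, h6, by omega⟩
  · obtain ⟨b, z, q, h1, h2, h3⟩ := h
    exact ⟨b, z, q, h1, h2, by omega⟩

/-- In `BaseReach`, `z` is the leaf from which the current excursion into the tree started, at
half-length `q`; `h` is the height accounted for since then, and `i` is some leaf below the node.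
Climbing `h` and descending to depth `x.1` takes `h + (h - (2 * k - x.1))` steps, which is the final
inequality. A move to the parent raises `h` only if the parent lies higher than `h`. -/
theorem baseReach_parent {s : Bool} {x y : TreeNode k} (hxy : IsParent y x) {t : ℕ}
    (h : BaseReach A m z₀ (baseTree s x) t) : BaseReach A m z₀ (baseTree s y) (t + 1) := by
  obtain ⟨b, z, q, h, i, h1, h2, h3, h4, h5, h6, h7⟩ := h
  have hd := hxy.1
  have hx := x.1.2
  have hi : (i : ℕ) / leavesBelow k (2 * k - y.1) = y.2 := by
    rw [show 2 * k - (y.1 : ℕ) = (2 * k - x.1) + 1 by omega, div_leavesBelow_succ, h5,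
      show 2 * k - (2 * k - (x.1 : ℕ)) - 1 = y.1 by omega]
    exact hxy.2
  by_cases hh : 2 * k ≤ y.1 + h
  · exact ⟨b, z, q, h, i, h1, h2, h3, hh, hi, h6, by omega⟩
  · exact ⟨b, z, q, h + 1, i, h1, h2, by omega, by omega, hi,
      div_leavesBelow_mono (Nat.le_succ h) h6, by omega⟩

theorem baseReach_child {s : Bool} {x y : TreeNode k} (hxy : IsParent x y) {t : ℕ}
    (h : BaseReach A m z₀ (baseTree s x) t) : BaseReach A m z₀ (baseTree s y) (t + 1) := by
  obtain ⟨b, z, q, h, i, h1, h2, h3, h4, h5, h6, h7⟩ := h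
  have hd := hxy.1
  have hy := y.1.2
  have hpos := leavesBelow_pos k (2 * k - y.1)
  have hlt : (y.2 : ℕ) * leavesBelow k (2 * k - y.1) < levelSize k (2 * k) := by
    rw [← levelSize_mul_leavesBelow (show 2 * k - (y.1 : ℕ) ≤ 2 * k by omega)]
    refine Nat.mul_lt_mul_of_pos_right ?_ hpos
    rw [show 2 * k - (2 * k - (y.1 : ℕ)) = y.1 by omega]
    exact y.2.2
  have hi : (y.2 : ℕ) * leavesBelow k (2 * k - y.1) / leavesBelow k (2 * k - y.1) = y.2 :=
    Nat.mul_div_cancel _ hpos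
  -- On a move down the height `h` stays, and the witness `i` becomes the first leaf below the
  -- child.
  refine ⟨b, z, q, h, ⟨_, hlt⟩, h1, h2, h3, by omega, hi, ?_, by omega⟩
  rw [← h6]
  refine div_leavesBelow_mono (show 2 * k - (x.1 : ℕ) ≤ h by omega) ?_
  rw [h5, show 2 * k - (x.1 : ℕ) = (2 * k - y.1) + 1 by omega, div_leavesBelow_succ, hi,
    show 2 * k - (2 * k - (y.1 : ℕ)) - 1 = x.1 by omega]
  exact hxy.2

theorem baseReach_leaf {s : Bool} {l : TreeLeaf k} {t : ℕ} :
    BaseReach A m z₀ (baseTree s l.node) t ↔ ∃ b z q h, BlockReach A m z₀ b false z q ∧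
      h ≤ 2 * k ∧ SameBlock h z (s, l) ∧ 2 * q + 2 * h ≤ t := by
  have hl : ((l.node).1 : ℕ) = 2 * k := rfl
  have hl2 : ∀ i : ℕ, i / leavesBelow k (2 * k - (l.node).1) = i := by
    intro i
    have h0 : 2 * k - ((l.node).1 : ℕ) = 0 := by rw [hl, Nat.sub_self]
    rw [h0, leavesBelow, Nat.div_one]
  constructor
  · rintro ⟨b, z, q, h, i, h1, h2, h3, h4, h5, h6, h7⟩
    rw [hl2, show ((l.node).2 : ℕ) = l from rfl] at h5
    rw [h5] at h6
    exact ⟨b, z, q, h, h1, h3, ⟨h2, h6.symm⟩, by omega⟩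
  · rintro ⟨b, z, q, h, h1, h3, ⟨h2, h6⟩, h7⟩
    exact ⟨b, z, q, h, l, h1, h2, h3, by omega, hl2 l, h6.symm, by omega⟩

theorem baseReach_short (u v : BaseVertex k) (t : ℕ) (h : (baseGraph A m).Adj u v)
    (hF : s(u, v) ∉ longEdges k) (hv : v ≠ baseApex k) (hu : BaseReach A m z₀ u t) :
    BaseReach A m z₀ v (t + 1) := by
  rcases u with u | ⟨s, x⟩ | a
  · exact hu.elim
  · rcases baseGraph_adj_tree h with ⟨h, -⟩ | ⟨y, hy, rfl⟩ | ⟨y, hy, rfl⟩ | ⟨l, -, rfl⟩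
    · exact absurd h hv
    · exact baseReach_parent hy hu
    · exact baseReach_child hy hu
    · exact absurd ⟨m (s, l), Sym2.mem_mk_right _ _⟩ hF
  · exact absurd ⟨a, Sym2.mem_mk_left _ _⟩ hF

theorem baseReach_long (u v : BaseVertex k) (t : ℕ) (h : (baseGraph A m).Adj u v)
    (hF : s(u, v) ∈ longEdges k) (hv : v ≠ baseApex k) (hu : BaseReach A m z₀ u t) :
    BaseReach A m z₀ v (t + 12) := by
  rcases u with u | ⟨s, x⟩ | a
  · exact hu.elim
  · have hno : ∀ y, s(baseTree s x, baseTree s y) ∉ longEdges k := by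
      rintro y ⟨a, ha⟩
      rcases Sym2.mem_iff.1 ha with h | h <;> exact baseTree_ne_baseExp _ _ _ h.symm
    rcases baseGraph_adj_tree h with ⟨h, -⟩ | ⟨y, hy, rfl⟩ | ⟨y, hy, rfl⟩ | ⟨l, rfl, rfl⟩
    · exact absurd h hv
    · exact absurd hF (hno y)
    · exact absurd hF (hno y)
    · obtain ⟨b, z, q, h, h1, h2, h3, h4⟩ := baseReach_leaf.1 hu
      exact ⟨b, (s, l), q + h + 6, BlockReach.up b z _ q h h1 h2 h3, rfl, by omega⟩
  · obtain ⟨b, z, q, h1, rfl, h3⟩ := hu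
    rcases baseGraph_adj_exp h with ⟨s, l, h', rfl⟩ | ⟨b', h, rfl⟩
    · obtain rfl := m.injective h'
      exact baseReach_leaf.2 ⟨b, (s, l), q + 6, 0, BlockReach.down b _ q h1, by omega,
        ⟨rfl, rfl⟩, by omega⟩
    · refine ⟨true, m.symm b', q + 6, BlockReach.edge b z _ q h1 ?_, ?_, by omega⟩
      · rwa [m.apply_symm_apply]
      · rw [m.apply_symm_apply]

/-- `BaseReach` is closed under the edges of the base graph with costs 1 and 12, except into the
apex, so `subdivReach_walk` applies. -/
theorem blockReach_of_walk {s s' : Bool} {l l' : TreeLeaf k}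
    (w : (joinGraph A m 12).Walk (joinLeaf A m 12 s l) (joinLeaf A m 12 s' l'))
    (hw : joinApex A m 12 ∉ w.support) :
    ∃ b z q h, BlockReach A m (s, l) b false z q ∧ h ≤ 2 * k ∧ SameBlock h z (s', l') ∧
      2 * q + 2 * h ≤ w.length := by
  rw [← baseReach_leaf]
  have h := subdivReach_walk (P := BaseReach A m (s, l)) (o := baseApex k) (by norm_num)
    baseReach_mono baseReach_short baseReach_long w hw (t := 0)
    (baseReach_leaf.2 ⟨false, (s, l), 0, 0, BlockReach.start, by omega, ⟨rfl, rfl⟩, by omega⟩)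
  rw [zero_add] at h
  exact h

/-! #### Counting -/

/-- The expander positions reached within half-length `t`. -/
noncomputable def reachSet (A : SimpleGraph (Fin (2 * 6 ^ k)))
    (m : Bool × TreeLeaf k ≃ Fin (2 * 6 ^ k)) (z₀ : Bool × TreeLeaf k) (b : Bool) (t : ℕ) :
    Finset (Bool × TreeLeaf k) :=
  {z | ∃ q ≤ t, BlockReach A m z₀ b true z q}

theorem mem_reachSet {b : Bool} {t : ℕ} {z : Bool × TreeLeaf k} :
    z ∈ reachSet A m z₀ b t ↔ ∃ q ≤ t, BlockReach A m z₀ b true z q := by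
  simp [reachSet]

/-- The leaves that share their ancestor at height `h` with `z`. -/
noncomputable def block (h : ℕ) (z : Bool × TreeLeaf k) : Finset (Bool × TreeLeaf k) :=
  {z' | SameBlock h z z'}

theorem mem_block {h : ℕ} {z z' : Bool × TreeLeaf k} : z' ∈ block h z ↔ SameBlock h z z' := by
  simp [block]

theorem card_block_le (h : ℕ) (z : Bool × TreeLeaf k) : #(block h z) ≤ leavesBelow k h := by
  have hpos := leavesBelow_pos k h
  refine (card_le_card_of_injOn (fun z' => (z'.2 : ℕ) % leavesBelow k h) (t := range _)
    (fun z' _ => ?_) (fun z' hz' z'' hz'' h => ?_)).trans (card_range _).le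
  · simpa using Nat.mod_lt _ hpos
  · have h1 := mem_block.1 hz'
    have h2 := mem_block.1 hz''
    refine Prod.ext (h1.1.symm.trans h2.1) (Fin.ext ?_)
    rw [← Nat.div_add_mod (z'.2 : ℕ) (leavesBelow k _), ← h1.2, h2.2,
      show (z'.2 : ℕ) % leavesBelow k _ = (z''.2 : ℕ) % leavesBelow k _ from h, Nat.div_add_mod]

theorem blockReach_leaf {b : Bool} {z : Bool × TreeLeaf k} {t : ℕ}
    (h : BlockReach A m z₀ b false z t) :
    (b = false ∧ z = z₀ ∧ t = 0) ∨ ∃ q, BlockReach A m z₀ b true z q ∧ t = q + 6 := by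
  cases h with
  | start => exact Or.inl ⟨rfl, rfl, rfl⟩
  | down b z t hz => exact Or.inr ⟨t, hz, rfl⟩

/-- Before any expander edge is used, a walk that leaves the tree along a matching edge can only
come back along the same one. -/
theorem blockReach_false_side {e : Bool} {b : Bool} {z : Bool × TreeLeaf k} {t : ℕ}
    (h : BlockReach A m z₀ b e z t) (hb : b = false) : z.1 = z₀.1 := by
  induction h with
  | start => rfl
  | up b z z' t h hz hh hzz ih => rw [← hzz.1]; exact ih hb
  | down b z t hz ih => exact ih hb
  | edge => simp at hb

/-- The leaves that share an ancestor at some height with an element of `X`, where `X` depends on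
this height. -/
noncomputable def blockUnion (r t : ℕ) (X : ℕ → Finset (Bool × TreeLeaf k)) :
    Finset (Bool × TreeLeaf k) :=
  ((range (2 * k + 1)).filter (r + · ≤ t)).biUnion fun h => (X (t - (r + h))).biUnion (block h)

theorem card_blockUnion_le (r t : ℕ) (X : ℕ → Finset (Bool × TreeLeaf k)) :
    #(blockUnion r t X) ≤ ∑ h ∈ (range (2 * k + 1)).filter (r + · ≤ t),
      leavesBelow k h * #(X (t - (r + h))) := by
  refine card_biUnion_le.trans (sum_le_sum fun h _ => ?_)
  refine card_biUnion_le.trans ?_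
  refine (sum_le_sum fun z _ => card_block_le h z).trans ?_
  rw [sum_const, smul_eq_mul, mul_comm]

theorem mem_blockUnion {r t h : ℕ} {X : ℕ → Finset (Bool × TreeLeaf k)} {z z' : Bool × TreeLeaf k}
    (hh : h ≤ 2 * k) (ht : r + h ≤ t) (hz : z ∈ X (t - (r + h))) (hzz : SameBlock h z z') :
    z' ∈ blockUnion r t X := by
  simp only [blockUnion, mem_biUnion, mem_filter, mem_range]
  exact ⟨h, ⟨by omega, ht⟩, z, hz, mem_block.2 hzz⟩

/-- Look at the last climb. It starts at `z₀` and ends with one matching edge (cost 6), or it starts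
at an earlier expander position and uses a matching edge down and one up (cost 12). -/
theorem reachSet_false_subset (t : ℕ) : reachSet A m z₀ false t ⊆
    blockUnion 6 t (fun _ => {z₀}) ∪ blockUnion 12 t (reachSet A m z₀ false) := by
  intro z' hz'
  obtain ⟨q, hq, h⟩ := mem_reachSet.1 hz'
  generalize hb : false = b at h
  cases h with
  | up b z z' t' h hz hh hzz =>
    subst hb
    rw [mem_union]
    rcases blockReach_leaf hz with ⟨-, rfl, rfl⟩ | ⟨q', hq', rfl⟩
    · exact Or.inl (mem_blockUnion hh (by omega) (mem_singleton_self _) hzz)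
    · exact Or.inr (mem_blockUnion hh (by omega) (mem_reachSet.2 ⟨q', by omega, hq'⟩) hzz)
  | edge => cases hb

/-- The leaves whose expander vertices are adjacent to those of the leaves in `X`. -/
noncomputable def expanderNeighbors (A : SimpleGraph (Fin (2 * 6 ^ k)))
    (m : Bool × TreeLeaf k ≃ Fin (2 * 6 ^ k)) (X : Finset (Bool × TreeLeaf k)) :
    Finset (Bool × TreeLeaf k) :=
  X.biUnion fun z => {z' | A.Adj (m z) (m z')}

theorem card_expanderNeighbors_le (hA : ∀ a, (A.neighborSet a).ncard ≤ 3)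
    (X : Finset (Bool × TreeLeaf k)) : #(expanderNeighbors A m X) ≤ 3 * #X := by
  refine card_biUnion_le.trans ?_
  refine le_trans (sum_le_card_nsmul X _ 3 fun z _ => ?_) (by rw [smul_eq_mul, Nat.mul_comm])
  refine le_trans ?_ (hA (m z))
  rw [← Set.ncard_coe_finset]
  refine Set.ncard_le_ncard_of_injOn m (fun z' hz' => ?_) m.injective.injOn (Set.toFinite _)
  simpa using hz'

/-- The last move is an expander edge, from a position of either kind, or a detour through the tree,
which cannot start at `z₀` because an expander edge has been used. -/
theorem reachSet_true_subset {t : ℕ} (ht : 6 ≤ t) : reachSet A m z₀ true t ⊆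
    (expanderNeighbors A m (reachSet A m z₀ false (t - 6)) ∪
      expanderNeighbors A m (reachSet A m z₀ true (t - 6))) ∪
      blockUnion 12 t (reachSet A m z₀ true) := by
  intro z' hz'
  obtain ⟨q, hq, h⟩ := mem_reachSet.1 hz'
  cases h with
  | up b z z' t' h hz hh hzz =>
    rw [mem_union]
    rcases blockReach_leaf hz with ⟨h, -⟩ | ⟨q', hq', rfl⟩
    · cases h
    · exact Or.inr (mem_blockUnion hh (by omega) (mem_reachSet.2 ⟨q', by omega, hq'⟩) hzz)
  | edge b z z' t' hz hzz =>
    have hm : z ∈ reachSet A m z₀ b (t - 6) := mem_reachSet.2 ⟨t', by omega, hz⟩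
    have hm' : z' ∈ expanderNeighbors A m (reachSet A m z₀ b (t - 6)) := by
      simp only [expanderNeighbors, mem_biUnion, mem_filter, mem_univ, true_and]
      exact ⟨z, hm, hzz⟩
    rw [mem_union, mem_union]
    cases b
    · exact Or.inl (Or.inl hm')
    · exact Or.inl (Or.inr hm')

theorem six_le_of_mem_reachSet {b : Bool} {t : ℕ} {z : Bool × TreeLeaf k}
    (h : z ∈ reachSet A m z₀ b t) : 6 ≤ t := by
  obtain ⟨q, hq, h⟩ := mem_reachSet.1 h
  cases h <;> omega

/-- The growth function that dominates the numbers of reached positions. -/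
noncomputable def growth (k t : ℕ) : ℝ := (12 / 5) ^ t + (2 / 3) ^ k * 3 ^ t

theorem growth_pos (k t : ℕ) : 0 < growth k t := by unfold growth; positivity

theorem one_le_growth (k t : ℕ) : 1 ≤ growth k t := by
  have h1 : (1 : ℝ) ≤ (12 / 5) ^ t := one_le_pow₀ (by norm_num)
  have h2 : (0 : ℝ) ≤ (2 / 3) ^ k * 3 ^ t := by positivity
  unfold growth
  linarith

/-- Both `(12 / 5) ^ 6` and `3 ^ 6` exceed 100. Here the path length 12 matters: one long edge has
half-length 6 and pays a factor 100. -/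
theorem growth_le (k t : ℕ) : growth k t ≤ 1 / 100 * growth k (t + 6) := by
  have h1 : (0 : ℝ) ≤ (12 / 5) ^ t := by positivity
  have h2 : (0 : ℝ) ≤ (2 / 3) ^ k * 3 ^ t := by positivity
  unfold growth
  rw [pow_add, pow_add]
  norm_num
  nlinarith

/-- The two terms are the exact values in the regimes `h ≤ k` and `k ≤ h`. -/
theorem leavesBelow_le {k h : ℕ} (hh : h ≤ 2 * k) :
    (leavesBelow k h : ℝ) ≤ 2 ^ h + (2 / 3) ^ k * 3 ^ h := by
  rcases le_total h k with hk | hk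
  · rw [leavesBelow_of_le hk]
    push_cast
    have : (0 : ℝ) ≤ (2 / 3) ^ k * 3 ^ h := by positivity
    linarith
  · obtain ⟨d, rfl⟩ := Nat.exists_eq_add_of_le hk
    rw [leavesBelow_add (by omega)]
    push_cast
    have h1 : ((2 : ℝ) / 3) ^ k * 3 ^ (k + d) = 2 ^ k * 3 ^ d := by
      rw [div_pow, pow_add]
      field_simp
    have h2 : (0 : ℝ) ≤ 2 ^ (k + d) := by positivity
    linarith

theorem pow_mul_le (k : ℕ) : ((2 : ℝ) / 3) ^ k * (2 * k + 1) ≤ 9 / 4 := by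
  -- The sequence decreases only from `k = 2` on, so the induction starts there.
  have h : ∀ j : ℕ, ((2 : ℝ) / 3) ^ (j + 2) * (2 * (j + 2 : ℕ) + 1) ≤ 9 / 4 := by
    intro j
    induction j with
    | zero => norm_num
    | succ j ih =>
      refine le_trans ?_ ih
      rw [show j + 1 + 2 = (j + 2) + 1 by ring, pow_succ, mul_assoc]
      refine mul_le_mul_of_nonneg_left ?_ (by positivity)
      push_cast
      have : (0 : ℝ) ≤ j := Nat.cast_nonneg _
      linarith
  rcases k with _ | _ | k
  · norm_num
  · norm_num
  · exact_mod_cast h k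

theorem sum_geom_le {x y : ℝ} (hx : 0 ≤ x) (hxy : x < y) (t : ℕ) :
    ∑ h ∈ range (t + 1), x ^ h * y ^ (t - h) ≤ y / (y - x) * y ^ t := by
  have h1 := (Commute.all x y).geom_sum₂_mul (t + 1)
  simp only [Nat.add_sub_cancel] at h1
  rw [div_mul_eq_mul_div, le_div_iff₀ (by linarith)]
  have h2 : 0 ≤ x ^ (t + 1) := by positivity
  rw [pow_succ y] at h1
  linarith

/-- The product of the two sums of exponentials has four terms. Three give geometric sums with
constants 6, 3 and 5, because `2 < 12 / 5 < 3`. In the fourth both factors have base 3, so there is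
no decay, but the surplus factor `(2 / 3) ^ k` absorbs the number `2 * k + 1` of summands. -/
theorem sum_leavesBelow_mul_growth_le (k t : ℕ) :
    ∑ h ∈ (range (2 * k + 1)).filter (· ≤ t), leavesBelow k h * growth k (t - h) ≤
      11 * growth k t := by
  set τ : ℝ := (2 / 3) ^ k with hτ
  have hτ0 : 0 < τ := by positivity
  have hsub : (range (2 * k + 1)).filter (· ≤ t) ⊆ range (t + 1) := by
    intro h hh
    simp only [mem_filter, mem_range] at hh ⊢
    omega
  have key : ∀ h ∈ (range (2 * k + 1)).filter (· ≤ t), leavesBelow k h * growth k (t - h) ≤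
      (2 ^ h * (12 / 5) ^ (t - h) + τ * (2 ^ h * 3 ^ (t - h)) +
        τ * (3 ^ h * (12 / 5) ^ (t - h))) + τ ^ 2 * 3 ^ t := by
    intro h hh
    simp only [mem_filter, mem_range] at hh
    have h1 := leavesBelow_le (k := k) (h := h) (by omega)
    refine (mul_le_mul_of_nonneg_right h1 (growth_pos k (t - h)).le).trans (le_of_eq ?_)
    have h2 : (3 : ℝ) ^ t = 3 ^ h * 3 ^ (t - h) := by
      rw [← pow_add, Nat.add_sub_cancel' hh.2]
    rw [h2]
    unfold growth
    ring
  refine (sum_le_sum key).trans ?_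
  rw [sum_add_distrib]
  have h1 : ∑ h ∈ (range (2 * k + 1)).filter (· ≤ t), ((2 : ℝ) ^ h * (12 / 5) ^ (t - h) +
      τ * (2 ^ h * 3 ^ (t - h)) + τ * (3 ^ h * (12 / 5) ^ (t - h))) ≤
      6 * (12 / 5) ^ t + τ * (3 * 3 ^ t) + τ * (5 * 3 ^ t) := by
    refine (sum_le_sum_of_subset_of_nonneg hsub fun _ _ _ => by positivity).trans ?_
    rw [sum_add_distrib, sum_add_distrib, ← mul_sum, ← mul_sum]
    have e1 := sum_geom_le (x := 2) (y := 12 / 5) (by norm_num) (by norm_num) t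
    have e2 := sum_geom_le (x := 2) (y := 3) (by norm_num) (by norm_num) t
    -- Here the factor `3 ^ h` of the block dominates, so the sum is reversed.
    have e3 : ∑ h ∈ range (t + 1), (3 : ℝ) ^ h * (12 / 5) ^ (t - h) ≤ 5 * 3 ^ t := by
      have h := sum_geom_le (x := 12 / 5) (y := 3) (by norm_num) (by norm_num) t
      rw [← sum_range_reflect] at h
      refine le_trans (le_of_eq (sum_congr rfl fun j hj => ?_))
        (h.trans (le_of_eq (by norm_num)))
      have hj := mem_range.1 hj
      rw [show t + 1 - 1 - j = t - j by omega, show t - (t - j) = j by omega, mul_comm]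
    norm_num at e1 e2
    gcongr
  have h2 : ∑ h ∈ (range (2 * k + 1)).filter (· ≤ t), τ ^ 2 * (3 : ℝ) ^ t ≤
      9 / 4 * (τ * 3 ^ t) := by
    rw [sum_const, nsmul_eq_mul]
    have h3 : (#((range (2 * k + 1)).filter (· ≤ t)) : ℝ) ≤ 2 * k + 1 := by
      have := card_filter_le (range (2 * k + 1)) (· ≤ t)
      rw [card_range] at this
      exact_mod_cast this
    have h4 := pow_mul_le k
    calc _ ≤ (2 * k + 1 : ℝ) * (τ ^ 2 * 3 ^ t) := by gcongr
      _ = (τ * (2 * k + 1)) * (τ * 3 ^ t) := by ring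
      _ ≤ 9 / 4 * (τ * 3 ^ t) := by gcongr
  have h3 : 0 ≤ τ * 3 ^ t := by positivity
  have h4 : (0 : ℝ) ≤ (12 / 5) ^ t := by positivity
  unfold growth
  rw [← hτ]
  linarith

theorem card_blockUnion_le_growth (r t : ℕ) (X : ℕ → Finset (Bool × TreeLeaf k)) {D : ℝ}
    (hD : 0 ≤ D)
    (hX : ∀ h, h ≤ 2 * k → r + h ≤ t → #(X (t - (r + h))) ≤ D * growth k (t - (r + h))) :
    #(blockUnion r t X) ≤ if r ≤ t then 11 * D * growth k (t - r) else 0 := by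
  have h1 : (#(blockUnion r t X) : ℝ) ≤ ∑ h ∈ (range (2 * k + 1)).filter (r + · ≤ t),
      (leavesBelow k h : ℝ) * #(X (t - (r + h))) := by
    exact_mod_cast card_blockUnion_le r t X
  refine h1.trans ?_
  split_ifs with hr
  · have h2 : (range (2 * k + 1)).filter (r + · ≤ t) = (range (2 * k + 1)).filter (· ≤ t - r) := by
      ext h
      simp only [mem_filter, mem_range]
      omega
    have h3 := mul_le_mul_of_nonneg_left (sum_leavesBelow_mul_growth_le k (t - r)) hD
    rw [mul_sum] at h3
    refine le_trans ?_ (h3.trans (le_of_eq (by ring)))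
    rw [← h2]
    refine sum_le_sum fun h hh => ?_
    simp only [mem_filter, mem_range] at hh
    rw [Nat.sub_sub, mul_left_comm]
    gcongr
    exact hX h (by omega) hh.2
  · have h2 : (range (2 * k + 1)).filter (r + · ≤ t) = ∅ := by
      ext h
      simp only [mem_filter, mem_range, notMem_empty, iff_false]
      omega
    rw [h2, sum_empty]

/-! ### Bounds for the numbers of positions reached -/

theorem growth_sub_le {k t : ℕ} (ht : 6 ≤ t) : growth k (t - 6) ≤ 1 / 100 * growth k t := by
  have := growth_le k (t - 6)
  rwa [Nat.sub_add_cancel ht] at this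

theorem growth_sub_le' {k t : ℕ} (ht : 12 ≤ t) : growth k (t - 12) ≤ 1 / 10000 * growth k t := by
  have h1 := growth_sub_le (k := k) (show 6 ≤ t by omega)
  have h2 := growth_sub_le (k := k) (show 6 ≤ t - 6 by omega)
  rw [Nat.sub_sub] at h2
  norm_num at h2
  linarith

/-- The first climb costs one long edge and contributes `11 / 100`; every further one costs two, and
contributes `11 * (12 / 100) / 10000`, which is less than `1 / 100`. -/
theorem card_reachSet_false_le (t : ℕ) :
    (#(reachSet A m z₀ false t) : ℝ) ≤ 12 / 100 * growth k t := by
  induction t using Nat.strong_induction_on with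
  | _ t ih =>
    have hg := growth_pos k t
    have h1 : (#(reachSet A m z₀ false t) : ℝ) ≤ #(blockUnion 6 t fun _ => {z₀}) +
        #(blockUnion 12 t (reachSet A m z₀ false)) := by
      exact_mod_cast (card_le_card (reachSet_false_subset t)).trans (card_union_le _ _)
    have h2 := card_blockUnion_le_growth 6 t (fun _ => {z₀}) zero_le_one
      (fun h _ _ => by simpa using one_le_growth k _)
    have h3 := card_blockUnion_le_growth 12 t (reachSet A m z₀ false) (D := 12 / 100)
      (by norm_num) (fun h _ _ => ih _ (by omega))
    have h4 : (#(blockUnion 6 t fun _ => {z₀}) : ℝ) ≤ 11 / 100 * growth k t := by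
      refine h2.trans ?_
      split_ifs with h
      · have := growth_sub_le (k := k) h
        linarith
      · positivity
    have h5 : (#(blockUnion 12 t (reachSet A m z₀ false)) : ℝ) ≤ 1 / 100 * growth k t := by
      refine h3.trans ?_
      split_ifs with h
      · have := growth_sub_le' (k := k) h
        linarith
      · positivity
    linarith

/-- An expander edge multiplies by at most 3 and divides by 100: the first one gives `36 / 10000`,
and further edges and climbs fit into the remaining `4 / 10000`. -/
theorem card_reachSet_true_le (hA : ∀ a, (A.neighborSet a).ncard ≤ 3) (t : ℕ) :
    (#(reachSet A m z₀ true t) : ℝ) ≤ 40 / 10000 * growth k t := by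
  induction t using Nat.strong_induction_on with
  | _ t ih =>
    have hg := growth_pos k t
    by_cases ht : 6 ≤ t
    · have h1 : (#(reachSet A m z₀ true t) : ℝ) ≤
          #(expanderNeighbors A m (reachSet A m z₀ false (t - 6))) +
          #(expanderNeighbors A m (reachSet A m z₀ true (t - 6))) +
          #(blockUnion 12 t (reachSet A m z₀ true)) := by
        exact_mod_cast (card_le_card (reachSet_true_subset ht)).trans ((card_union_le _ _).trans
          (Nat.add_le_add_right (card_union_le _ _) _))
      have h2 : (#(expanderNeighbors A m (reachSet A m z₀ false (t - 6))) : ℝ) ≤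
          3 * #(reachSet A m z₀ false (t - 6)) := by exact_mod_cast card_expanderNeighbors_le hA _
      have h3 : (#(expanderNeighbors A m (reachSet A m z₀ true (t - 6))) : ℝ) ≤
          3 * #(reachSet A m z₀ true (t - 6)) := by exact_mod_cast card_expanderNeighbors_le hA _
      have h4 := card_reachSet_false_le (A := A) (m := m) (z₀ := z₀) (t - 6)
      have h5 := ih (t - 6) (by omega)
      have h6 := growth_sub_le (k := k) ht
      have h7 : (#(blockUnion 12 t (reachSet A m z₀ true)) : ℝ) ≤ 1 / 10000 * growth k t := by
        refine (card_blockUnion_le_growth 12 t (reachSet A m z₀ true) (D := 40 / 10000)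
          (by norm_num) (fun h _ _ => ih _ (by omega))).trans ?_
        split_ifs with h
        · have := growth_sub_le' (k := k) h
          linarith
        · positivity
      linarith
    · rw [card_eq_zero.2 (eq_empty_of_forall_notMem fun z hz => ht (six_le_of_mem_reachSet hz))]
      rw [Nat.cast_zero]
      positivity

/-- Two numerical facts decide this: `(12 / 5) ^ 2 < 6` and `2 / 3 * 3 ^ 2 = 6`. -/
theorem growth_end_le (k : ℕ) : growth k (2 * k + 1) ≤ 6 * 6 ^ k := by
  unfold growth
  rw [pow_succ (12 / 5 : ℝ) (2 * k), pow_mul, pow_succ (3 : ℝ) (2 * k), pow_mul]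
  have h1 : ((12 / 5 : ℝ) ^ 2) ^ k ≤ 6 ^ k := by gcongr; norm_num
  have h2 : ((2 : ℝ) / 3) ^ k * (3 ^ 2) ^ k = 6 ^ k := by rw [← mul_pow]; norm_num
  have h3 : (0 : ℝ) < 6 ^ k := by positivity
  nlinarith

/-- From a given leaf, walks that avoid the apex and are not longer than `4 * k + 2` reach fewer
than half of the leaves of the other tree. -/
theorem card_reached_le (hA : ∀ a, (A.neighborSet a).ncard ≤ 3) (s s' : Bool) (hs : s ≠ s')
    (l : TreeLeaf k) (R : Finset (TreeLeaf k))
    (hR : ∀ r ∈ R, ∃ b z q h, BlockReach A m (s, l) b false z q ∧ h ≤ 2 * k ∧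
      SameBlock h z (s', r) ∧ 2 * q + 2 * h ≤ 4 * k + 2) : (#R : ℝ) ≤ 6 ^ k / 2 := by
  have hsub : R.image (Prod.mk s') ⊆ blockUnion 6 (2 * k + 1) (reachSet A m (s, l) true) := by
    intro y hy
    obtain ⟨r, hr, rfl⟩ := mem_image.1 hy
    obtain ⟨b, z, q, h, h1, h2, h3, h4⟩ := hR r hr
    cases b with
    -- The target lies in the other tree, so an expander edge must have been used.
    | false => exact absurd ((blockReach_false_side h1 rfl).symm.trans h3.1) hs
    | true =>
      rcases blockReach_leaf h1 with ⟨h, -⟩ | ⟨q', hq', rfl⟩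
      · cases h
      · exact mem_blockUnion h2 (by omega) (mem_reachSet.2 ⟨q', by omega, hq'⟩) h3
  have h1 : (#R : ℝ) ≤ #(blockUnion 6 (2 * k + 1) (reachSet A m (s, l) true)) := by
    rw [← card_image_of_injective R (Prod.mk_right_injective s')]
    exact_mod_cast card_le_card hsub
  refine h1.trans ((card_blockUnion_le_growth 6 (2 * k + 1) (reachSet A m (s, l) true)
    (D := 40 / 10000) (by norm_num) (fun h _ _ => card_reachSet_true_le hA _)).trans ?_)
  have hpos : (0 : ℝ) < 6 ^ k := by positivity
  split_ifs with h
  -- The final matching edge gains another factor 100, so the bound is `11 * (40 / 10000) / 100 * 6`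
  -- times `6 ^ k`, far below one half.
  · have h2 := growth_sub_le (k := k) h
    have h3 := growth_end_le k
    linarith
  · positivity

end Reach

/-! ### The graph of two trees, expander and apex -/

section Join

open Finset
open scoped Classical

variable {k : ℕ} {A : SimpleGraph (Fin (2 * 6 ^ k))} {m : Bool × TreeLeaf k ≃ Fin (2 * 6 ^ k)}

theorem joinGraph_degree_le (hA : ∀ a, (A.neighborSet a).ncard ≤ 3) (v : JoinVertex A m 12) :
    ((joinGraph A m 12).neighborSet v).ncard ≤ 4 := by
  rcases v with v | p
  · exact (subdivide_degree_inl (by norm_num) v).trans (baseGraph_degree_le hA v)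
  · exact (subdivide_degree_inr p).trans (by norm_num)

theorem joinGraph_degree_leaf (s : Bool) (l : TreeLeaf k) :
    ((joinGraph A m 12).neighborSet (joinLeaf A m 12 s l)).ncard ≤ 2 :=
  (subdivide_degree_inl (by norm_num) _).trans (baseGraph_degree_leaf s l)

theorem exists_le_edgeExpansion_joinGraph (α : ℝ≥0) (hα : 0 < α) : ∃ β : ℝ≥0, 0 < β ∧
    ∀ (k : ℕ) (A : SimpleGraph (Fin (2 * 6 ^ k))) (m : Bool × TreeLeaf k ≃ Fin (2 * 6 ^ k)),
      (∀ a, (A.neighborSet a).ncard ≤ 3) → (α : ℝ≥0∞) ≤ edgeExpansion A →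
      (β : ℝ≥0∞) ≤ edgeExpansion (joinGraph A m 12) := by
  set γ : ℝ≥0 := α / (((7 : ℕ) : ℝ≥0) * (((5 : ℕ) : ℝ≥0) + α)) with hγ
  have hγ0 : 0 < γ := by positivity
  refine ⟨_, ?_, fun k A m hA h => le_edgeExpansion_subdivide (by norm_num) 4
    (baseGraph_degree_le hA) γ hγ0 (le_edgeExpansion_baseGraph α hα h)⟩
  positivity

instance : Nonempty (JoinVertex A m 12) := ⟨joinApex A m 12⟩

/-- The factor `450 = 45 * 10` combines `1 + 11 * 4` from the subdivision with at most `10 * 6 ^ k`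
vertices in the base graph. -/
theorem card_joinVertex_le (hA : ∀ a, (A.neighborSet a).ncard ≤ 3) :
    Fintype.card (JoinVertex A m 12) ≤ 450 * 6 ^ k := by
  have h1 := card_le_of_transfer (G := joinGraph A m 12) Sum.inl _ _
    (fun S => subdivide_card_le S (by norm_num) 4 (baseGraph_degree_le hA))
  have h2 := card_baseVertex_le k
  omega

theorem le_card_joinVertex : 2 * 6 ^ k ≤ Fintype.card (JoinVertex A m 12) := by
  have := Fintype.card_le_of_injective
    (fun a : Fin (2 * 6 ^ k) => (Sum.inl (baseExp a) : JoinVertex A m 12))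
    (fun a b h => baseExp_injective (Sum.inl_injective h))
  simpa using this

theorem not_mem_longEdges {u v : BaseVertex k} (hu : ∀ a, baseExp a ≠ u)
    (hv : ∀ a, baseExp a ≠ v) : s(u, v) ∉ longEdges k := by
  rintro ⟨a, ha⟩
  rcases Sym2.mem_iff.1 ha with h | h
  · exact hu a h
  · exact hv a h

theorem exists_walk_to_apex (s : Bool) (d : ℕ) (x : TreeNode k) (hx : (x.1 : ℕ) = d) :
    ∃ w : (joinGraph A m 12).Walk (Sum.inl (baseTree s x)) (joinApex A m 12),
      w.length = d + 1 := by
  induction d generalizing x with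
  | zero =>
    have hroot : x = treeRoot k := by
      refine treeNode_ext hx ?_
      obtain ⟨⟨d, hd⟩, j⟩ := x
      obtain rfl : d = 0 := hx
      have : (j : ℕ) < 1 := j.2
      exact Nat.lt_one_iff.1 this
    subst hroot
    have h : (joinGraph A m 12).Adj (joinApex A m 12) (Sum.inl (baseTree s (treeRoot k))) :=
      subdivide_adj_inl (baseGraph_adj_of_rel (BaseRel.apex s)) (not_mem_longEdges
        (fun a => (baseApex_ne_baseExp a).symm) (fun a => (baseTree_ne_baseExp _ _ a).symm))
    exact ⟨SimpleGraph.Walk.cons h.symm SimpleGraph.Walk.nil, rfl⟩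
  | succ d ih =>
    obtain ⟨⟨d', hd⟩, j⟩ := x
    obtain rfl : d' = d + 1 := hx
    have hb := two_le_branching k d
    have hj : (j : ℕ) / branching k d < levelSize k d :=
      Nat.div_lt_of_lt_mul (lt_of_lt_of_eq j.2 (Nat.mul_comm _ _))
    let y : TreeNode k := ⟨⟨d, by omega⟩, ⟨_, hj⟩⟩
    obtain ⟨w, hw⟩ := ih y rfl
    have h : (joinGraph A m 12).Adj (Sum.inl (baseTree s y))
        (Sum.inl (baseTree s ⟨⟨d + 1, hd⟩, j⟩)) :=
      subdivide_adj_inl (baseGraph_adj_of_rel (BaseRel.tree s y _ ⟨rfl, rfl⟩)) (not_mem_longEdges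
        (fun a => (baseTree_ne_baseExp _ _ a).symm) (fun a => (baseTree_ne_baseExp _ _ a).symm))
    exact ⟨SimpleGraph.Walk.cons h.symm w, by rw [SimpleGraph.Walk.length_cons, hw]⟩

theorem dist_joinLeaf_le (l r : TreeLeaf k) :
    (joinGraph A m 12).dist (joinLeaf A m 12 false l) (joinLeaf A m 12 true r) ≤ 4 * k + 2 := by
  obtain ⟨w, hw⟩ := exists_walk_to_apex (A := A) (m := m) false (2 * k) l.node rfl
  obtain ⟨w', hw'⟩ := exists_walk_to_apex (A := A) (m := m) true (2 * k) r.node rfl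
  refine (SimpleGraph.dist_le (w.append w'.reverse)).trans ?_
  rw [SimpleGraph.Walk.length_append, SimpleGraph.Walk.length_reverse, hw, hw']
  omega

theorem card_treeLeaf (k : ℕ) : Fintype.card (TreeLeaf k) = 6 ^ k := by
  rw [Fintype.card_fin, levelSize_leaves]

/-- For a pair that fails, some geodesic avoids the apex. Its length is at most `4 * k + 2`, the
length of the route through the apex, so `card_reached_le` limits these pairs for each left leaf. -/
theorem le_ncard_apexPairs (hA : ∀ a, (A.neighborSet a).ncard ≤ 3) :
    (6 ^ k : ℝ) ^ 2 / 2 ≤ ((apexPairs A m 12).ncard : ℝ) := by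
  have key : ∀ l : TreeLeaf k,
      (6 ^ k : ℝ) / 2 ≤ #({r | (l, r) ∈ apexPairs A m 12} : Finset (TreeLeaf k)) := by
    intro l
    have h1 := card_reached_le (m := m) hA false true (by simp) l
      ({r | (l, r) ∈ apexPairs A m 12} : Finset (TreeLeaf k))ᶜ ?_
    · rw [card_compl, Nat.cast_sub (card_le_univ _), card_treeLeaf] at h1
      push_cast at h1
      linarith
    · intro r hr
      have hr' : (l, r) ∉ apexPairs A m 12 := fun h =>
        mem_compl.1 hr (mem_filter.2 ⟨mem_univ _, h⟩)
      rw [apexPairs, Set.mem_ofPred_eq] at hr'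
      push Not at hr'
      obtain ⟨w, hw, hapex⟩ := hr'
      obtain ⟨b, z, q, h, h1, h2, h3, h4⟩ := blockReach_of_walk w hapex
      have h5 : w.length ≤ 4 * k + 2 := by
        rw [show w.length = _ from hw]
        exact dist_joinLeaf_le l r
      exact ⟨b, z, q, h, h1, h2, h3, h4.trans h5⟩
  have h2 : ((apexPairs A m 12).ncard : ℝ) =
      ∑ l : TreeLeaf k, (#({r | (l, r) ∈ apexPairs A m 12} : Finset (TreeLeaf k)) : ℝ) := by
    have h3 : (apexPairs A m 12).ncard =
        #({p | p ∈ apexPairs A m 12} : Finset (TreeLeaf k × TreeLeaf k)) := by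
      rw [← Set.ncard_coe_finset]
      congr 1
      ext p
      simp
    rw [h3, card_filter, Fintype.sum_prod_type]
    push_cast
    refine sum_congr rfl fun l _ => ?_
    rw [card_filter]
    push_cast
    rfl
  rw [h2]
  refine le_trans ?_ (sum_le_sum fun l _ => key l)
  rw [sum_const, card_univ, card_treeLeaf, nsmul_eq_mul]
  push_cast
  exact le_of_eq (by ring)

theorem joinLeaf_ne (l r : TreeLeaf k) : joinLeaf A m 12 false l ≠ joinLeaf A m 12 true r := by
  intro h
  have := (baseTree_inj.1 (Sum.inl_injective h)).1
  simp at this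

theorem joinGraph_spec : ∃ c : ℕ, 0 < c ∧ Even c ∧ ∃ K κ₁ κ₂ : ℝ, 0 < K ∧ 0 < κ₁ ∧ 0 < κ₂ ∧
    ∀ α : ℝ≥0, 0 < α → ∃ β : ℝ≥0, 0 < β ∧
      ∀ (k : ℕ) (A : SimpleGraph (Fin (2 * 6 ^ k))) (m : Bool × TreeLeaf k ≃ Fin (2 * 6 ^ k)),
        (∀ a, (A.neighborSet a).ncard ≤ 3) → (α : ℝ≥0∞) ≤ edgeExpansion A →
        (joinGraph A m c).Connected ∧
        (∀ v, ((joinGraph A m c).neighborSet v).ncard ≤ 4) ∧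
        (β : ℝ≥0∞) ≤ edgeExpansion (joinGraph A m c) ∧
        6 ^ k ≤ Fintype.card (JoinVertex A m c) ∧
        (Fintype.card (JoinVertex A m c) : ℝ) ≤ K * 6 ^ k ∧
        (6 ^ k : ℝ) ^ 2 / 2 ≤ ((apexPairs A m c).ncard : ℝ) ∧
        κ₁ * (Fintype.card (JoinVertex A m c) : ℝ) ^ 2 ≤ maxCongestion (joinGraph A m c) ∧
        maxCongestion (joinGraph A m c) ≤ κ₂ * (Fintype.card (JoinVertex A m c) : ℝ) ^ 2 := by
  -- At least `(6 ^ k) ^ 2 / 2` pairs, taken in one order only, count with weight `1 / 2`; this and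
  -- `450` give the lower constant.
  refine ⟨12, by norm_num, by decide, 450, 1 / (4 * 450 ^ 2), 1 / 2, by norm_num, by norm_num,
    by norm_num, fun α hα => ?_⟩
  obtain ⟨β, hβ, h⟩ := exists_le_edgeExpansion_joinGraph α hα
  refine ⟨β, hβ, fun k A m hA hα' => ?_⟩
  have hexp := h k A m hA hα'
  have hconn := connected_of_le_edgeExpansion β hβ hexp
  have hcard : (Fintype.card (JoinVertex A m 12) : ℝ) ≤ 450 * 6 ^ k := by
    exact_mod_cast card_joinVertex_le hA
  refine ⟨hconn, joinGraph_degree_le hA, hexp,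
    le_trans (by omega) (le_card_joinVertex (A := A) (m := m)), hcard, le_ncard_apexPairs hA, ?_,
    maxCongestion_le⟩
  have hpairs := card_pairs_le_maxCongestion hconn (joinApex A m 12)
    ((Set.toFinite (apexPairs A m 12)).toFinset.image
      fun p => (joinLeaf A m 12 false p.1, joinLeaf A m 12 true p.2)) (by
    intro p hp
    obtain ⟨q, hq, rfl⟩ := mem_image.1 hp
    exact ⟨joinLeaf_ne _ _, (Set.Finite.mem_toFinset _).1 hq⟩)
  rw [card_image_of_injective, ← Set.ncard_eq_toFinset_card] at hpairs
  · have h1 := le_ncard_apexPairs (m := m) hA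
    have h2 : (Fintype.card (JoinVertex A m 12) : ℝ) ^ 2 ≤ (450 * 6 ^ k) ^ 2 := by gcongr
    refine le_trans ?_ hpairs
    rw [mul_pow] at h2
    linarith
  · intro p q h
    rw [Prod.mk.injEq] at h
    exact Prod.ext (leaf_node_injective (baseTree_inj.1 (Sum.inl_injective h.1)).2)
      (leaf_node_injective (baseTree_inj.1 (Sum.inl_injective h.2)).2)

end Join

/-! ### The spectral gap of the shears and translations of `(ℤ/m)²` -/

section Margulis

open Finset
open scoped Classical ComplexConjugate

variable {m : ℕ} [NeZero m]

/-- The character of `(ℤ/m)²` with frequency `q`. -/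
noncomputable def gridChar (q p : ZMod m × ZMod m) : ℂ :=
  ZMod.stdAddChar (q.1 * p.1 + q.2 * p.2)

/-- The discrete Fourier transform on `(ℤ/m)²`. -/
noncomputable def gridFourier (f : ZMod m × ZMod m → ℂ) (q : ZMod m × ZMod m) : ℂ :=
  ∑ p, f p * gridChar q p

theorem sum_gridChar_mul_conj (p p' : ZMod m × ZMod m) :
    ∑ q, gridChar q p * conj (gridChar q p') = if p = p' then (m : ℂ) ^ 2 else 0 := by
  have h1 : ∀ q, gridChar q p * conj (gridChar q p') =
      ZMod.stdAddChar (q.1 * (p.1 - p'.1)) * ZMod.stdAddChar (q.2 * (p.2 - p'.2)) := by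
    intro q
    unfold gridChar
    rw [← AddChar.map_neg_eq_conj, ← AddChar.map_add_eq_mul, ← AddChar.map_add_eq_mul]
    congr 1
    ring
  simp only [h1]
  rw [Fintype.sum_prod_type]
  simp only [← mul_sum]
  rw [← sum_mul, AddChar.sum_mulShift _ (ZMod.isPrimitive_stdAddChar m),
    AddChar.sum_mulShift _ (ZMod.isPrimitive_stdAddChar m)]
  by_cases h : p = p'
  · subst h
    simp [sq]
  · rw [if_neg h]
    by_cases h2 : p.1 = p'.1
    · have h3 : p.2 - p'.2 ≠ 0 := fun h3 => h (Prod.ext h2 (sub_eq_zero.1 h3))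
      simp [h3]
    · have h3 : p.1 - p'.1 ≠ 0 := sub_ne_zero.2 h2
      simp [h3]

/-- Plancherel, from the orthogonality of the characters. -/
theorem sum_norm_sq_gridFourier (f : ZMod m × ZMod m → ℂ) :
    ∑ q, ‖gridFourier f q‖ ^ 2 = (m : ℝ) ^ 2 * ∑ p, ‖f p‖ ^ 2 := by
  have h : ∑ q, gridFourier f q * conj (gridFourier f q) =
      (m : ℂ) ^ 2 * ∑ p, f p * conj (f p) := by
    have h1 : ∀ q, gridFourier f q * conj (gridFourier f q) =
        ∑ p, ∑ p', f p * conj (f p') * (gridChar q p * conj (gridChar q p')) := by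
      intro q
      unfold gridFourier
      rw [map_sum, sum_mul_sum]
      refine sum_congr rfl fun p _ => sum_congr rfl fun p' _ => ?_
      rw [map_mul]
      ring
    simp only [h1]
    rw [sum_comm, mul_sum]
    refine sum_congr rfl fun p _ => ?_
    rw [sum_comm]
    simp only [← mul_sum, sum_gridChar_mul_conj]
    simp [mul_comm]
  simp only [Complex.mul_conj'] at h
  exact_mod_cast h

theorem gridFourier_sub (f g : ZMod m × ZMod m → ℂ) (q : ZMod m × ZMod m) :
    gridFourier (fun p => f p - g p) q = gridFourier f q - gridFourier g q := by
  simp [gridFourier, sub_mul]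

/-- The translations and shears of `(ℤ/m)²`. -/
def gridMap (m : ℕ) : Fin 4 → (ZMod m × ZMod m ≃ ZMod m × ZMod m)
  | 0 => ⟨fun p => (p.1 + 1, p.2), fun p => (p.1 - 1, p.2), fun p => by simp, fun p => by simp⟩
  | 1 => ⟨fun p => (p.1, p.2 + 1), fun p => (p.1, p.2 - 1), fun p => by simp, fun p => by simp⟩
  | 2 => ⟨fun p => (p.1 + 2 * p.2, p.2), fun p => (p.1 - 2 * p.2, p.2), fun p => by simp,
      fun p => by simp⟩
  | 3 => ⟨fun p => (p.1, p.2 + 2 * p.1), fun p => (p.1, p.2 - 2 * p.1), fun p => by simp,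
      fun p => by simp⟩

theorem gridFourier_comp (f : ZMod m × ZMod m → ℂ) (i : Fin 4) (q : ZMod m × ZMod m) :
    gridFourier (fun p => f (gridMap m i p)) q =
      ∑ p, f p * gridChar q ((gridMap m i).symm p) := by
  unfold gridFourier
  rw [← (gridMap m i).sum_comp (fun p => f p * gridChar q ((gridMap m i).symm p))]
  simp

theorem gridFourier_comp_zero (f : ZMod m × ZMod m → ℂ) (q : ZMod m × ZMod m) :
    gridFourier (fun p => f (gridMap m 0 p)) q =
      ZMod.stdAddChar (-q.1) * gridFourier f q := by
  rw [gridFourier_comp, gridFourier, mul_sum]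
  refine sum_congr rfl fun p _ => ?_
  rw [mul_left_comm, gridChar, gridChar, ← AddChar.map_add_eq_mul]
  congr 2
  change q.1 * (p.1 - 1) + q.2 * p.2 = _
  ring

theorem gridFourier_comp_one (f : ZMod m × ZMod m → ℂ) (q : ZMod m × ZMod m) :
    gridFourier (fun p => f (gridMap m 1 p)) q =
      ZMod.stdAddChar (-q.2) * gridFourier f q := by
  rw [gridFourier_comp, gridFourier, mul_sum]
  refine sum_congr rfl fun p _ => ?_
  rw [mul_left_comm, gridChar, gridChar, ← AddChar.map_add_eq_mul]
  congr 2
  change q.1 * p.1 + q.2 * (p.2 - 1) = _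
  ring

/-- A shear of the points acts on the frequencies by the transpose of its inverse, while a
translation only multiplies the transform by a phase. -/
theorem gridFourier_comp_two (f : ZMod m × ZMod m → ℂ) (q : ZMod m × ZMod m) :
    gridFourier (fun p => f (gridMap m 2 p)) q = gridFourier f (q.1, q.2 - 2 * q.1) := by
  rw [gridFourier_comp, gridFourier]
  refine sum_congr rfl fun p _ => ?_
  rw [gridChar, gridChar]
  congr 2
  change q.1 * (p.1 - 2 * p.2) + q.2 * p.2 = _
  ring

theorem gridFourier_comp_three (f : ZMod m × ZMod m → ℂ) (q : ZMod m × ZMod m) :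
    gridFourier (fun p => f (gridMap m 3 p)) q = gridFourier f (q.1 - 2 * q.2, q.2) := by
  rw [gridFourier_comp, gridFourier]
  refine sum_congr rfl fun p _ => ?_
  rw [gridChar, gridChar]
  congr 2
  change q.1 * p.1 + q.2 * (p.2 - 2 * p.1) = _
  ring

theorem norm_stdAddChar_sub_one (x : ZMod m) (hx : m < 8 * x.valMinAbs.natAbs) :
    1 / 4 ≤ ‖(ZMod.stdAddChar (-x) : ℂ) - 1‖ ^ 2 := by
  have hm : (0 : ℝ) < m := by exact_mod_cast Nat.pos_of_ne_zero (NeZero.ne m)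
  have hconj : ‖(ZMod.stdAddChar (-x) : ℂ) - 1‖ = ‖(ZMod.stdAddChar x : ℂ) - 1‖ := by
    rw [AddChar.map_neg_eq_conj, ← RCLike.norm_conj, map_sub, Complex.conj_conj, map_one]
  have habs : ∀ y : ℝ, |Real.sin y| = |Real.sin (abs y)| := by
    intro y
    rcases abs_choice y with h | h <;> rw [h]
    rw [Real.sin_neg, abs_neg]
  have h1 : (ZMod.stdAddChar x : ℂ) =
      Complex.exp (Complex.I * ((2 * Real.pi * x.valMinAbs / m : ℝ) : ℂ)) := by
    rw [← x.coe_valMinAbs, ZMod.stdAddChar_coe, x.coe_valMinAbs]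
    congr 1
    push_cast
    ring
  rw [hconj, h1, Complex.norm_exp_I_mul_ofReal_sub_one, Real.norm_eq_abs, abs_mul, habs,
    abs_of_pos (two_pos : (0 : ℝ) < 2)]
  have h2 : |2 * Real.pi * (x.valMinAbs : ℝ) / m / 2| =
      Real.pi * ((x.valMinAbs.natAbs : ℝ) / m) := by
    rw [show 2 * Real.pi * (x.valMinAbs : ℝ) / m / 2 = Real.pi * ((x.valMinAbs : ℝ) / m) by ring,
      abs_mul, abs_div, abs_of_pos Real.pi_pos, abs_of_pos hm, Nat.cast_natAbs, Int.cast_abs]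
  rw [h2]
  have h3 : (m : ℝ) ≤ 8 * x.valMinAbs.natAbs := by exact_mod_cast hx.le
  have h4 : (x.valMinAbs.natAbs : ℝ) * 2 ≤ m := by
    have := x.natAbs_valMinAbs_le
    exact_mod_cast (by omega : x.valMinAbs.natAbs * 2 ≤ m)
  have h5 : 1 / 8 ≤ (x.valMinAbs.natAbs : ℝ) / m := by rw [le_div_iff₀ hm]; linarith
  have h6 : (x.valMinAbs.natAbs : ℝ) / m ≤ 1 / 2 := by rw [div_le_iff₀ hm]; linarith
  have hpi := Real.pi_pos
  -- Jordan's inequality `2 / π * x ≤ sin x` on `[0, π / 2]`, where the argument is at least `π /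
  -- 8`.
  have h7 := Real.mul_le_sin (x := Real.pi * ((x.valMinAbs.natAbs : ℝ) / m)) (by positivity)
    (by nlinarith)
  rw [show 2 / Real.pi * (Real.pi * ((x.valMinAbs.natAbs : ℝ) / m)) =
    2 * ((x.valMinAbs.natAbs : ℝ) / m) by field_simp] at h7
  have h8 : 1 / 4 ≤ |Real.sin (Real.pi * ((x.valMinAbs.natAbs : ℝ) / m))| :=
    le_trans (by linarith) (le_abs_self _)
  nlinarith

/-! #### Ping-pong -/

/-- The sum of `μ` over the points with property `c`. -/
noncomputable def massOn {V : Type*} [Fintype V] (μ : V → ℝ) (c : V → Prop) : ℝ :=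
  ∑ q, if c q then μ q else 0

section MassOn

variable {V : Type*} [Fintype V] {μ : V → ℝ}

theorem massOn_le_add (hμ : ∀ q, 0 ≤ μ q) {c c₁ c₂ : V → Prop} (h : ∀ q, c q → c₁ q ∨ c₂ q) :
    massOn μ c ≤ massOn μ c₁ + massOn μ c₂ := by
  unfold massOn
  rw [← sum_add_distrib]
  refine sum_le_sum fun q _ => ?_
  have := hμ q
  have := h q
  by_cases hc : c q <;> by_cases h1 : c₁ q <;> by_cases h2 : c₂ q <;> simp_all

theorem massOn_mono (hμ : ∀ q, 0 ≤ μ q) {c d : V → Prop} (h : ∀ q, c q → d q) :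
    massOn μ c ≤ massOn μ d := by
  refine sum_le_sum fun q _ => ?_
  have := hμ q
  have := h q
  by_cases hc : c q <;> by_cases h1 : d q <;> simp_all

theorem massOn_add_le (hμ : ∀ q, 0 ≤ μ q) {d c₁ c₂ : V → Prop} (h₁ : ∀ q, c₁ q → d q)
    (h₂ : ∀ q, c₂ q → d q) (h : ∀ q, c₁ q → ¬ c₂ q) :
    massOn μ c₁ + massOn μ c₂ ≤ massOn μ d := by
  unfold massOn
  rw [← sum_add_distrib]
  refine sum_le_sum fun q _ => ?_
  have := hμ q
  have := h q
  have := h₁ q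
  have := h₂ q
  by_cases hd : d q <;> by_cases h1 : c₁ q <;> by_cases h2 : c₂ q <;> simp_all

theorem massOn_comp (φ : V ≃ V) (c : V → Prop) :
    massOn (fun q => μ (φ q)) c = massOn μ fun q => c (φ.symm q) := by
  unfold massOn
  rw [← φ.sum_comp (fun q => if c (φ.symm q) then μ q else 0)]
  simp

theorem massOn_le_of_almost_invariant (φ : V ≃ V) {E : ℝ} (hE : ∑ q, |μ (φ q) - μ q| ≤ E)
    (c : V → Prop) : massOn μ c ≤ massOn μ (fun q => c (φ.symm q)) + E := by
  rw [← massOn_comp]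
  refine le_trans ?_ (add_le_add_right hE _)
  unfold massOn
  rw [← sum_add_distrib]
  refine sum_le_sum fun q _ => ?_
  have h1 := neg_abs_le (μ (φ q) - μ q)
  have h2 := abs_nonneg (μ (φ q) - μ q)
  split_ifs <;> linarith

end MassOn

/-- The box of the frequencies whose two coordinates are at most `m / 8`. -/
def InBox (q : ZMod m × ZMod m) : Prop :=
  8 * q.1.valMinAbs.natAbs ≤ m ∧ 8 * q.2.valMinAbs.natAbs ≤ m

/-- Within the box the result has absolute value at most `3 * m / 8 < m / 2`, so nothing wraps
around and the shear acts as on integers. -/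
theorem valMinAbs_sub_two_mul {q : ZMod m × ZMod m} (hq : InBox q) :
    (q.2 - 2 * q.1).valMinAbs = q.2.valMinAbs - 2 * q.1.valMinAbs := by
  have hm := Nat.pos_of_ne_zero (NeZero.ne m)
  obtain ⟨h1, h2⟩ := hq
  rw [ZMod.valMinAbs_spec]
  refine ⟨?_, ?_⟩
  · simp
  · constructor <;> omega

theorem valMinAbs_add_two_mul {q : ZMod m × ZMod m} (hq : InBox q) :
    (q.2 + 2 * q.1).valMinAbs = q.2.valMinAbs + 2 * q.1.valMinAbs := by
  have hm := Nat.pos_of_ne_zero (NeZero.ne m)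
  obtain ⟨h1, h2⟩ := hq
  rw [ZMod.valMinAbs_spec]
  refine ⟨?_, ?_⟩
  · simp
  · constructor <;> omega

/-- The shear of the frequencies. -/
def freqShear (m : ℕ) : ZMod m × ZMod m ≃ ZMod m × ZMod m :=
  ⟨fun q => (q.1, q.2 - 2 * q.1), fun q => (q.1, q.2 + 2 * q.1), fun q => by simp, fun q => by simp⟩

/-- If `|q.2| < |q.1|`, then both `q.2 - 2 * q.1` and `q.2 + 2 * q.1` are larger than `q.1` in
absolute value, and the two images are disjoint. Near invariance therefore gives twice the mass of
the first region inside the second, up to `2 * E`. The diagonals are moved into the second region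
one by one. -/
theorem shear_mass_le (μ : ZMod m × ZMod m → ℝ) (hμ : ∀ q, 0 ≤ μ q) {E : ℝ}
    (hE : ∑ q, |μ (freqShear m q) - μ q| ≤ E) :
    2 * massOn μ (fun q => InBox q ∧ q.2.valMinAbs.natAbs < q.1.valMinAbs.natAbs) ≤
      massOn μ (fun q => q.1.valMinAbs.natAbs < q.2.valMinAbs.natAbs) + 2 * E ∧
    massOn μ (fun q => InBox q ∧ q.2.valMinAbs.natAbs = q.1.valMinAbs.natAbs ∧ q ≠ 0) ≤
      2 * massOn μ (fun q => q.1.valMinAbs.natAbs < q.2.valMinAbs.natAbs) + 2 * E := by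
  have hE' : ∑ q, |μ ((freqShear m).symm q) - μ q| ≤ E := by
    rw [← (freqShear m).sum_comp]
    simpa only [Equiv.symm_apply_apply, abs_sub_comm] using hE
  have hmap : ∀ q : ZMod m × ZMod m, InBox ((freqShear m).symm q) →
      q.1.valMinAbs = ((freqShear m).symm q).1.valMinAbs ∧ q.2.valMinAbs =
        ((freqShear m).symm q).2.valMinAbs - 2 * ((freqShear m).symm q).1.valMinAbs := by
    intro q hq
    refine ⟨rfl, ?_⟩
    rw [← valMinAbs_sub_two_mul hq]
    congr 1
    exact (congrArg Prod.snd ((freqShear m).apply_symm_apply q)).symm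
  have hmap' : ∀ q : ZMod m × ZMod m, InBox (freqShear m q) →
      q.1.valMinAbs = (freqShear m q).1.valMinAbs ∧ q.2.valMinAbs =
        (freqShear m q).2.valMinAbs + 2 * (freqShear m q).1.valMinAbs := by
    intro q hq
    refine ⟨rfl, ?_⟩
    rw [← valMinAbs_add_two_mul hq]
    congr 1
    exact (congrArg Prod.snd ((freqShear m).symm_apply_apply q)).symm
  have hne : ∀ q : ZMod m × ZMod m, q ≠ 0 → q.1.valMinAbs ≠ 0 ∨ q.2.valMinAbs ≠ 0 := by
    intro q hq
    by_contra hcon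
    push Not at hcon
    rw [ZMod.valMinAbs_eq_zero, ZMod.valMinAbs_eq_zero] at hcon
    exact hq (Prod.ext hcon.1 hcon.2)
  have hinv := massOn_le_of_almost_invariant (freqShear m) hE
  have hinv' := massOn_le_of_almost_invariant (freqShear m).symm hE'
  simp only [Equiv.symm_symm] at hinv'
  constructor
  · have h1 := hinv fun q => InBox q ∧ q.2.valMinAbs.natAbs < q.1.valMinAbs.natAbs
    have h2 := hinv' fun q => InBox q ∧ q.2.valMinAbs.natAbs < q.1.valMinAbs.natAbs
    have h3 := massOn_add_le hμ
      (d := fun q => q.1.valMinAbs.natAbs < q.2.valMinAbs.natAbs)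
      (c₁ := fun q => InBox ((freqShear m).symm q) ∧
        ((freqShear m).symm q).2.valMinAbs.natAbs < ((freqShear m).symm q).1.valMinAbs.natAbs)
      (c₂ := fun q => InBox (freqShear m q) ∧
        (freqShear m q).2.valMinAbs.natAbs < (freqShear m q).1.valMinAbs.natAbs)
      (fun q ⟨hq, h⟩ => by obtain ⟨e1, e2⟩ := hmap q hq; omega)
      (fun q ⟨hq, h⟩ => by obtain ⟨e1, e2⟩ := hmap' q hq; omega)
      -- The second coordinate has the sign opposite to the first in one image and the same sign in
      -- the other.
      (fun q ⟨hq, h⟩ ⟨hq', h'⟩ => by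
        obtain ⟨e1, e2⟩ := hmap q hq
        obtain ⟨e3, e4⟩ := hmap' q hq'
        omega)
    linarith
  -- The direction is chosen so that `(x, x)` and `(x, -x)` go to `(x, 3 * x)` and `(x, -3 * x)`;
  -- the other one would only exchange the diagonals.
  · have h1 := hinv' fun q => InBox q ∧ q.2.valMinAbs = q.1.valMinAbs ∧ q ≠ 0
    have h2 := hinv fun q => InBox q ∧ q.2.valMinAbs = -q.1.valMinAbs ∧ q ≠ 0
    have h3 := massOn_mono hμ
      (c := fun q => InBox (freqShear m q) ∧
        (freqShear m q).2.valMinAbs = (freqShear m q).1.valMinAbs ∧ freqShear m q ≠ 0)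
      (d := fun q => q.1.valMinAbs.natAbs < q.2.valMinAbs.natAbs)
      (fun q ⟨hq, h, h0⟩ => by
        obtain ⟨e1, e2⟩ := hmap' q hq
        have := hne _ h0
        omega)
    have h4 := massOn_mono hμ
      (c := fun q => InBox ((freqShear m).symm q) ∧ ((freqShear m).symm q).2.valMinAbs =
        -((freqShear m).symm q).1.valMinAbs ∧ (freqShear m).symm q ≠ 0)
      (d := fun q => q.1.valMinAbs.natAbs < q.2.valMinAbs.natAbs)
      (fun q ⟨hq, h, h0⟩ => by
        obtain ⟨e1, e2⟩ := hmap q hq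
        have := hne _ h0
        omega)
    have h5 := massOn_le_add hμ
      (c := fun q => InBox q ∧ q.2.valMinAbs.natAbs = q.1.valMinAbs.natAbs ∧ q ≠ 0)
      (c₁ := fun q => InBox q ∧ q.2.valMinAbs = q.1.valMinAbs ∧ q ≠ 0)
      (c₂ := fun q => InBox q ∧ q.2.valMinAbs = -q.1.valMinAbs ∧ q ≠ 0)
      (fun q ⟨h1, h2, h3⟩ => by
        rcases Int.natAbs_eq_natAbs_iff.1 h2 with h | h
        · exact Or.inl ⟨h1, h, h3⟩
        · exact Or.inr ⟨h1, h, h3⟩)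
    linarith

/-- A nonnegative function on the frequencies that vanishes at `0`, has little mass outside the
box and is almost invariant under the two shears has little mass. -/
theorem mass_le (μ : ZMod m × ZMod m → ℝ) (hμ : ∀ q, 0 ≤ μ q) (h0 : μ 0 = 0) {D E : ℝ}
    (hE : ∑ q, |μ (q.1, q.2 - 2 * q.1) - μ q| ≤ E)
    (hE' : ∑ q, |μ (q.1 - 2 * q.2, q.2) - μ q| ≤ E)
    (hD : massOn μ (fun q => ¬ InBox q) ≤ D) :
    ∑ q, μ q ≤ 7 * D + 10 * E := by
  obtain ⟨h1, h2⟩ := shear_mass_le μ hμ hE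
  have hswap : ∑ q, |μ (freqShear m q).swap - μ q.swap| ≤ E := by
    rw [← (Equiv.prodComm (ZMod m) (ZMod m)).sum_comp]
    exact hE'
  obtain ⟨h3, -⟩ := shear_mass_le (fun q => μ q.swap) (fun q => hμ _) hswap
  have hs := massOn_comp (μ := μ) (Equiv.prodComm (ZMod m) (ZMod m))
  simp only [Equiv.prodComm_apply, Equiv.prodComm_symm] at hs
  rw [hs, hs] at h3
  have hbox : ∀ q : ZMod m × ZMod m, InBox q.swap ↔ InBox q := fun q => and_comm
  simp only [hbox, Prod.fst_swap, Prod.snd_swap] at h3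
  have hle : ∀ c : ZMod m × ZMod m → Prop,
      massOn μ c ≤ massOn μ (fun q => InBox q ∧ c q) + D := fun c =>
    (massOn_le_add hμ (c₂ := fun q => ¬ InBox q) (fun q hq => by tauto)).trans
      (add_le_add_right hD _)
  have h4 := hle fun q => q.1.valMinAbs.natAbs < q.2.valMinAbs.natAbs
  have h5 := hle fun q => q.2.valMinAbs.natAbs < q.1.valMinAbs.natAbs
  have h6 := hle fun q => q ≠ 0
  have h7 := massOn_le_add hμ (c := fun q => InBox q ∧ q ≠ 0)
    (c₁ := fun q => InBox q ∧ q.1.valMinAbs.natAbs < q.2.valMinAbs.natAbs)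
    (c₂ := fun q => (InBox q ∧ q.2.valMinAbs.natAbs < q.1.valMinAbs.natAbs) ∨
      (InBox q ∧ q.2.valMinAbs.natAbs = q.1.valMinAbs.natAbs ∧ q ≠ 0))
    (fun q ⟨hb, hq⟩ => by
      rcases lt_trichotomy q.1.valMinAbs.natAbs q.2.valMinAbs.natAbs with h | h | h
      · exact Or.inl ⟨hb, h⟩
      · exact Or.inr (Or.inr ⟨hb, h.symm, hq⟩)
      · exact Or.inr (Or.inl ⟨hb, h⟩))
  have h8 := massOn_le_add hμ (c := fun q =>
      (InBox q ∧ q.2.valMinAbs.natAbs < q.1.valMinAbs.natAbs) ∨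
      (InBox q ∧ q.2.valMinAbs.natAbs = q.1.valMinAbs.natAbs ∧ q ≠ 0)) (fun q hq => hq)
  have h9 : ∑ q, μ q = massOn μ fun q => q ≠ 0 := by
    refine sum_congr rfl fun q _ => ?_
    by_cases hq : q = 0
    · simp [hq, h0]
    · simp [hq]
  -- With `a` and `b` the masses of the two open regions in the box, `2 * b ≤ a + D + 2 * E` and
  -- symmetrically, so `a + b ≤ 2 * D + 4 * E` and `a ≤ D + 2 * E`. The diagonals have at most `2 *
  -- (a + D) + 2 * E`, and the outside of the box at most `D`.
  linarith

/-- The sum of the squared differences along one of the maps. -/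
noncomputable def dirichlet (f : ZMod m × ZMod m → ℂ) (i : Fin 4) : ℝ :=
  ∑ p, ‖f (gridMap m i p) - f p‖ ^ 2

theorem dirichlet_fourier (f : ZMod m × ZMod m → ℂ) (i : Fin 4) :
    ∑ q, ‖gridFourier (fun p => f (gridMap m i p)) q - gridFourier f q‖ ^ 2 =
      (m : ℝ) ^ 2 * dirichlet f i := by
  rw [dirichlet, ← sum_norm_sq_gridFourier]
  simp only [gridFourier_sub]

/-- Weighted arithmetic-geometric mean inequality for the factors `‖u - v‖` and `‖u‖ + ‖v‖`. The
weights keep the coefficient of the total mass small. -/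
theorem abs_sq_sub_sq_le (u v : ℂ) :
    |‖u‖ ^ 2 - ‖v‖ ^ 2| ≤ 50 * ‖u - v‖ ^ 2 + 1 / 100 * (‖u‖ ^ 2 + ‖v‖ ^ 2) := by
  have h1 := abs_norm_sub_norm_le u v
  have h2 : |‖u‖ ^ 2 - ‖v‖ ^ 2| = |‖u‖ - ‖v‖| * (‖u‖ + ‖v‖) := by
    rw [sq_sub_sq, mul_comm, abs_mul, abs_of_nonneg (by positivity : 0 ≤ ‖u‖ + ‖v‖)]
  rw [h2]
  have h3 : |‖u‖ - ‖v‖| * (‖u‖ + ‖v‖) ≤ ‖u - v‖ * (‖u‖ + ‖v‖) := by gcongr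
  nlinarith [sq_nonneg (10 * ‖u - v‖ - 1 / 10 * (‖u‖ + ‖v‖)), sq_nonneg (‖u‖ - ‖v‖)]

theorem sum_abs_shear_le (f : ZMod m × ZMod m → ℂ) (i : Fin 4)
    (φ : ZMod m × ZMod m ≃ ZMod m × ZMod m)
    (h : ∀ q, gridFourier (fun p => f (gridMap m i p)) q = gridFourier f (φ q)) :
    ∑ q, |‖gridFourier f (φ q)‖ ^ 2 - ‖gridFourier f q‖ ^ 2| ≤
      50 * ((m : ℝ) ^ 2 * dirichlet f i) + 1 / 50 * ∑ q, ‖gridFourier f q‖ ^ 2 := by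
  refine (sum_le_sum fun q _ => abs_sq_sub_sq_le _ _).trans ?_
  rw [sum_add_distrib, ← mul_sum, ← mul_sum, sum_add_distrib,
    φ.sum_comp (fun q => ‖gridFourier f q‖ ^ 2), ← dirichlet_fourier]
  simp only [h]
  linarith

/-- The spectral gap. -/
theorem sum_norm_sq_le_dirichlet (f : ZMod m × ZMod m → ℂ) (hf : ∑ p, f p = 0) :
    ∑ p, ‖f p‖ ^ 2 ≤ 10000 * ∑ i, dirichlet f i := by
  by_contra hcon
  push Not at hcon
  have hm : (0 : ℝ) < (m : ℝ) ^ 2 := by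
    have : (0 : ℝ) < m := by exact_mod_cast Nat.pos_of_ne_zero (NeZero.ne m)
    positivity
  have hnonneg : ∀ i, 0 ≤ dirichlet f i := fun i => sum_nonneg fun p _ => by positivity
  obtain ⟨W, hW⟩ : ∃ W, W = ∑ q, ‖gridFourier f q‖ ^ 2 := ⟨_, rfl⟩
  have hWf : W = (m : ℝ) ^ 2 * ∑ p, ‖f p‖ ^ 2 := hW.trans (sum_norm_sq_gridFourier f)
  have hdir : ∀ i, (m : ℝ) ^ 2 * dirichlet f i ≤ 1 / 10000 * W := by
    intro i
    have h1 : dirichlet f i ≤ ∑ i, dirichlet f i :=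
      single_le_sum (f := fun i => dirichlet f i) (fun i _ => hnonneg i) (mem_univ i)
    have h2 : (m : ℝ) ^ 2 * dirichlet f i ≤ (m : ℝ) ^ 2 * (1 / 10000 * ∑ p, ‖f p‖ ^ 2) :=
      mul_le_mul_of_nonneg_left (by linarith) hm.le
    rw [hWf]
    linarith
  have hWpos : 0 < W := by
    rw [hWf]
    have := sum_nonneg fun i (_ : i ∈ univ) => hnonneg i
    exact mul_pos hm (lt_of_le_of_lt (by linarith) hcon)
  have h0 : ‖gridFourier f 0‖ ^ 2 = 0 := by
    have : gridFourier f 0 = ∑ p, f p := by simp [gridFourier, gridChar]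
    rw [this, hf]
    simp
  have h2 := sum_abs_shear_le f 2 (freqShear m) (gridFourier_comp_two f)
  have h3 := sum_abs_shear_le f 3
    ((Equiv.prodComm _ _).trans ((freqShear m).trans (Equiv.prodComm _ _)))
    (gridFourier_comp_three f)
  rw [← hW] at h2 h3
  have houter : ∀ (i : Fin 4) (x : ZMod m × ZMod m → ZMod m),
      (∀ q, gridFourier (fun p => f (gridMap m i p)) q =
        ZMod.stdAddChar (-x q) * gridFourier f q) →
      massOn (fun q => ‖gridFourier f q‖ ^ 2) (fun q => m < 8 * (x q).valMinAbs.natAbs) ≤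
        4 / 10000 * W := by
    intro i x h
    have h1 := (dirichlet_fourier f i).le.trans (hdir i)
    have h4 : 1 / 4 * massOn (fun q => ‖gridFourier f q‖ ^ 2)
          (fun q => m < 8 * (x q).valMinAbs.natAbs) ≤
        ∑ q, ‖gridFourier (fun p => f (gridMap m i p)) q - gridFourier f q‖ ^ 2 := by
      rw [massOn, mul_sum]
      refine sum_le_sum fun q _ => ?_
      split_ifs with hq
      · rw [h q, ← sub_one_mul, norm_mul, mul_pow]
        gcongr
        exact norm_stdAddChar_sub_one _ hq
      · rw [mul_zero]
        positivity
    linarith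
  have hD : massOn (fun q => ‖gridFourier f q‖ ^ 2) (fun q => ¬ InBox q) ≤ 8 / 10000 * W := by
    have e0 := houter 0 Prod.fst (gridFourier_comp_zero f)
    have e1 := houter 1 Prod.snd (gridFourier_comp_one f)
    have e2 := massOn_le_add (μ := fun q => ‖gridFourier f q‖ ^ 2) (fun q => by positivity)
      (c := fun q => ¬ InBox q) (c₁ := fun q => m < 8 * q.1.valMinAbs.natAbs)
      (c₂ := fun q => m < 8 * q.2.valMinAbs.natAbs)
      (fun q hq => by unfold InBox at hq; omega)
    linarith
  -- Here `D` is `8 / 10000 * W` and `E` is `(50 / 10000 + 1 / 50) * W`, so the total is less than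
  -- `W`, a contradiction.
  have key : W ≤ 7 * (8 / 10000 * W) + 10 * (25 / 1000 * W) := by
    refine hW.le.trans (mass_le (fun q => ‖gridFourier f q‖ ^ 2) (fun q => by positivity) h0
      (h2.trans ?_) (h3.trans ?_) hD)
    · linarith [hdir 2]
    · linarith [hdir 3]
  linarith

end Margulis

/-! ### Cubic expanders -/

section Expander

open Finset
open scoped Classical

theorem le_edgeExpansion_comap {V W : Type*} [Fintype V] [Fintype W] {G : SimpleGraph V}
    (e : W ≃ V) (β : ℝ≥0) (h : (β : ℝ≥0∞) ≤ edgeExpansion G) :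
    (β : ℝ≥0∞) ≤ edgeExpansion (G.comap e) := by
  rw [le_edgeExpansion_iff] at h ⊢
  intro S hS
  have h1 := h (S.map e.toEmbedding) (by rw [card_map, ← Fintype.card_congr e]; exact hS)
  rw [card_map] at h1
  refine h1.trans (Nat.cast_le.2 ?_)
  refine Set.ncard_le_ncard_of_injOn (Sym2.map e.symm) ?_
    (Sym2.map.injective e.symm.injective).injOn (Set.toFinite _)
  rintro _ ⟨he, u, hu, v, hv, rfl⟩
  refine ⟨?_, e.symm u, ?_, e.symm v, ?_, rfl⟩
  · rw [Sym2.map_mk, SimpleGraph.mem_edgeSet, SimpleGraph.comap_adj, e.apply_symm_apply,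
      e.apply_symm_apply]
    exact he
  · obtain ⟨w, hw, rfl⟩ := mem_map.1 hu
    simpa using hw
  · intro hcon
    exact hv (mem_map.2 ⟨_, hcon, by simp⟩)

theorem ncard_neighborSet_comap_le {V W : Type*} [Finite V] {G : SimpleGraph V} (e : W ≃ V)
    (w : W) : ((G.comap e).neighborSet w).ncard ≤ (G.neighborSet (e w)).ncard :=
  Set.ncard_le_ncard_of_injOn e (fun _ h => h) e.injective.injOn (Set.toFinite _)

/-- The spectral gap is applied to the indicator of `Y` minus its mean. The squared norm is `#Y * (n
- #Y) / n`, at least half the smaller of `#Y` and `#Yᶜ`, and the Dirichlet sum counts separated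
pairs; this turns `10000` into `20000`. -/
theorem grid_isoperimetry {m : ℕ} [NeZero m] (Y : Finset (ZMod m × ZMod m)) :
    (1 / 20000 : ℝ≥0) * (#Y : ℝ) ≤ ((∑ i, ∑ p, sep Y (gridMap m i p) p : ℕ) : ℝ) ∨
      (1 / 20000 : ℝ≥0) * (#Yᶜ : ℝ) ≤ ((∑ i, ∑ p, sep Y (gridMap m i p) p : ℕ) : ℝ) := by
  set n : ℝ := ((Fintype.card (ZMod m × ZMod m) : ℕ) : ℝ) with hn
  have hn0 : 0 < n := by
    rw [hn]
    exact_mod_cast Fintype.card_pos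
  set b : ℝ := ((∑ i, ∑ p, sep Y (gridMap m i p) p : ℕ) : ℝ) with hb
  let r : ZMod m × ZMod m → ℝ := fun p => ind Y p - #Y / n
  have hind : ∑ p, (ind Y p : ℝ) = #Y := by rw [← Nat.cast_sum, sum_ind]
  have hr0 : ∑ p, r p = 0 := by
    simp only [r]
    rw [sum_sub_distrib, hind, sum_const, card_univ, nsmul_eq_mul, ← hn]
    field_simp
    ring
  have hr2 : ∑ p, r p ^ 2 = #Y - #Y ^ 2 / n := by
    have h1 : ∀ p, r p ^ 2 = ind Y p * (1 - 2 * (#Y / n)) + (#Y / n) ^ 2 := by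
      intro p
      have : (ind Y p : ℝ) ^ 2 = ind Y p := by unfold ind; split_ifs <;> simp
      simp only [r]
      linear_combination this
    simp only [h1]
    rw [sum_add_distrib, ← sum_mul, hind, sum_const, card_univ, nsmul_eq_mul, ← hn]
    field_simp
    ring
  have hgap := sum_norm_sq_le_dirichlet (fun p => (r p : ℂ)) (by exact_mod_cast hr0)
  have hdir : ∑ i, dirichlet (fun p => (r p : ℂ)) i = b := by
    rw [hb]
    push_cast
    refine sum_congr rfl fun i _ => sum_congr rfl fun p _ => ?_
    rw [← Complex.ofReal_sub, Complex.norm_real, Real.norm_eq_abs, sq_abs]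
    rw [show r (gridMap m i p) - r p = (ind Y (gridMap m i p) : ℝ) - ind Y p by
      simp only [r]; ring]
    simp only [ind, sep]
    by_cases h1 : gridMap m i p ∈ Y <;> by_cases h2 : p ∈ Y <;> simp [h1, h2]
  simp only [Complex.norm_real, Real.norm_eq_abs, sq_abs] at hgap
  rw [hr2, hdir] at hgap
  have hcompl : (#Yᶜ : ℝ) = n - #Y := by
    rw [card_compl, Nat.cast_sub (card_le_univ _)]
  have hY : (#Y : ℝ) - #Y ^ 2 / n = #Y * (n - #Y) / n := by field_simp
  rw [hY, div_le_iff₀ hn0] at hgap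
  push_cast
  rw [hcompl]
  have hY0 : (0 : ℝ) ≤ #Y := Nat.cast_nonneg _
  have hb0 : 0 ≤ b := Nat.cast_nonneg _
  rcases le_total (2 * (#Y : ℝ)) n with h | h
  · left
    by_contra hcon
    push Not at hcon
    nlinarith
  · right
    by_contra hcon
    push Not at hcon
    have : (0 : ℝ) ≤ #Yᶜ := Nat.cast_nonneg _
    nlinarith

/-- The edges of the cubic graph: every point of the grid is replaced by a path on `12` vertices,
and the `i`-th map is realized by edges from the vertices `2 * i` to the vertices `2 * i + 1`. -/
inductive CubicRel (m : ℕ) :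
    (ZMod m × ZMod m) × Fin 12 → (ZMod m × ZMod m) × Fin 12 → Prop
  | path (v : ZMod m × ZMod m) (t t' : Fin 12) (h : (t' : ℕ) = t + 1) : CubicRel m (v, t) (v, t')
  | port (v : ZMod m × ZMod m) (i : Fin 4) (t t' : Fin 12) (h : (t : ℕ) = 2 * i)
      (h' : (t' : ℕ) = 2 * i + 1) : CubicRel m (v, t) (gridMap m i v, t')

/-- The cubic graph over the grid. -/
def cubicGraph (m : ℕ) : SimpleGraph ((ZMod m × ZMod m) × Fin 12) :=
  SimpleGraph.fromRel (CubicRel m)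

theorem cubicGraph_adj_of_rel {m : ℕ} {x y : (ZMod m × ZMod m) × Fin 12} (h : CubicRel m x y) :
    (cubicGraph m).Adj x y := by
  refine (SimpleGraph.fromRel_adj _ _ _).2 ⟨?_, Or.inl h⟩
  cases h with
  | path v t t' h =>
    intro h'
    have := congrArg (fun x : (ZMod m × ZMod m) × Fin 12 => (x.2 : ℕ)) h'
    simp only at this
    omega
  | port v i t t' h h' =>
    intro h''
    have := congrArg (fun x : (ZMod m × ZMod m) × Fin 12 => (x.2 : ℕ)) h''
    simp only at this
    omega

theorem cubicGraph_degree_le {m : ℕ} (x : (ZMod m × ZMod m) × Fin 12) :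
    ((cubicGraph m).neighborSet x).ncard ≤ 3 := by
  obtain ⟨v, t⟩ := x
  let f : Fin 3 → (ZMod m × ZMod m) × Fin 12 :=
    ![(v, ⟨t - 1, by omega⟩), (v, t + 1),
      if h : (t : ℕ) < 8 then
        if (t : ℕ) % 2 = 0 then (gridMap m ⟨t / 2, by omega⟩ v, t + 1)
        else ((gridMap m ⟨t / 2, by omega⟩).symm v, ⟨t - 1, by omega⟩)
      else (v, t)]
  refine ncard_le_of_subset_range f ?_
  have hsucc : ∀ s : Fin 12, (s : ℕ) = t + 1 → s = t + 1 := by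
    intro s hs
    refine Fin.ext ?_
    have h1 := s.2
    rw [Fin.val_add, hs, show ((1 : Fin 12) : ℕ) = 1 from rfl]
    omega
  intro y hy
  rw [SimpleGraph.mem_neighborSet, cubicGraph, SimpleGraph.fromRel_adj] at hy
  obtain ⟨-, hy | hy⟩ := hy
  · cases hy with
    | path _ _ t' h => exact ⟨1, by rw [hsucc t' h]; rfl⟩
    | port _ i _ t' h h' =>
      refine ⟨2, ?_⟩
      have hi := i.2
      have h8 : (t : ℕ) < 8 := by omega
      have h2 : (t : ℕ) % 2 = 0 := by omega
      have hi' : (⟨(t : ℕ) / 2, by omega⟩ : Fin 4) = i := Fin.ext (by simp only; omega)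
      change dite _ _ _ = _
      rw [dif_pos h8, if_pos h2, hi', hsucc t' (by omega)]
  · generalize hx : (v, t) = x at hy
    cases hy with
    | path u s s' h =>
      obtain ⟨rfl, rfl⟩ := Prod.mk.inj hx
      exact ⟨0, Prod.ext rfl (Fin.ext (by change (t : ℕ) - 1 = s; omega))⟩
    | port u i s s' h h' =>
      obtain ⟨hv, rfl⟩ := Prod.mk.inj hx
      refine ⟨2, ?_⟩
      have hi := i.2
      have h8 : (t : ℕ) < 8 := by omega
      have h2 : ¬ (t : ℕ) % 2 = 0 := by omega
      have hi' : (⟨(t : ℕ) / 2, by omega⟩ : Fin 4) = i := Fin.ext (by simp only; omega)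
      change dite _ _ _ = _
      rw [dif_pos h8, if_neg h2, hi', hv, Equiv.symm_apply_apply]
      exact Prod.ext rfl (Fin.ext (by change (t : ℕ) - 1 = s; omega))

section

variable {m : ℕ} [NeZero m] (S : Finset ((ZMod m × ZMod m) × Fin 12))

theorem sum_ind_cubic_le (t : ℕ) (ht : t < 12) :
    ∑ v, ind S (v, ⟨t, ht⟩) ≤
      ∑ v, ind S (v, 0) + t * (edgeBoundary (cubicGraph m) S).ncard := by
  induction t with
  | zero => exact (Nat.add_zero _).symm.le.trans (by simp)
  | succ t ih =>
    have h := sum_ind_le S (fun v : ZMod m × ZMod m => (v, (⟨t + 1, ht⟩ : Fin 12)))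
      (fun v => (v, ⟨t, by omega⟩))
      (fun v => (cubicGraph_adj_of_rel (CubicRel.path v ⟨t, by omega⟩ ⟨t + 1, ht⟩ rfl)).symm)
      (fun u v h => (Prod.mk.inj (Prod.mk.inj h).1).1)
    have := ih (by omega)
    rw [add_mul]
    omega

theorem sum_sep_cubic_le (t : ℕ) (ht : t < 12) :
    ∑ v, sep S (v, ⟨t, ht⟩) (v, 0) ≤ t * (2 * (edgeBoundary (cubicGraph m) S).ncard) := by
  induction t with
  | zero =>
    refine (sum_eq_zero fun v _ => ?_).le.trans (Nat.zero_le _)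
    exact sep_self S (v, 0)
  | succ t ih =>
    have h := sum_sep_le S (fun v : ZMod m × ZMod m => (v, (⟨t + 1, ht⟩ : Fin 12)))
      (fun v => (v, ⟨t, by omega⟩))
      (fun v => (cubicGraph_adj_of_rel (CubicRel.path v ⟨t, by omega⟩ ⟨t + 1, ht⟩ rfl)).symm)
      (fun u v h => (Prod.mk.inj (Prod.mk.inj h).1).1)
    have h1 := ih (by omega)
    have h2 : ∑ v : ZMod m × ZMod m, sep S (v, ⟨t + 1, ht⟩) (v, 0) ≤
        ∑ v : ZMod m × ZMod m, (sep S (v, ⟨t + 1, ht⟩) (v, ⟨t, by omega⟩) +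
          sep S (v, ⟨t, by omega⟩) (v, 0)) :=
      sum_le_sum fun v _ => sep_triangle S _ _ _
    rw [sum_add_distrib] at h2
    rw [add_mul]
    omega

/-- Go from `(v, 0)` along its path to port `2 * i`, across the edge, and back along the other path
from port `2 * i + 1`. Since `i ≤ 3`, at most 14 edges are used, each counted twice; 40 is a
generous bound. -/
theorem sum_sep_gridMap_le (i : Fin 4) :
    ∑ v, sep (preim (fun v => (v, (0 : Fin 12))) S) (gridMap m i v) v ≤
      40 * (edgeBoundary (cubicGraph m) S).ncard := by
  have hi := i.2
  have h1 := sum_sep_cubic_le S (2 * i) (by omega)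
  have h2 := sum_sep_cubic_le S (2 * i + 1) (by omega)
  rw [← (gridMap m i).sum_comp] at h2
  have h3 := sum_sep_le S (fun v : ZMod m × ZMod m => (v, (⟨2 * i, by omega⟩ : Fin 12)))
    (fun v => (gridMap m i v, ⟨2 * i + 1, by omega⟩))
    (fun v => cubicGraph_adj_of_rel (CubicRel.port v i _ _ rfl rfl))
    (fun u v h => (Prod.mk.inj (Prod.mk.inj h).1).1)
  have h4 : ∑ v, sep (preim (fun v => (v, (0 : Fin 12))) S) (gridMap m i v) v ≤
      ∑ v, (sep S (gridMap m i v, ⟨2 * i + 1, by omega⟩) (gridMap m i v, 0) +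
        sep S (v, ⟨2 * i, by omega⟩) (gridMap m i v, ⟨2 * i + 1, by omega⟩) +
        sep S (v, ⟨2 * i, by omega⟩) (v, 0)) := by
    refine sum_le_sum fun v _ => ?_
    rw [sep_preim]
    refine (sep_triangle S _ (v, ⟨2 * i, by omega⟩) _).trans (Nat.add_le_add_right ?_ _)
    refine (sep_triangle S _ (gridMap m i v, ⟨2 * i + 1, by omega⟩) _).trans (le_of_eq ?_)
    rw [sep_comm S (gridMap m i v, 0), sep_comm S (v, _)]
  rw [sum_add_distrib, sum_add_distrib] at h4
  have h5 : (2 * (i : ℕ)) * (2 * (edgeBoundary (cubicGraph m) S).ncard) ≤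
    6 * (2 * (edgeBoundary (cubicGraph m) S).ncard) := Nat.mul_le_mul_right _ (by omega)
  rw [add_mul] at h2
  omega

theorem cubicGraph_card_le :
    #S ≤ 12 * #(preim (fun v => (v, (0 : Fin 12))) S) +
      160 * (edgeBoundary (cubicGraph m) S).ncard := by
  rw [← sum_ind S, Fintype.sum_prod_type_right, ← sum_ind_comp]
  have h : ∀ t : Fin 12, ∑ v, ind S (v, t) ≤
      ∑ v, ind S (v, 0) + 11 * (edgeBoundary (cubicGraph m) S).ncard := fun t =>
    (sum_ind_cubic_le S t t.2).trans
      (Nat.add_le_add_left (Nat.mul_le_mul_right _ (by omega)) _)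
  refine (sum_le_sum fun t _ => h t).trans ?_
  rw [sum_const, card_univ, Fintype.card_fin, smul_eq_mul]
  omega

end

theorem exists_cubic_expanders : ∃ α : ℝ≥0, 0 < α ∧ ∀ j : ℕ,
    ∃ A : SimpleGraph (Fin (2 * 6 ^ (2 * j + 1))),
      (∀ a, (A.neighborSet a).ncard ≤ 3) ∧ (α : ℝ≥0∞) ≤ edgeExpansion A := by
  refine ⟨(1 / 20000) / ((160 : ℕ) * ((12 : ℕ) + 1 / 20000)), by positivity, fun j => ?_⟩
  -- The grid has side `6 ^ j`. Only 8 of the 12 path vertices carry ports; the length 12 makes the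
  -- order `12 * 36 ^ j = 2 * 6 ^ (2 * j + 1)`, as the construction requires.
  have : NeZero (6 ^ j) := ⟨by positivity⟩
  have hcard : Fintype.card (Fin (2 * 6 ^ (2 * j + 1))) =
      Fintype.card ((ZMod (6 ^ j) × ZMod (6 ^ j)) × Fin 12) := by
    simp only [Fintype.card_fin, Fintype.card_prod, ZMod.card]
    rw [pow_succ, two_mul j, pow_add]
    ring
  let e := Fintype.equivOfCardEq hcard
  refine ⟨(cubicGraph (6 ^ j)).comap e,
    fun a => (ncard_neighborSet_comap_le e a).trans (cubicGraph_degree_le _),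
    le_edgeExpansion_comap e _ ?_⟩
  refine le_edgeExpansion_of_transfer (fun v => (v, (0 : Fin 12)))
    (fun Y => ((∑ i, ∑ p, sep Y (gridMap (6 ^ j) i p) p : ℕ) : ℝ)) (1 / 20000) (by positivity)
    12 160 (by norm_num) (fun Y => by convert grid_isoperimetry Y) cubicGraph_card_le (fun S => ?_)
  have h := sum_le_sum fun i (_ : i ∈ univ) => sum_sep_gridMap_le (m := 6 ^ j) S i
  rw [sum_const, card_univ, Fintype.card_fin, smul_eq_mul, ← mul_assoc] at h
  exact_mod_cast h

end Expander

/-! ### Pendant paths -/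

section Pendant

open Finset
open scoped Classical

variable {V : Type*} {M r : ℕ}

/-- The predecessor of the `i`-th new vertex: the vertex `L i` if `i < M`, and otherwise the new
vertex `i - M`. -/
def pendantParent (L : Fin M → V) (i : Fin r) : V ⊕ Fin r :=
  if h : (i : ℕ) < M then Sum.inl (L ⟨i, h⟩) else Sum.inr ⟨i - M, by omega⟩

/-- The edges of `G` and those between the new vertices and their predecessors. -/
inductive PendantRel (G : SimpleGraph V) (L : Fin M → V) (r : ℕ) : V ⊕ Fin r → V ⊕ Fin r → Prop
  | keep (u v : V) (h : G.Adj u v) : PendantRel G L r (Sum.inl u) (Sum.inl v)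
  | attach (i : Fin r) : PendantRel G L r (pendantParent L i) (Sum.inr i)

/-- The graph `G` with paths attached to the vertices `L i`, with `r` new vertices that are
distributed evenly. -/
def pendantGraph (G : SimpleGraph V) (L : Fin M → V) (r : ℕ) : SimpleGraph (V ⊕ Fin r) :=
  SimpleGraph.fromRel (PendantRel G L r)

variable {G : SimpleGraph V} {L : Fin M → V}

theorem pendantGraph_adj_inl {u v : V} (h : G.Adj u v) :
    (pendantGraph G L r).Adj (Sum.inl u) (Sum.inl v) :=
  (SimpleGraph.fromRel_adj _ _ _).2 ⟨by simpa using h.ne, Or.inl (PendantRel.keep u v h)⟩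

theorem pendantGraph_adj_parent (hM : 0 < M) (i : Fin r) :
    (pendantGraph G L r).Adj (Sum.inr i) (pendantParent L i) := by
  refine (SimpleGraph.fromRel_adj _ _ _).2 ⟨?_, Or.inr (PendantRel.attach i)⟩
  unfold pendantParent
  split_ifs with h
  · simp
  · intro h'
    have := congrArg Fin.val (Sum.inr_injective h')
    simp only at this
    omega

theorem pendantParent_injective (hL : Function.Injective L) :
    Function.Injective (pendantParent L (r := r)) := by
  intro i j h
  unfold pendantParent at h
  split_ifs at h with hi hj hj
  · have := congrArg Fin.val (hL (Sum.inl_injective h))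
    exact Fin.ext this
  · have := congrArg Fin.val (Sum.inr_injective h)
    simp only at this
    exact Fin.ext (by omega)

theorem pendantGraph_degree_inl [Finite V] (hL : Function.Injective L) (v : V) :
    ((pendantGraph G L r).neighborSet (Sum.inl v)).ncard ≤
      (G.neighborSet v).ncard + if v ∈ Set.range L then 1 else 0 := by
  have hD : (Sum.inr '' {i : Fin r | pendantParent L i = Sum.inl v} : Set (V ⊕ Fin r)).ncard ≤
      if v ∈ Set.range L then 1 else 0 := by
    rw [Set.ncard_image_of_injective _ Sum.inr_injective]
    split_ifs with hv
    · rw [Set.ncard_le_one_iff_subsingleton]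
      intro i hi j hj
      exact pendantParent_injective hL (hi.trans hj.symm)
    · have h0 : {i : Fin r | pendantParent L i = Sum.inl v} = ∅ := by
        refine Set.eq_empty_of_forall_notMem fun i hi => hv ?_
        change pendantParent L i = Sum.inl v at hi
        unfold pendantParent at hi
        split_ifs at hi with h
        exact ⟨_, Sum.inl_injective hi⟩
      rw [h0, Set.ncard_empty]
  refine (Set.ncard_le_ncard (t := Sum.inl '' G.neighborSet v ∪
      Sum.inr '' {i : Fin r | pendantParent L i = Sum.inl v}) ?_ (Set.toFinite _)).trans
    ((Set.ncard_union_le _ _).trans (Nat.add_le_add (Set.ncard_image_le (Set.toFinite _)) hD))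
  intro y hy
  rw [SimpleGraph.mem_neighborSet, pendantGraph, SimpleGraph.fromRel_adj] at hy
  obtain ⟨-, hy | hy⟩ := hy
  · generalize hx : (Sum.inl v : V ⊕ Fin r) = x at hy
    cases hy with
    | keep u w h =>
      obtain rfl := Sum.inl_injective hx
      exact Or.inl ⟨w, h, rfl⟩
    | attach i => exact Or.inr ⟨i, rfl, rfl⟩
  · generalize hx : (Sum.inl v : V ⊕ Fin r) = x at hy
    cases hy with
    | keep u w h =>
      obtain rfl := Sum.inl_injective hx
      exact Or.inl ⟨u, h.symm, rfl⟩
    | attach i => cases hx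

theorem pendantGraph_degree_inr (i : Fin r) :
    ((pendantGraph G L r).neighborSet (Sum.inr i)).ncard ≤ 2 := by
  refine ncard_le_of_subset_range ![pendantParent L i,
    if h : (i : ℕ) + M < r then Sum.inr ⟨i + M, h⟩ else pendantParent L i] ?_
  intro y hy
  rw [SimpleGraph.mem_neighborSet, pendantGraph, SimpleGraph.fromRel_adj] at hy
  obtain ⟨-, hy | hy⟩ := hy
  · generalize hx : (Sum.inr i : V ⊕ Fin r) = x at hy
    cases hy with
    | keep => cases hx
    | attach j =>
      unfold pendantParent at hx
      split_ifs at hx with h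
      have h1 := congrArg Fin.val (Sum.inr_injective hx)
      simp only at h1
      have h2 : (i : ℕ) + M < r := by omega
      refine ⟨1, ?_⟩
      change dite _ _ _ = _
      rw [dif_pos h2]
      exact congrArg Sum.inr (Fin.ext (by simp only; omega))
  · generalize hx : (Sum.inr i : V ⊕ Fin r) = x at hy
    cases hy with
    | keep => cases hx
    | attach j =>
      obtain rfl := Sum.inr_injective hx
      exact ⟨0, rfl⟩

section

variable [Fintype V] (S : Finset (V ⊕ Fin r))

/-- Passing to predecessors maps the first `(q + 1) * M` new vertices injectively to the old
vertices and the first `q * M` new ones, so each further layer adds at most one trace and one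
boundary. -/
theorem sum_ind_inr_le (hM : 0 < M) (hL : Function.Injective L) (q : ℕ) :
    ∑ i : {i : Fin r // (i : ℕ) < q * M}, ind S (Sum.inr i.1) ≤
      q * (#(preim Sum.inl S) + (edgeBoundary (pendantGraph G L r) S).ncard) := by
  induction q with
  | zero =>
    exact (sum_eq_zero fun i _ => absurd i.2 (by simp)).le.trans (Nat.zero_le _)
  | succ q ih =>
    have h1 := sum_ind_le S (fun i : {i : Fin r // (i : ℕ) < (q + 1) * M} => Sum.inr i.1)
      (fun i => pendantParent L i.1) (fun i => pendantGraph_adj_parent (G := G) hM i.1)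
      (fun i j h => Subtype.ext (Sum.inr_injective (Prod.mk.inj h).1))
    let π : {i : Fin r // (i : ℕ) < (q + 1) * M} → V ⊕ {i : Fin r // (i : ℕ) < q * M} := fun i =>
      if h : (i.1 : ℕ) < M then Sum.inl (L ⟨i.1, h⟩)
      else Sum.inr ⟨⟨i.1 - M, by omega⟩, by
        have := lt_of_lt_of_eq i.2 (show (q + 1) * M = q * M + M by ring)
        simp only
        omega⟩
    have hπ : ∀ i, Sum.map id Subtype.val (π i) = pendantParent L i.1 := by
      intro i
      simp only [π, pendantParent]
      split_ifs <;> rfl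
    have h2 := sum_comp_le_of_injective (fun x => ind S (Sum.map id Subtype.val x)) π
      (fun i j h => Subtype.ext (pendantParent_injective (r := r) hL (by rw [← hπ, ← hπ, h])))
    simp only [hπ] at h2
    rw [Fintype.sum_sum_type] at h2
    have h3 : ∑ v : V, ind S (Sum.map id (Subtype.val : {i : Fin r // (i : ℕ) < q * M} → Fin r)
        (Sum.inl v)) = #(preim Sum.inl S) := sum_ind_comp S Sum.inl
    rw [h3] at h2
    have h4 : ∑ i : {i : Fin r // (i : ℕ) < q * M}, ind S (Sum.map id Subtype.val
        (Sum.inr i : V ⊕ {i : Fin r // (i : ℕ) < q * M})) ≤ _ := ih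
    have h5 : (q + 1) * (#(preim Sum.inl S) + (edgeBoundary (pendantGraph G L r) S).ncard) =
      q * (#(preim Sum.inl S) + (edgeBoundary (pendantGraph G L r) S).ncard) +
        (#(preim Sum.inl S) + (edgeBoundary (pendantGraph G L r) S).ncard) := by ring
    omega

theorem pendantGraph_card_le (hM : 0 < M) (hL : Function.Injective L) (q : ℕ) (hr : r ≤ q * M) :
    #S ≤ (1 + q) * #(preim Sum.inl S) +
      (1 + q) * (edgeBoundary (pendantGraph G L r) S).ncard := by
  have h1 := sum_ind_inr_le (G := G) S hM hL q
  have h2 := sum_comp_le_of_injective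
    (fun i : {i : Fin r // (i : ℕ) < q * M} => ind S (Sum.inr i.1))
    (fun i : Fin r => ⟨i, i.2.trans_le hr⟩) (fun i j h => congrArg Subtype.val h)
  simp only at h2
  rw [← sum_ind S, Fintype.sum_sum_type, sum_ind_comp S Sum.inl]
  rw [mul_add] at h1
  rw [add_mul, add_mul]
  omega

theorem edgeBoundary_preim_inl_le :
    (edgeBoundary G (preim Sum.inl S)).ncard ≤ (edgeBoundary (pendantGraph G L r) S).ncard := by
  refine Set.ncard_le_ncard_of_injOn (Sym2.map Sum.inl) ?_
    (Sym2.map.injective Sum.inl_injective).injOn (Set.toFinite _)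
  rintro _ ⟨he, u, hu, v, hv, rfl⟩
  exact ⟨pendantGraph_adj_inl he, _, mem_preim.1 hu, _, fun h => hv (mem_preim.2 h), rfl⟩

theorem le_edgeExpansion_pendantGraph (hM : 0 < M) (hL : Function.Injective L) (q : ℕ)
    (hr : r ≤ q * M) (α : ℝ≥0) (hα : 0 < α) (h : (α : ℝ≥0∞) ≤ edgeExpansion G) :
    ((α / (((1 + q : ℕ) : ℝ≥0) * (((1 + q : ℕ) : ℝ≥0) + α)) : ℝ≥0) : ℝ≥0∞) ≤
      edgeExpansion (pendantGraph G L r) := by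
  refine le_edgeExpansion_of_transfer Sum.inl (fun Y => ((edgeBoundary G Y).ncard : ℝ)) α hα _ _
    (by omega) (isoperimetry_of_le_edgeExpansion α h)
    (fun S => pendantGraph_card_le S hM hL q hr) (fun S => ?_)
  have h2 : (edgeBoundary G (preim Sum.inl S)).ncard ≤
      (1 + q) * (edgeBoundary (pendantGraph G L r) S).ncard :=
    (edgeBoundary_preim_inl_le S).trans (Nat.le_mul_of_pos_left _ (by omega))
  exact_mod_cast h2

end

/-- The retraction that maps a new vertex to the vertex to which its path is attached. -/
def pendantRetract (hM : 0 < M) (L : Fin M → V) : V ⊕ Fin r → V :=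
  Sum.elim id fun i => L ⟨i % M, Nat.mod_lt _ hM⟩

theorem pendantRetract_adj (hM : 0 < M) {x y : V ⊕ Fin r} (h : (pendantGraph G L r).Adj x y) :
    pendantRetract hM L x = pendantRetract hM L y ∨
      G.Adj (pendantRetract hM L x) (pendantRetract hM L y) := by
  have key : ∀ x y : V ⊕ Fin r, PendantRel G L r x y →
      pendantRetract hM L x = pendantRetract hM L y ∨
      G.Adj (pendantRetract hM L x) (pendantRetract hM L y) := by
    intro x y h
    cases h with
    | keep u v h => exact Or.inr h
    | attach i =>
      left
      unfold pendantParent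
      split_ifs with h
      · simp only [pendantRetract, Sum.elim_inl, Sum.elim_inr, id]
        congr 2
        exact (Nat.mod_eq_of_lt h).symm
      · simp only [pendantRetract, Sum.elim_inr]
        congr 2
        exact (Nat.mod_eq_sub_mod (by omega)).symm
  rw [pendantGraph, SimpleGraph.fromRel_adj] at h
  obtain ⟨-, h | h⟩ := h
  · exact key x y h
  · exact (key y x h).imp Eq.symm fun h => h.symm

end Pendant

/-! ### Geodesics and retractions -/

section Retract

variable {V W : Type*} {G : SimpleGraph V} {G' : SimpleGraph W} {ρ : W → V}

theorem exists_walk_of_retract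
    (hρ : ∀ x y, G'.Adj x y → ρ x = ρ y ∨ G.Adj (ρ x) (ρ y)) {x y : W} (w : G'.Walk x y) :
    ∃ w' : G.Walk (ρ x) (ρ y), w'.length ≤ w.length ∧
      ∀ z ∈ w'.support, ∃ z' ∈ w.support, ρ z' = z := by
  induction w with
  | nil => exact ⟨SimpleGraph.Walk.nil, le_rfl, fun z hz => by simp_all⟩
  | @cons u v z h p ih =>
    obtain ⟨w', h1, h2⟩ := ih
    rcases hρ _ _ h with h3 | h3
    · refine ⟨w'.copy h3.symm rfl, ?_, fun z hz => ?_⟩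
      · rw [SimpleGraph.Walk.length_copy, SimpleGraph.Walk.length_cons]
        omega
      · rw [SimpleGraph.Walk.support_copy] at hz
        obtain ⟨z', hz', rfl⟩ := h2 z hz
        exact ⟨z', List.mem_cons_of_mem _ hz', rfl⟩
    · refine ⟨SimpleGraph.Walk.cons h3 w', by simpa using h1, fun z hz => ?_⟩
      rw [SimpleGraph.Walk.support_cons, List.mem_cons] at hz
      rcases hz with rfl | hz
      · exact ⟨u, by simp, rfl⟩
      · obtain ⟨z', hz', rfl⟩ := h2 z hz
        exact ⟨z', List.mem_cons_of_mem _ hz', rfl⟩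

/-- If a graph is a weak retract of another one, and only one vertex is mapped to `o`, then
geodesics through `o` stay geodesics through `o`. -/
theorem geodesics_through_of_retract (hG : G.Connected)
    (hρ : ∀ x y, G'.Adj x y → ρ x = ρ y ∨ G.Adj (ρ x) (ρ y)) (i : G →g G') (hi : ∀ v, ρ (i v) = v)
    (o : V) (ho : ∀ z, ρ z = o → z = i o) (x y : V) (h : ∀ w ∈ geodesics G x y, o ∈ w.support) :
    ∀ w ∈ geodesics G' (i x) (i y), i o ∈ w.support := by
  intro w hw
  obtain ⟨w', h1, h2⟩ := exists_walk_of_retract hρ w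
  obtain ⟨w₀, hw₀⟩ := hG.exists_walk_length_eq_dist x y
  have h3 : G'.dist (i x) (i y) ≤ G.dist x y := by
    rw [← hw₀, ← SimpleGraph.Walk.length_map i]
    exact SimpleGraph.dist_le _
  -- The projected walk is no longer than `w`, and `w` is no longer than the distance in `G`; so it
  -- is a geodesic there and passes through `o`.
  have h4 : w'.copy (hi x) (hi y) ∈ geodesics G x y := by
    refine le_antisymm ?_ (SimpleGraph.dist_le _)
    rw [SimpleGraph.Walk.length_copy]
    exact h1.trans ((show w.length = _ from hw).le.trans h3)
  have h5 := h _ h4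
  rw [SimpleGraph.Walk.support_copy] at h5
  obtain ⟨z', hz', hz⟩ := h2 o h5
  rwa [← ho z' hz]

end Retract

/-! ### A graph of every size -/

section AllSizes

open Finset
open scoped Classical

/-- The leaf that is matched with a vertex of the expander. -/
def matchedLeaf {k : ℕ} (A : SimpleGraph (Fin (2 * 6 ^ k)))
    (m : Bool × TreeLeaf k ≃ Fin (2 * 6 ^ k)) (a : Fin (2 * 6 ^ k)) : JoinVertex A m 12 :=
  joinLeaf A m 12 (m.symm a).1 (m.symm a).2

theorem matchedLeaf_injective {k : ℕ} (A : SimpleGraph (Fin (2 * 6 ^ k)))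
    (m : Bool × TreeLeaf k ≃ Fin (2 * 6 ^ k)) : Function.Injective (matchedLeaf A m) := by
  intro a b h
  obtain ⟨h1, h2⟩ := baseTree_inj.1 (Sum.inl_injective h)
  exact m.symm.injective (Prod.ext h1 (leaf_node_injective h2))

theorem joinApex_ne_matchedLeaf {k : ℕ} (A : SimpleGraph (Fin (2 * 6 ^ k)))
    (m : Bool × TreeLeaf k ≃ Fin (2 * 6 ^ k)) (a : Fin (2 * 6 ^ k)) :
    matchedLeaf A m a ≠ joinApex A m 12 :=
  fun h => baseApex_ne_baseTree _ _ (Sum.inl_injective h).symm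

/-- Take the largest odd `k` for which the join graph is sure to fit into `n` vertices, and spend
the remaining vertices on paths attached to the leaves. -/
theorem exists_large_graph : ∃ β : ℝ≥0, 0 < β ∧ ∀ n : ℕ, 2700 ≤ n → ∃ G : SimpleGraph (Fin n),
    (∀ v, (G.neighborSet v).ncard ≤ 4) ∧ (β : ℝ≥0∞) ≤ edgeExpansion G ∧
    1 / (4 * 16200 ^ 2) * (n : ℝ) ^ 2 ≤ maxCongestion G := by
  obtain ⟨α, hα, hexp⟩ := exists_cubic_expanders
  obtain ⟨β, hβ, hjoin⟩ := exists_le_edgeExpansion_joinGraph α hα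
  refine ⟨β / (((1 + 8100 : ℕ) : ℝ≥0) * (((1 + 8100 : ℕ) : ℝ≥0) + β)), by positivity,
    fun n hn => ?_⟩
  -- Expanders are available for odd exponents only, so consecutive sizes differ by a factor 36 and
  -- `n < 16200 * 6 ^ k`. The threshold `2700 = 450 * 6` is the case `j = 0`.
  obtain ⟨j, hj, hj'⟩ : ∃ j, 450 * 6 ^ (2 * j + 1) ≤ n ∧ n < 450 * 6 ^ (2 * (j + 1) + 1) := by
    have hex : ∃ j, n < 450 * 6 ^ (2 * j + 1) := by
      refine ⟨n, (Nat.lt_pow_self (by norm_num : 1 < 6)).trans_le ?_⟩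
      calc 6 ^ n ≤ 6 ^ (2 * n + 1) := Nat.pow_le_pow_right (by norm_num) (by omega)
        _ ≤ 450 * 6 ^ (2 * n + 1) := Nat.le_mul_of_pos_left _ (by norm_num)
    have h1 := Nat.find_spec hex
    have h2 : Nat.find hex ≠ 0 := by
      intro h0
      rw [h0] at h1
      norm_num at h1
      omega
    obtain ⟨j, hj⟩ := Nat.exists_eq_succ_of_ne_zero h2
    refine ⟨j, not_lt.1 (Nat.find_min hex (by omega)), ?_⟩
    rw [hj] at h1
    exact h1
  have hpow : 6 ^ (2 * (j + 1) + 1) = 36 * 6 ^ (2 * j + 1) := by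
    rw [show 2 * (j + 1) + 1 = (2 * j + 1) + 2 by ring, pow_add]
    ring
  obtain ⟨A, hA, hAexp⟩ := hexp j
  generalize 2 * j + 1 = k at *
  let m : Bool × TreeLeaf k ≃ Fin (2 * 6 ^ k) :=
    Fintype.equivOfCardEq (by rw [Fintype.card_prod, card_treeLeaf]; simp)
  have hcard := card_joinVertex_le (m := m) hA
  have hGexp := hjoin k A m hA hAexp
  have hGconn := connected_of_le_edgeExpansion β hβ hGexp
  have hM : 0 < 2 * 6 ^ k := by positivity
  have hL := matchedLeaf_injective A m
  set r := n - Fintype.card (JoinVertex A m 12) with hr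
  have hrn : Fintype.card (JoinVertex A m 12) + r = n := by omega
  -- There are `2 * 6 ^ k` leaves, so pendant paths of length at most 8100 suffice.
  have hr' : r ≤ 8100 * (2 * 6 ^ k) := by omega
  let e : Fin n ≃ JoinVertex A m 12 ⊕ Fin r :=
    Fintype.equivOfCardEq (by rw [Fintype.card_sum, Fintype.card_fin, Fintype.card_fin, hrn])
  let P := pendantGraph (joinGraph A m 12) (matchedLeaf A m) r
  have hexp' := le_edgeExpansion_comap e _
    (le_edgeExpansion_pendantGraph (r := r) hM hL 8100 hr' β hβ hGexp)
  have : Nonempty (Fin n) := ⟨⟨0, by omega⟩⟩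
  have hconn : (P.comap e).Connected :=
    connected_of_le_edgeExpansion _ (by positivity) hexp'
  refine ⟨P.comap e, fun v => (ncard_neighborSet_comap_le e v).trans ?_, hexp', ?_⟩
  · rcases e v with x | i
    · refine (pendantGraph_degree_inl hL x).trans ?_
      split_ifs with hx
      · obtain ⟨a, rfl⟩ := hx
        -- Leaves have degree at most 2 and thus have room for a pendant path.
        have := joinGraph_degree_leaf (A := A) (m := m) (m.symm a).1 (m.symm a).2
        exact (Nat.add_le_add_right this 1).trans (by norm_num)
      · exact joinGraph_degree_le hA x
    · exact (pendantGraph_degree_inr i).trans (by norm_num)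
  · let ι : joinGraph A m 12 →g P.comap e :=
      ⟨fun v => e.symm (Sum.inl v), fun {u v} h => by
        rw [SimpleGraph.comap_adj, e.apply_symm_apply, e.apply_symm_apply]
        exact pendantGraph_adj_inl h⟩
    have hι : Function.Injective ι := fun u v h => Sum.inl_injective (e.symm.injective h)
    have hthrough := geodesics_through_of_retract (G' := P.comap e)
      (ρ := fun x => pendantRetract hM (matchedLeaf A m) (e x)) hGconn
      (fun x y h => pendantRetract_adj hM h) ι
      (fun v => by
        change pendantRetract hM (matchedLeaf A m) (e (e.symm (Sum.inl v))) = v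
        rw [e.apply_symm_apply]
        rfl)
      (joinApex A m 12)
      -- Pendant paths retract to leaves, so only the apex itself is mapped to the apex.
      (fun z hz => by
        change z = e.symm (Sum.inl (joinApex A m 12))
        rw [Equiv.eq_symm_apply]
        rcases hx : e z with x | i
        · rw [hx] at hz
          exact congrArg Sum.inl hz
        · rw [hx] at hz
          exact absurd hz (joinApex_ne_matchedLeaf A m _))
    have hpairs := card_pairs_le_maxCongestion hconn (ι (joinApex A m 12))
      ((Set.toFinite (apexPairs A m 12)).toFinset.image
        fun p => (ι (joinLeaf A m 12 false p.1), ι (joinLeaf A m 12 true p.2))) (by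
      intro p hp
      obtain ⟨q, hq, rfl⟩ := mem_image.1 hp
      exact ⟨fun h => joinLeaf_ne _ _ (hι h),
        hthrough _ _ ((Set.Finite.mem_toFinset _).1 hq)⟩)
    rw [card_image_of_injective, ← Set.ncard_eq_toFinset_card] at hpairs
    · have h1 := le_ncard_apexPairs (m := m) hA
      have h2 : (n : ℝ) ≤ 16200 * 6 ^ k := by
        rw [hpow] at hj'
        have h3 : n ≤ 16200 * 6 ^ k := by omega
        exact_mod_cast h3
      have h4 : (n : ℝ) ^ 2 ≤ (16200 * 6 ^ k) ^ 2 := by gcongr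
      rw [mul_pow] at h4
      refine le_trans ?_ hpairs
      linarith
    · intro p q h
      rw [Prod.mk.injEq] at h
      exact Prod.ext (leaf_node_injective (baseTree_inj.1 (Sum.inl_injective (hι h.1))).2)
        (leaf_node_injective (baseTree_inj.1 (Sum.inl_injective (hι h.2))).2)

theorem one_le_ncard_edgeBoundary {V : Type*} [Finite V] {G : SimpleGraph V} (hG : G.Connected)
    {S : Finset V} {u v : V} (hu : u ∈ S) (hv : v ∉ S) : 1 ≤ (edgeBoundary G S).ncard := by
  obtain ⟨w⟩ := hG.preconnected u v
  obtain ⟨d, -, h1, h2⟩ := w.exists_boundary_dart (S : Set V) hu hv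
  exact (Set.ncard_pos (Set.toFinite _)).2 ⟨s(d.fst, d.snd), d.adj, d.fst, h1, d.snd, h2, rfl⟩

/-- With at most 2700 vertices any connected graph of bounded degree would do: every cut has at
least one edge, and for the congestion the pairs with endpoint `0` suffice. -/
theorem pathGraph_spec (n : ℕ) (hn : n < 2700) :
    (∀ v, ((SimpleGraph.pathGraph (n + 1)).neighborSet v).ncard ≤ 4) ∧
    ((1 / 2700 : ℝ≥0) : ℝ≥0∞) ≤ edgeExpansion (SimpleGraph.pathGraph (n + 1)) ∧
    (2 ≤ n + 1 → 1 / (4 * 16200 ^ 2) * ((n + 1 : ℕ) : ℝ) ^ 2 ≤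
      maxCongestion (SimpleGraph.pathGraph (n + 1))) := by
  have hconn := SimpleGraph.pathGraph_connected n
  refine ⟨fun v => ?_, ?_, fun h2 => ?_⟩
  · refine le_trans (ncard_le_of_subset_range
      ![if h : (v : ℕ) + 1 < n + 1 then ⟨v + 1, h⟩ else v, ⟨v - 1, by omega⟩] ?_)
      (by norm_num : 2 ≤ 4)
    intro u hu
    rw [SimpleGraph.mem_neighborSet, SimpleGraph.pathGraph_adj] at hu
    rcases hu with h | h
    · refine ⟨0, ?_⟩
      change dite _ _ _ = _
      rw [dif_pos (by omega)]
      exact Fin.ext h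
    · exact ⟨1, Fin.ext (by change (v : ℕ) - 1 = u; omega)⟩
  · rw [le_edgeExpansion_iff]
    intro S hS
    rw [Fintype.card_fin] at hS
    rcases S.eq_empty_or_nonempty with rfl | ⟨u, hu⟩
    · simp
    · obtain ⟨v, hv⟩ : ∃ v, v ∉ S := by
        by_contra hcon
        push Not at hcon
        rw [eq_univ_of_forall hcon, card_univ, Fintype.card_fin] at hS
        omega
      have h1 : (1 : ℝ) ≤ (edgeBoundary (SimpleGraph.pathGraph (n + 1)) S).ncard := by
        exact_mod_cast one_le_ncard_edgeBoundary hconn hu hv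
      have h2 : (#S : ℝ) ≤ 2700 := by
        exact_mod_cast (by omega : #S ≤ 2700)
      push_cast
      linarith
  · have hpairs := card_pairs_le_maxCongestion hconn 0
      ((univ.erase (0 : Fin (n + 1))).image fun y => ((0 : Fin (n + 1)), y)) (by
      intro p hp
      obtain ⟨y, hy, rfl⟩ := mem_image.1 hp
      exact ⟨(ne_of_mem_erase hy).symm, fun w _ => w.start_mem_support⟩)
    rw [card_image_of_injective _ (Prod.mk_right_injective _), card_erase_of_mem (mem_univ _),
      card_univ, Fintype.card_fin, Nat.add_sub_cancel] at hpairs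
    refine le_trans ?_ hpairs
    have h1 : (1 : ℝ) ≤ n := by exact_mod_cast (by omega : 1 ≤ n)
    have h3 : (n : ℝ) ≤ 2700 := by exact_mod_cast hn.le
    push_cast
    nlinarith

theorem exists_graph_family : ∃ β : ℝ≥0, 0 < β ∧ ∃ κ₁ κ₂ : ℝ, 0 < κ₁ ∧ 0 < κ₂ ∧
    ∃ G : (n : ℕ) → SimpleGraph (Fin n), ∀ n : ℕ, 1 ≤ n →
      (G n).Connected ∧
      (∀ v, ((G n).neighborSet v).ncard ≤ 4) ∧
      (β : ℝ≥0∞) ≤ edgeExpansion (G n) ∧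
      (2 ≤ n → κ₁ * (n : ℝ) ^ 2 ≤ maxCongestion (G n)) ∧
      maxCongestion (G n) ≤ κ₂ * (n : ℝ) ^ 2 := by
  obtain ⟨β, hβ, hlarge⟩ := exists_large_graph
  have hβ' : 0 < min β (1 / 2700) := lt_min hβ (by positivity)
  have key : ∀ n : ℕ, ∃ G : SimpleGraph (Fin n), 1 ≤ n →
      (∀ v, (G.neighborSet v).ncard ≤ 4) ∧
      ((min β (1 / 2700) : ℝ≥0) : ℝ≥0∞) ≤ edgeExpansion G ∧
      (2 ≤ n → 1 / (4 * 16200 ^ 2) * (n : ℝ) ^ 2 ≤ maxCongestion G) := by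
    intro n
    by_cases hn : 2700 ≤ n
    · obtain ⟨G, h1, h2, h3⟩ := hlarge n hn
      exact ⟨G, fun _ => ⟨h1, le_trans (ENNReal.coe_le_coe.2 (min_le_left _ _)) h2, fun _ => h3⟩⟩
    · rcases n with _ | n
      · exact ⟨⊥, fun h => absurd h (by norm_num)⟩
      · obtain ⟨h1, h2, h3⟩ := pathGraph_spec n (by omega)
        exact ⟨_, fun _ => ⟨h1, le_trans (ENNReal.coe_le_coe.2 (min_le_right _ _)) h2, h3⟩⟩
  choose G hG using key
  refine ⟨_, hβ', 1 / (4 * 16200 ^ 2), 1 / 2, by norm_num, by norm_num, G, fun n hn => ?_⟩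
  obtain ⟨h1, h2, h3⟩ := hG n hn
  have : Nonempty (Fin n) := ⟨⟨0, hn⟩⟩
  refine ⟨connected_of_le_edgeExpansion _ hβ' h2, h1, h2, h3, ?_⟩
  have := maxCongestion_le (G := G n)
  rwa [Fintype.card_fin] at this

end AllSizes

theorem mainTheorem4 :
    (∃ β : ℝ≥0, 0 < β ∧ ∃ κ₁ κ₂ : ℝ, 0 < κ₁ ∧ 0 < κ₂ ∧
      ∃ G : (n : ℕ) → SimpleGraph (Fin n), ∀ n : ℕ, 1 ≤ n →
        (G n).Connected ∧
        (∀ v, ((G n).neighborSet v).ncard ≤ 4) ∧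
        (β : ℝ≥0∞) ≤ edgeExpansion (G n) ∧
        (2 ≤ n → κ₁ * (n : ℝ) ^ 2 ≤ maxCongestion (G n)) ∧
        maxCongestion (G n) ≤ κ₂ * (n : ℝ) ^ 2) ∧
    (∃ c : ℕ, 0 < c ∧ Even c ∧ ∃ K κ₁ κ₂ : ℝ, 0 < K ∧ 0 < κ₁ ∧ 0 < κ₂ ∧
      ∀ α : ℝ≥0, 0 < α → ∃ β : ℝ≥0, 0 < β ∧
        ∀ (k : ℕ) (A : SimpleGraph (Fin (2 * 6 ^ k))) (m : Bool × TreeLeaf k ≃ Fin (2 * 6 ^ k)),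
          (∀ a, (A.neighborSet a).ncard ≤ 3) → (α : ℝ≥0∞) ≤ edgeExpansion A →
          (joinGraph A m c).Connected ∧
          (∀ v, ((joinGraph A m c).neighborSet v).ncard ≤ 4) ∧
          (β : ℝ≥0∞) ≤ edgeExpansion (joinGraph A m c) ∧
          6 ^ k ≤ Fintype.card (JoinVertex A m c) ∧
          (Fintype.card (JoinVertex A m c) : ℝ) ≤ K * 6 ^ k ∧
          (6 ^ k : ℝ) ^ 2 / 2 ≤ ((apexPairs A m c).ncard : ℝ) ∧
          κ₁ * (Fintype.card (JoinVertex A m c) : ℝ) ^ 2 ≤ maxCongestion (joinGraph A m c) ∧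
          maxCongestion (joinGraph A m c) ≤ κ₂ * (Fintype.card (JoinVertex A m c) : ℝ) ^ 2) :=
  ⟨exists_graph_family, joinGraph_spec⟩
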